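/- Let $n\ge 2$ and write $\mathbb{R}^n=\mathbb{R}\times\mathbb{R}^{n-1}$ with coordinates $(t,u_1,\dots,u_{n-1})$. Let $E=\sum_{i=1}^{n-1}u_i\partial_{u_i}$ and let $\Lambda_{book}=\partial_t\wedge E$ be the book Poisson structure. For an open set $U\subseteq\mathbb{R}^n$ let $\mathfrak{X}^k(U)$ be the space of smooth $k$-vector fields on $U$ (zero for $k<0$), let $d_{book}=[\Lambda_{book},\cdot\,]$ (Schouten bracket) be the Poisson differential, and let $H^k_{book}(U)=\ker(d_{book}|_{\mathfrak{X}^k(U)})/d_{book}(\mathfrak{X}^{k-1}(U))$ be the Poisson cohomology. Every $\mu\in\mathfrak{X}^k(U)$ is uniquely $\mu=\partial_t\wedge a+b$ with $a\in\mathfrak{X}^{k-1}(U)$, $b\in\mathfrak{X}^k(U)$ and $\iota_{dt}a=0$, $\iota_{dt}b=0$. Let $\mathbb{W}^k\subseteq\mathfrak{X}^k(U)$ be the real span of the fields $u_I\partial_J=u_{i_1}\cdots u_{i_k}\,\partial_{u_{j_1}}\wedge\cdots\wedge\partial_{u_{j_k}}$ with $|I|=|J|=k$ (zero for $k<0$).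 If $(t_0,0)\in U$ and $c=\sum_J c_J\partial_J\in\mathfrak{X}^k(U)$ satisfies $\iota_{dt}c=0$, put $$T^kc|_{t_0}=\sum_J\Big(\frac1{k!}\sum_{(i_1,\dots,i_k)\in\{1,\dots,n-1\}^k}\frac{\partial^kc_J}{\partial u_{i_1}\cdots\partial u_{i_k}}(t_0,0)\,u_{i_1}\cdots u_{i_k}\Big)\partial_J\in\mathbb{W}^k .$$ Theorem 3.6. Let $U\subseteq\mathbb{R}\times\mathbb{R}^{n-1}$ be an open set such that the projection $p\colon U\to\mathbb{R}^{n-1}$, $(t,u)\mapsto u$, has connected fibers over the points of $p(U)$, and $p(U)$ is star-shaped with respect to $0\in\mathbb{R}^{n-1}$. Then for every $t_0$ with $(t_0,0)\in U$ and every integer $k\ge 0$, the map $$H^k_{book}(U)\to\frac{\mathbb{W}^{k-1}}{E\wedge\mathbb{W}^{k-2}}\oplus\frac{\mathbb{W}^{k}}{E\wedge\mathbb{W}^{k-1}},\qquad [\partial_t\wedge a+b]\mapsto[T^{k-1}a|_{t_0}]\oplus[T^kb|_{t_0}]$$ is well defined and a linear isomorphism, with inverse $[a]\oplus[b]\mapsto[\partial_t\wedge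 a+b]$ (in particular $\partial_t\wedge a+b$ is a cocycle for all $a\in\mathbb{W}^{k-1}$, $b\in\mathbb{W}^k$). -/

import Mathlib

open scoped ContDiff TensorProduct

noncomputable section

namespace BookPoisson

/-- The space `ℝ × ℝ^m` with coordinates `(t, u_1, …, u_m)`. -/
abbrev Space (m : ℕ) : Type := ℝ × (Fin m → ℝ)

/-- The labels of the coordinates: `none` is `t` and `some i` is `u_i`. -/
abbrev Coord (m : ℕ) : Type := Option (Fin m)

/-- The constant vectors `∂_t` and `∂_{u_i}`. -/
def coordVec {m : ℕ} : Coord m → Space m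
  | none => (1, 0)
  | some i => (0, Pi.single i 1)

/-- The constant covectors `dt` and `du_i`. -/
def coordCovec {m : ℕ} : Coord m → Module.Dual ℝ (Space m)
  | none => LinearMap.fst ℝ ℝ (Fin m → ℝ)
  | some i => (LinearMap.proj i).comp (LinearMap.snd ℝ ℝ (Fin m → ℝ))

/-- Extension by zero to the whole space of a function on an open set `U`; it is used only to
express smoothness and derivatives at the points of `U`. -/
def ext0 {m : ℕ} {U : TopologicalSpace.Opens (Space m)} (f : U → ℝ) : Space m → ℝ :=
  Function.extend (Subtype.val : U → Space m) f 0

section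

variable {m : ℕ} {U : TopologicalSpace.Opens (Space m)}

theorem ext0_apply (f : U → ℝ) (x : U) : ext0 f x = f x :=
  Subtype.val_injective.extend_apply f 0 x

theorem ext0_apply_of_notMem (f : U → ℝ) {y : Space m} (hy : y ∉ U) : ext0 f y = 0 :=
  Function.extend_apply' _ _ _ fun ⟨a, ha⟩ => hy (ha ▸ a.2)

theorem ext0_eventuallyEq (f : U → ℝ) (g : Space m → ℝ) (h : ∀ x : U, f x = g x) (x : U) :
    ext0 f =ᶠ[nhds (x : Space m)] g := by
  filter_upwards [U.isOpen.mem_nhds x.2] with y hy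
  rw [← h ⟨y, hy⟩]
  exact ext0_apply f ⟨y, hy⟩

theorem ext0_add (f g : U → ℝ) : ext0 (f + g) = ext0 f + ext0 g := by
  ext y
  by_cases hy : y ∈ U
  · simpa using (ext0_apply (f + g) ⟨y, hy⟩).trans
      (congrArg₂ (· + ·) (ext0_apply f ⟨y, hy⟩) (ext0_apply g ⟨y, hy⟩)).symm
  · simp [ext0_apply_of_notMem _ hy]

theorem ext0_mul (f g : U → ℝ) : ext0 (f * g) = ext0 f * ext0 g := by
  ext y
  by_cases hy : y ∈ U
  · simpa using (ext0_apply (f * g) ⟨y, hy⟩).trans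
      (congrArg₂ (· * ·) (ext0_apply f ⟨y, hy⟩) (ext0_apply g ⟨y, hy⟩)).symm
  · simp [ext0_apply_of_notMem _ hy]

theorem ext0_smul (r : ℝ) (f : U → ℝ) : ext0 (r • f) = r • ext0 f := by
  ext y
  by_cases hy : y ∈ U
  · simpa using (ext0_apply (r • f) ⟨y, hy⟩).trans
      (congrArg (r * ·) (ext0_apply f ⟨y, hy⟩)).symm
  · simp [ext0_apply_of_notMem _ hy]

end

/-- The algebra of smooth real functions on an open set `U ⊆ ℝ × ℝ^m`. -/
def smoothFunctions {m : ℕ} (U : TopologicalSpace.Opens (Space m)) : Subalgebra ℝ (U → ℝ) where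
  carrier := {f | ∀ x : U, ContDiffAt ℝ ∞ (ext0 f) x}
  add_mem' {f g} hf hg x := by
    rw [ext0_add]
    exact (hf x).add (hg x)
  mul_mem' {f g} hf hg x := by
    rw [ext0_mul]
    exact (hf x).mul (hg x)
  algebraMap_mem' r x :=
    contDiffAt_const.congr_of_eventuallyEq (ext0_eventuallyEq _ (fun _ => r) (fun _ => rfl) x)

/-- The algebra `C^∞(U)`, as a type. -/
def Smooth {m : ℕ} (U : TopologicalSpace.Opens (Space m)) : Type := smoothFunctions U

variable {m : ℕ} {U : TopologicalSpace.Opens (Space m)}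

instance : CommRing (Smooth U) := inferInstanceAs (CommRing (smoothFunctions U))

instance : Algebra ℝ (Smooth U) := inferInstanceAs (Algebra ℝ (smoothFunctions U))

/-- The underlying function of a smooth function. -/
def Smooth.toFun (f : Smooth U) : U → ℝ := Subtype.val (p := (· ∈ smoothFunctions U)) f

instance : CoeFun (Smooth U) (fun _ => U → ℝ) := ⟨Smooth.toFun⟩

theorem Smooth.contDiffAt (f : Smooth U) (x : U) : ContDiffAt ℝ ∞ (ext0 f) x :=
  Subtype.property (p := (· ∈ smoothFunctions U)) f x

/-- A smooth function on `U` from a function and a proof that it is smooth. -/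
def Smooth.mk (f : U → ℝ) (h : ∀ x : U, ContDiffAt ℝ ∞ (ext0 f) x) : Smooth U :=
  Subtype.mk (p := (· ∈ smoothFunctions U)) f h

@[simp]
theorem Smooth.toFun_mk (f : U → ℝ) (h : ∀ x : U, ContDiffAt ℝ ∞ (ext0 f) x) :
    (Smooth.mk f h).toFun = f := rfl

@[ext]
theorem Smooth.ext {f g : Smooth U} (h : ∀ x, f x = g x) : f = g :=
  Subtype.ext (p := (· ∈ smoothFunctions U)) (funext h)

@[simp]
theorem Smooth.toFun_add (f g : Smooth U) : (f + g).toFun = f.toFun + g.toFun := rfl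

@[simp]
theorem Smooth.toFun_mul (f g : Smooth U) : (f * g).toFun = f.toFun * g.toFun := rfl

@[simp]
theorem Smooth.toFun_smul (r : ℝ) (f : Smooth U) : (r • f).toFun = r • f.toFun := rfl

@[simp]
theorem Smooth.toFun_zero : (0 : Smooth U).toFun = 0 := rfl

@[simp]
theorem Smooth.toFun_one : (1 : Smooth U).toFun = 1 := rfl

/-- The partial derivative `∂f/∂t` or `∂f/∂u_i`, as a linear operator on `C^∞(U)`. -/
def pderiv (U : TopologicalSpace.Opens (Space m)) (c : Coord m) : Smooth U →ₗ[ℝ] Smooth U where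
  toFun f := Smooth.mk (fun x => fderiv ℝ (ext0 f) x (coordVec c)) fun x => by
    have h : ContDiffAt ℝ ∞ (fun y : Space m => fderiv ℝ (ext0 f) y (coordVec c)) x :=
      ((f.contDiffAt x).fderiv_right (m := ∞) le_rfl).clm_apply contDiffAt_const
    exact h.congr_of_eventuallyEq (ext0_eventuallyEq _
      (fun y : Space m => fderiv ℝ (ext0 f) y (coordVec c)) (fun _ => rfl) x)
  map_add' f g := by
    ext x
    have hf := (f.contDiffAt x).differentiableAt (by simp)
    have hg := (g.contDiffAt x).differentiableAt (by simp)
    simp [ext0_add, fderiv_add hf hg]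
  map_smul' r f := by
    ext x
    have hf := (f.contDiffAt x).differentiableAt (by simp)
    simp [ext0_smul, fderiv_const_smul hf]

/-- The coordinate function `u_i` on `U`. -/
def coordU (U : TopologicalSpace.Opens (Space m)) (i : Fin m) : Smooth U :=
  Smooth.mk (fun x => (x : Space m).2 i) fun x => by
    have h : ContDiff ℝ ∞ (fun y : Space m => y.2 i) := by fun_prop
    exact h.contDiffAt.congr_of_eventuallyEq
      (ext0_eventuallyEq _ (fun y : Space m => y.2 i) (fun _ => rfl) x)

/-- The algebra `𝔛^•(U) = C^∞(U) ⊗ ⋀^•(ℝ × ℝ^m)` of multivector fields on `U`;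
its product is the wedge product. -/
abbrev MultiVF (U : TopologicalSpace.Opens (Space m)) : Type :=
  Smooth U ⊗[ℝ] ExteriorAlgebra ℝ (Space m)

/-- The space `𝔛^k(U)` of `k`-vector fields on `U`; it is zero for `k < 0`. -/
def kVF (U : TopologicalSpace.Opens (Space m)) (k : ℤ) : Submodule ℝ (MultiVF U) :=
  Submodule.span ℝ {μ | ∃ (j : ℕ) (f : Smooth U), ∃ w ∈ ⋀[ℝ]^j (Space m),
    (j : ℤ) = k ∧ μ = f ⊗ₜ[ℝ] w}

/-- The constant coordinate vector field `∂_t` or `∂_{u_i}` on `U`. -/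
def vf (U : TopologicalSpace.Opens (Space m)) (c : Coord m) : MultiVF U :=
  1 ⊗ₜ[ℝ] ExteriorAlgebra.ι ℝ (coordVec c)

/-- The Euler vector field `E = ∑ u_i ∂_{u_i}`. -/
def euler (U : TopologicalSpace.Opens (Space m)) : MultiVF U :=
  ∑ i : Fin m, coordU U i • vf U (some i)

/-- The book Poisson structure `∂_t ∧ E`. -/
def bookBivector (U : TopologicalSpace.Opens (Space m)) : MultiVF U :=
  vf U none * euler U

/-- The partial derivative of a multivector field, applied to its coefficient functions. -/
def pderivM (U : TopologicalSpace.Opens (Space m)) (c : Coord m) : MultiVF U →ₗ[ℝ] MultiVF U :=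
  (pderiv U c).rTensor (ExteriorAlgebra ℝ (Space m))

/-- The left interior product with `dt` or `du_i`. -/
def contractL (U : TopologicalSpace.Opens (Space m)) (c : Coord m) : MultiVF U →ₗ[ℝ] MultiVF U :=
  (CliffordAlgebra.contractLeft (Q := (0 : QuadraticForm ℝ (Space m)))
    (coordCovec c)).lTensor (Smooth U)

/-- The right interior product with `dt` or `du_i`: on constant multivectors it is the odd
derivative `∂(ζ_1 ⋯ ζ_p)/∂ζ_j = (-1)^(p-j) ζ_1 ⋯ ζ_{j-1} ζ_{j+1} ⋯ ζ_p`. -/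
def contractR (U : TopologicalSpace.Opens (Space m)) (c : Coord m) : MultiVF U →ₗ[ℝ] MultiVF U :=
  ((CliffordAlgebra.contractRight (Q := (0 : QuadraticForm ℝ (Space m)))).flip
    (coordCovec c)).lTensor (Smooth U)

/-- `P, Q ↦ ∑_c (∂P/∂ζ_c) ∧ (∂Q/∂x_c)`, the sum being over all coordinates `x_c`. -/
def halfSchouten (U : TopologicalSpace.Opens (Space m)) :
    MultiVF U →ₗ[ℝ] MultiVF U →ₗ[ℝ] MultiVF U :=
  ∑ c : Coord m, (LinearMap.mul ℝ (MultiVF U)).compl₁₂ (contractR U c) (pderivM U c)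

/-- The Schouten bracket of a `p`-vector field and a `q`-vector field:
`[P, Q] = ∑_c ∂P/∂ζ_c ∧ ∂Q/∂x_c - (-1)^((p-1)(q-1)) ∑_c ∂Q/∂ζ_c ∧ ∂P/∂x_c`. -/
def schouten (U : TopologicalSpace.Opens (Space m)) (p q : ℤ) :
    MultiVF U →ₗ[ℝ] MultiVF U →ₗ[ℝ] MultiVF U :=
  halfSchouten U - ((-1 : ℝ) ^ ((p - 1) * (q - 1))) • (halfSchouten U).flip

/-- The Poisson differential `μ ↦ [Λ_book, μ]` on `k`-vector fields. -/
def dBook (U : TopologicalSpace.Opens (Space m)) (k : ℤ) : MultiVF U →ₗ[ℝ] MultiVF U :=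
  schouten U 2 k (bookBivector U)

/-- The `k`-cocycles of the complex `(𝔛^•(U), d_book)`. -/
def cocycles (U : TopologicalSpace.Opens (Space m)) (k : ℤ) : Submodule ℝ (MultiVF U) :=
  kVF U k ⊓ LinearMap.ker (dBook U k)

/-- The `k`-coboundaries of the complex `(𝔛^•(U), d_book)`. -/
def coboundaries (U : TopologicalSpace.Opens (Space m)) (k : ℤ) : Submodule ℝ (MultiVF U) :=
  (kVF U (k - 1)).map (dBook U (k - 1))

/-- The Poisson cohomology `H^k_book(U)`. -/
abbrev Cohomology (U : TopologicalSpace.Opens (Space m)) (k : ℤ) : Type :=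
  cocycles U k ⧸ (coboundaries U k).submoduleOf (cocycles U k)

/-- The class in `H^k_book(U)` of a cocycle. -/
def Cohomology.mk {k : ℤ} (μ : MultiVF U) (h : μ ∈ cocycles U k) : Cohomology U k :=
  Submodule.Quotient.mk ⟨μ, h⟩

/-- The `k`-vector fields `μ` on `U` with `ι_{dt} μ = 0`. -/
def horizontal (U : TopologicalSpace.Opens (Space m)) (k : ℤ) : Submodule ℝ (MultiVF U) :=
  kVF U k ⊓ LinearMap.ker (contractL U none)

/-- The space `𝕎^k ⊆ 𝔛^k(U)`: the span of the `k`-vector fields `u_I ∂_J` with `|I| = |J| = k`,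
that is, of all the products `(u_{i_1} ∂_{j_1}) ∧ ⋯ ∧ (u_{i_k} ∂_{j_k})`.  It is zero for `k < 0`.
Tuples that are not increasing only contribute redundant generators. -/
def polyW (U : TopologicalSpace.Opens (Space m)) (k : ℤ) : Submodule ℝ (MultiVF U) :=
  Submodule.span ℝ {μ | ∃ (j : ℕ) (I J : Fin j → Fin m), (j : ℤ) = k ∧
    μ = (∏ s, coordU U (I s)) ⊗ₜ[ℝ]
      ExteriorAlgebra.ιMulti ℝ j (fun s => coordVec (some (J s)) : Fin j → Space m)}

/-- The subspace `E ∧ 𝕎^k`. -/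
def eulerW (U : TopologicalSpace.Opens (Space m)) (k : ℤ) : Submodule ℝ (MultiVF U) :=
  (polyW U k).map (LinearMap.mulLeft ℝ (euler U))

/-- The quotient `𝕎^k / (E ∧ 𝕎^(k-1))`. -/
abbrev QuotW (U : TopologicalSpace.Opens (Space m)) (k : ℤ) : Type :=
  polyW U k ⧸ (eulerW U (k - 1)).submoduleOf (polyW U k)

/-- The class in `𝕎^k / (E ∧ 𝕎^(k-1))` of an element of `𝕎^k`. -/
def QuotW.mk {k : ℤ} (a : MultiVF U) (h : a ∈ polyW U k) : QuotW U k :=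
  Submodule.Quotient.mk ⟨a, h⟩

/-- The iterated partial derivative `∂^k/∂u_{i_1} ⋯ ∂u_{i_k}`. -/
def iterPderiv (U : TopologicalSpace.Opens (Space m)) {k : ℕ} (I : Fin k → Fin m) :
    Smooth U →ₗ[ℝ] Smooth U :=
  (List.ofFn fun s => pderiv U (some (I s))).foldr (fun D F => D.comp F) LinearMap.id

/-- Evaluation at a point of `U`. -/
def evalAt (x : U) : Smooth U →ₗ[ℝ] ℝ where
  toFun f := f x
  map_add' f g := congrFun (Smooth.toFun_add f g) x
  map_smul' r f := congrFun (Smooth.toFun_smul r f) x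

@[simp]
theorem evalAt_apply (x : U) (f : Smooth U) : evalAt x f = f x := rfl

/-- The Taylor operator on functions, evaluated at `t = t₀`, where `x₀ = (t₀, 0)`:
`f ↦ (1/k!) ∑_{(i_1, …, i_k)} (∂^k f/∂u_{i_1} ⋯ ∂u_{i_k})(t₀, 0) u_{i_1} ⋯ u_{i_k}`. -/
def taylorFun (x₀ : U) (k : ℕ) : Smooth U →ₗ[ℝ] Smooth U :=
  ((k.factorial : ℝ)⁻¹) • ∑ I : Fin k → Fin m,
    ((evalAt x₀).comp (iterPderiv U I)).smulRight (∏ s, coordU U (I s))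

/-- The operator `μ ↦ T^k μ |_{t = t₀}`, where `x₀ = (t₀, 0)`, which applies the Taylor operator of
order `k` to the coefficient functions of `μ`.  It is zero for `k < 0`. -/
def taylorAt (x₀ : U) : ℤ → (MultiVF U →ₗ[ℝ] MultiVF U)
  | Int.ofNat k => (taylorFun x₀ k).rTensor (ExteriorAlgebra ℝ (Space m))
  | Int.negSucc _ => 0

end BookPoisson

end

/-! ### Calculus on functions: the Euler operator, homogeneous polynomials, Taylor operators. -/

noncomputable section
namespace BookPoisson

variable {m : ℕ} {U : TopologicalSpace.Opens (Space m)}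

/-! Let E act on multivector fields through their coefficients and let a dot denote the derivative
in t. On k-vector fields the differential is d(∂_t∧a + b) = ∂_t∧((E - k)b + E∧ȧ) - E∧ḃ
(`dBook_vf_mul_add`), so everything reduces to three operators: ∂_t, E - k and E∧.

The derivative ∂_t is surjective with kernel the functions of u: the fibres are intervals, so there
is a smooth section σ of the projection, and one integrates from it (`exists_pderiv_none_eq`). On
functions of u, the kernel of E - k is the space of homogeneous polynomials of degree k, and these
also complement its image (`mem_homPoly_of_eulerShift_eq_zero`, `exists_eulerShift_add_homPoly`);
this uses the star-shaped base. The operator E∧ is a Koszul differential, exact below degree m = n -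
1 and, in degree m, on fields vanishing on the axis u = 0 (`exists_euler_mul_eq`).

These facts put a cocycle into normal form (`exists_sub_mem_coboundaries`). From E∧ḃ = 0 one gets ḃ
= E∧c, and two integrations of c in t give a coboundary that makes b independent of t. Then E∧ȧ =
-(E - k)b is independent of t too, so ȧ may be replaced there by its restriction g to the section.
Write g = (E - (k - 1))h + q with q polynomial. Now (E - k)(b + E∧h) = -E∧q, and the Taylor operator
T^k annihilates the left side and fixes the right; hence E∧q = 0 and b + E∧h is polynomial. A
further coboundary reduces to E∧ȧ = 0, where the same tools make a polynomial (`exists_polyW_add`).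

The Taylor operators satisfy T^k(E - k) = 0 and T^k(E∧x) = E∧T^(k-1)x, so they send coboundaries
into E∧𝕎 (`taylorMap_coboundaries`), and they are the identity on 𝕎. Conversely, elements of E∧𝕎
give coboundaries (`vf_mul_add_mem_coboundaries`). Together with the normal form this gives
bijectivity and the stated inverse. -/

@[simp]
theorem Smooth.toFun_sub (f g : Smooth U) : (f - g).toFun = f.toFun - g.toFun := rfl

@[simp]
theorem Smooth.toFun_sum {ι : Type*} (s : Finset ι) (f : ι → Smooth U) :
    (∑ i ∈ s, f i).toFun = ∑ i ∈ s, (f i).toFun := by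
  ext x
  rw [Finset.sum_apply]
  exact map_sum (evalAt x) f s

@[simp]
theorem coordU_toFun (i : Fin m) (x : U) : (coordU U i).toFun x = (x : Space m).2 i := rfl

theorem pderiv_toFun (c : Coord m) (f : Smooth U) (x : U) :
    (pderiv U c f).toFun x = fderiv ℝ (ext0 f) x (coordVec c) := rfl

theorem Smooth.differentiableAt (f : Smooth U) (x : U) : DifferentiableAt ℝ (ext0 f) x :=
  (f.contDiffAt x).differentiableAt (by simp)

theorem pderiv_mul (c : Coord m) (f g : Smooth U) :
    pderiv U c (f * g) = f * pderiv U c g + g * pderiv U c f := by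
  ext x
  simp [pderiv_toFun, ext0_mul, fderiv_mul (f.differentiableAt x) (g.differentiableAt x), ext0_apply]

/-- Derivatives may be computed on any function that agrees with a smooth function on `U`. -/
theorem pderiv_eq_of_forall (c : Coord m) (f : Smooth U) (g : Space m → ℝ)
    (h : ∀ x : U, f x = g x) (x : U) :
    (pderiv U c f).toFun x = fderiv ℝ g x (coordVec c) := by
  rw [pderiv_toFun, (ext0_eventuallyEq f.toFun g h x).fderiv_eq]

theorem pderiv_algebraMap (c : Coord m) (r : ℝ) : pderiv U c (algebraMap ℝ (Smooth U) r) = 0 := by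
  ext x
  rw [pderiv_eq_of_forall c _ (fun _ => r) (fun _ => rfl)]
  simp

@[simp]
theorem pderiv_one (c : Coord m) : pderiv U c (1 : Smooth U) = 0 := by
  rw [← map_one (algebraMap ℝ (Smooth U)), pderiv_algebraMap]

theorem pderiv_coordU (c : Coord m) (i : Fin m) :
    pderiv U c (coordU U i) = if c = some i then 1 else 0 := by
  ext x
  rw [pderiv_eq_of_forall c _ (fun y => y.2 i) (fun _ => rfl)]
  have : HasFDerivAt (fun y : Space m => y.2 i)
      ((ContinuousLinearMap.proj (R := ℝ) (φ := fun _ : Fin m => ℝ) i).comp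
        (ContinuousLinearMap.snd ℝ ℝ (Fin m → ℝ))) (x : Space m) :=
    ((ContinuousLinearMap.proj (R := ℝ) (φ := fun _ : Fin m => ℝ) i).comp
      (ContinuousLinearMap.snd ℝ ℝ (Fin m → ℝ))).hasFDerivAt
  rw [this.fderiv]
  rcases c with _ | j
  · simp [coordVec]
  · by_cases h : j = i
    · subst h; simp [coordVec]
    · simp [coordVec, h, Ne.symm h]

@[simp]
theorem pderiv_none_coordU (i : Fin m) : pderiv U none (coordU U i) = 0 := by
  simp [pderiv_coordU]

theorem pderiv_comm (c c' : Coord m) (f : Smooth U) :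
    pderiv U c (pderiv U c' f) = pderiv U c' (pderiv U c f) := by
  ext x
  have key (a b : Coord m) : (pderiv U a (pderiv U b f)).toFun x =
      fderiv ℝ (fderiv ℝ (ext0 f)) x (coordVec a) (coordVec b) := by
    rw [pderiv_eq_of_forall a (pderiv U b f) (fun y => fderiv ℝ (ext0 f) y (coordVec b))
      (fun _ => rfl)]
    have hd : DifferentiableAt ℝ (fderiv ℝ (ext0 f)) x :=
      ((f.contDiffAt x).fderiv_right (m := ∞) le_rfl).differentiableAt (by simp)
    rw [fderiv_clm_apply hd (differentiableAt_const _)]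
    simp
  rw [key, key]
  exact ((f.contDiffAt x).isSymmSndFDerivAt
    (by simpa using WithTop.coe_le_coe.2 (le_top (a := (2 : ℕ∞))))) _ _

/-- The Euler vector field acting on functions. -/
def eulerOp (U : TopologicalSpace.Opens (Space m)) : Smooth U →ₗ[ℝ] Smooth U :=
  ∑ i : Fin m, (LinearMap.mulLeft ℝ (coordU U i)).comp (pderiv U (some i))

theorem eulerOp_apply (f : Smooth U) :
    eulerOp U f = ∑ i, coordU U i * pderiv U (some i) f := by
  simp [eulerOp, LinearMap.sum_apply]

/-- The operator `f ↦ E f + r f`. -/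
def eulerShift (U : TopologicalSpace.Opens (Space m)) (r : ℝ) : Smooth U →ₗ[ℝ] Smooth U :=
  eulerOp U + r • LinearMap.id

theorem eulerShift_apply (r : ℝ) (f : Smooth U) : eulerShift U r f = eulerOp U f + r • f := rfl

theorem eulerOp_mul (f g : Smooth U) :
    eulerOp U (f * g) = f * eulerOp U g + g * eulerOp U f := by
  simp only [eulerOp_apply, pderiv_mul, Finset.mul_sum, ← Finset.sum_add_distrib]
  exact Finset.sum_congr rfl fun i _ => by ring

theorem eulerOp_coordU (i : Fin m) : eulerOp U (coordU U i) = coordU U i := by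
  simp [eulerOp_apply, pderiv_coordU]

/-- Since E u_i = u_i, multiplication by u_i moves the shift by one. Inductions on the degree use
this to climb, and `pderiv_some_eulerShift` to descend. -/
theorem eulerShift_coordU_mul (r : ℝ) (i : Fin m) (f : Smooth U) :
    eulerShift U r (coordU U i * f) = coordU U i * eulerShift U (r + 1) f := by
  simp only [eulerShift_apply, eulerOp_mul, eulerOp_coordU, mul_add, mul_smul_comm, add_smul,
    one_smul]
  ring

theorem pderiv_none_eulerOp (f : Smooth U) :
    pderiv U none (eulerOp U f) = eulerOp U (pderiv U none f) := by
  simp [eulerOp_apply, pderiv_mul, pderiv_comm none]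

theorem pderiv_none_eulerShift (r : ℝ) (f : Smooth U) :
    pderiv U none (eulerShift U r f) = eulerShift U r (pderiv U none f) := by
  simp [eulerShift_apply, pderiv_none_eulerOp]

theorem pderiv_some_eulerOp (j : Fin m) (f : Smooth U) :
    pderiv U (some j) (eulerOp U f) = eulerOp U (pderiv U (some j) f) + pderiv U (some j) f := by
  simp [eulerOp_apply, pderiv_mul, pderiv_comm (some j), Finset.sum_add_distrib, pderiv_coordU]

theorem pderiv_some_eulerShift (r : ℝ) (j : Fin m) (f : Smooth U) :
    pderiv U (some j) (eulerShift U r f) = eulerShift U (r + 1) (pderiv U (some j) f) := by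
  simp only [eulerShift_apply, map_add, pderiv_some_eulerOp, map_smul, add_smul, one_smul]
  abel

/-- The functions on `U` that do not depend on `t`, to first order. -/
def basic (U : TopologicalSpace.Opens (Space m)) : Submodule ℝ (Smooth U) :=
  LinearMap.ker (pderiv U none)

theorem mem_basic {f : Smooth U} : f ∈ basic U ↔ pderiv U none f = 0 := Iff.rfl

theorem coordU_mul_mem_basic (i : Fin m) {f : Smooth U} (hf : f ∈ basic U) :
    coordU U i * f ∈ basic U := by
  rw [mem_basic] at *
  simp [pderiv_mul, hf]

theorem pderiv_mem_basic (c : Coord m) {f : Smooth U} (hf : f ∈ basic U) :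
    pderiv U c f ∈ basic U := by
  rw [mem_basic] at *
  rw [pderiv_comm, hf, map_zero]

/-- The homogeneous polynomials of degree `k` in the coordinates `u_i`. -/
def homPoly (U : TopologicalSpace.Opens (Space m)) (k : ℕ) : Submodule ℝ (Smooth U) :=
  Submodule.span ℝ (Set.range fun I : Fin k → Fin m => ∏ s, coordU U (I s))

theorem coordU_mul_mem_homPoly (i : Fin m) {k : ℕ} {q : Smooth U} (hq : q ∈ homPoly U k) :
    coordU U i * q ∈ homPoly U (k + 1) := by
  suffices homPoly U k ≤ (homPoly U (k + 1)).comap (LinearMap.mulLeft ℝ (coordU U i)) from this hq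
  rw [homPoly, Submodule.span_le]
  rintro _ ⟨I, rfl⟩
  exact Submodule.subset_span ⟨Fin.cons i I, by simp [Fin.prod_univ_succ]⟩

theorem algebraMap_mem_homPoly_zero (r : ℝ) : algebraMap ℝ (Smooth U) r ∈ homPoly U 0 := by
  rw [Algebra.algebraMap_eq_smul_one]
  exact Submodule.smul_mem _ _ (Submodule.subset_span ⟨Fin.elim0, by simp⟩)

theorem eq_algebraMap_of_mem_homPoly_zero {q : Smooth U} (hq : q ∈ homPoly U 0) :
    ∃ r : ℝ, q = algebraMap ℝ (Smooth U) r := by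
  suffices homPoly U 0 ≤ LinearMap.range (Algebra.linearMap ℝ (Smooth U)) by
    obtain ⟨r, hr⟩ := this hq
    exact ⟨r, hr.symm⟩
  rw [homPoly, Submodule.span_le]
  rintro _ ⟨I, rfl⟩
  exact ⟨1, by simp⟩

theorem pderiv_none_homPoly {k : ℕ} {q : Smooth U} (hq : q ∈ homPoly U k) : q ∈ basic U := by
  suffices homPoly U k ≤ basic U from this hq
  rw [homPoly, Submodule.span_le]
  rintro _ ⟨I, rfl⟩
  clear hq
  induction k with
  | zero => simp [basic]
  | succ k ih =>
    simp only [Fin.prod_univ_succ]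
    exact coordU_mul_mem_basic _ (ih fun s => I s.succ)

theorem pderiv_some_mem_homPoly (j : Fin m) {k : ℕ} {q : Smooth U} (hq : q ∈ homPoly U (k + 1)) :
    pderiv U (some j) q ∈ homPoly U k := by
  suffices homPoly U (k + 1) ≤ (homPoly U k).comap (pderiv U (some j)) from this hq
  rw [homPoly, Submodule.span_le]
  rintro _ ⟨I, rfl⟩
  clear hq
  have hone : (1 : Smooth U) ∈ homPoly U 0 := by simpa using algebraMap_mem_homPoly_zero (U := U) 1
  induction k with
  | zero =>
    simp only [SetLike.mem_coe, Submodule.mem_comap, Fin.prod_univ_succ, Fin.prod_univ_zero, mul_one,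
      pderiv_coordU]
    split_ifs
    · exact hone
    · exact Submodule.zero_mem _
  | succ k ih =>
    simp only [SetLike.mem_coe, Submodule.mem_comap] at ih ⊢
    rw [Fin.prod_univ_succ, pderiv_mul, pderiv_coordU]
    refine Submodule.add_mem _ (coordU_mul_mem_homPoly _ (ih _)) ?_
    split_ifs
    · rw [mul_one]
      exact Submodule.subset_span ⟨_, rfl⟩
    · simp

theorem eulerOp_homPoly {k : ℕ} {q : Smooth U} (hq : q ∈ homPoly U k) :
    eulerOp U q = (k : ℝ) • q := by
  suffices homPoly U k ≤ LinearMap.ker (eulerOp U - (k : ℝ) • LinearMap.id) by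
    simpa [sub_eq_zero] using this hq
  rw [homPoly, Submodule.span_le]
  rintro _ ⟨I, rfl⟩
  simp only [SetLike.mem_coe, LinearMap.mem_ker, LinearMap.sub_apply, LinearMap.smul_apply,
    LinearMap.id_apply, sub_eq_zero]
  clear hq
  induction k with
  | zero => simp [eulerOp_apply]
  | succ k ih =>
    rw [Fin.prod_univ_succ, eulerOp_mul, eulerOp_coordU, ih]
    push_cast
    simp only [mul_smul_comm, add_smul, one_smul]
    ring

theorem iterPderiv_zero (I : Fin 0 → Fin m) : iterPderiv U I = LinearMap.id := by
  simp [iterPderiv]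

theorem iterPderiv_cons {k : ℕ} (i : Fin m) (I : Fin k → Fin m) (f : Smooth U) :
    iterPderiv U (Fin.cons i I : Fin (k + 1) → Fin m) f = pderiv U (some i) (iterPderiv U I f) := by
  simp [iterPderiv, List.ofFn_succ]

theorem iterPderiv_pderiv {k : ℕ} (I : Fin k → Fin m) (c : Coord m) (f : Smooth U) :
    iterPderiv U I (pderiv U c f) = pderiv U c (iterPderiv U I f) := by
  induction k with
  | zero => simp [iterPderiv_zero]
  | succ k ih =>
    rw [← Fin.cons_self_tail I, iterPderiv_cons, iterPderiv_cons, ih, pderiv_comm]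

theorem taylorFun_zero (x₀ : U) (f : Smooth U) :
    taylorFun x₀ 0 f = algebraMap ℝ (Smooth U) (f x₀) := by
  simp [taylorFun, iterPderiv_zero, Algebra.algebraMap_eq_smul_one]

/-- Splitting off the first index of the tuple gives a recursion, from which the later properties of
the Taylor operators follow without multi-index combinatorics. -/
theorem taylorFun_succ (x₀ : U) (k : ℕ) (f : Smooth U) :
    taylorFun x₀ (k + 1) f =
      ((k : ℝ) + 1)⁻¹ • ∑ i, coordU U i * taylorFun x₀ k (pderiv U (some i) f) := by
  simp only [taylorFun, LinearMap.smul_apply, LinearMap.sum_apply, LinearMap.smulRight_apply,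
    LinearMap.comp_apply, mul_smul_comm, ← Finset.smul_sum, smul_smul]
  congr 1
  · rw [Nat.factorial_succ]; push_cast; rw [mul_inv]
  · simp only [Finset.mul_sum]
    rw [← Finset.sum_product', ← (Fin.consEquiv fun _ => Fin m).sum_comp]
    refine Finset.sum_congr rfl fun p _ => ?_
    simp [Fin.consEquiv, iterPderiv_cons, iterPderiv_pderiv, Fin.prod_univ_succ]

theorem taylorFun_mem_homPoly (x₀ : U) (k : ℕ) (f : Smooth U) :
    taylorFun x₀ k f ∈ homPoly U k := by
  simp only [taylorFun, LinearMap.smul_apply, LinearMap.sum_apply, LinearMap.smulRight_apply]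
  exact Submodule.smul_mem _ _ (Submodule.sum_mem _ fun I _ =>
    Submodule.smul_mem _ _ (Submodule.subset_span ⟨I, rfl⟩))

/-- By induction the recursion becomes (k + 1)⁻¹ E q, which is q by Euler's identity. -/
theorem taylorFun_homPoly (x₀ : U) {k : ℕ} {q : Smooth U} (hq : q ∈ homPoly U k) :
    taylorFun x₀ k q = q := by
  induction k generalizing q with
  | zero =>
    obtain ⟨r, rfl⟩ := eq_algebraMap_of_mem_homPoly_zero hq
    rw [taylorFun_zero]
    rfl
  | succ k ih =>
    rw [taylorFun_succ]
    simp only [ih (pderiv_some_mem_homPoly _ hq)]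
    rw [← eulerOp_apply, eulerOp_homPoly hq, smul_smul]
    push_cast
    rw [inv_mul_cancel₀ (by positivity), one_smul]

/-- Each ∂_i in the recursion turns E - (k + 1) into E - k, until only E is left; and E f vanishes
where u = 0. -/
theorem taylorFun_eulerShift (x₀ : U) (hx₀ : (x₀ : Space m).2 = 0) (k : ℕ) (f : Smooth U) :
    taylorFun x₀ k (eulerShift U (-(k : ℝ)) f) = 0 := by
  induction k generalizing f with
  | zero =>
    rw [taylorFun_zero]
    simp [eulerShift_apply, eulerOp_apply, hx₀]
  | succ k ih =>
    rw [taylorFun_succ]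
    simp only [pderiv_some_eulerShift]
    have : (-((k + 1 : ℕ) : ℝ) + 1) = -(k : ℝ) := by push_cast; ring
    simp only [this, ih, mul_zero, Finset.sum_const_zero, smul_zero]

theorem taylorFun_zero_coordU_mul (x₀ : U) (hx₀ : (x₀ : Space m).2 = 0) (i : Fin m)
    (f : Smooth U) : taylorFun x₀ 0 (coordU U i * f) = 0 := by
  rw [taylorFun_zero]
  simp [hx₀]

theorem taylorFun_succ_coordU_mul (x₀ : U) (hx₀ : (x₀ : Space m).2 = 0) (k : ℕ) (i : Fin m)
    (f : Smooth U) : taylorFun x₀ (k + 1) (coordU U i * f) = coordU U i * taylorFun x₀ k f := by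
  have hsum (k : ℕ) (f : Smooth U) : ∑ j, coordU U j * taylorFun x₀ k (pderiv U (some j) f) =
      ((k : ℝ) + 1) • taylorFun x₀ (k + 1) f := by
    rw [taylorFun_succ, smul_smul, mul_inv_cancel₀ (by positivity), one_smul]
  have hstep (k : ℕ) (f : Smooth U) : taylorFun x₀ (k + 1) (coordU U i * f) =
      ((k : ℝ) + 1)⁻¹ • (coordU U i * taylorFun x₀ k f +
        ∑ j, coordU U j * taylorFun x₀ k (coordU U i * pderiv U (some j) f)) := by
    rw [taylorFun_succ]
    simp only [pderiv_mul, map_add, mul_add, Finset.sum_add_distrib]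
    rw [add_comm (coordU U i * _)]
    congr 2
    rw [Finset.sum_eq_single i]
    · simp [pderiv_coordU]
    · intro j _ hj
      simp [pderiv_coordU, hj]
    · simp
  induction k generalizing f with
  | zero =>
    rw [hstep]
    simp [taylorFun_zero_coordU_mul x₀ hx₀]
  | succ k ih =>
    -- The derivative hitting u_i contributes u_i T^(k+1) f once; by induction the remaining terms
    -- contribute it k + 1 times. The total k + 2 cancels the prefactor.
    rw [hstep]
    simp only [ih, mul_left_comm _ (coordU U i)]
    rw [← Finset.mul_sum, hsum, mul_smul_comm, ← one_smul ℝ (coordU U i * taylorFun x₀ (k + 1) f),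
      smul_smul, ← add_smul, smul_smul]
    congr 1
    push_cast
    field_simp
    ring

end BookPoisson
end

/-! ### Analytic tools: integrals depending smoothly on parameters, and smooth selections. -/

noncomputable section

section ParametricIntegral

open MeasureTheory Set Filter Topology

theorem isOpen_setOf_forall_mem_Icc {X : Type} [TopologicalSpace X] {Ω : Set (X × ℝ)} (hΩ : IsOpen Ω) :
    IsOpen {p : X | ∀ s ∈ Icc (0 : ℝ) 1, (p, s) ∈ Ω} := by
  rw [isOpen_iff_mem_nhds]
  intro p hp
  obtain ⟨u, v, hu, -, hpu, hv, huv⟩ := generalized_tube_lemma (s := {p}) isCompact_singleton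
    (isCompact_Icc (a := (0 : ℝ)) (b := 1)) hΩ (by rintro ⟨q, s⟩ ⟨rfl, hs⟩; exact hp s hs)
  filter_upwards [hu.mem_nhds (hpu rfl)] with q hq s hs
  exact huv ⟨hq, hv hs⟩

variable {X : Type} [NormedAddCommGroup X] [NormedSpace ℝ X]

/-- Differentiation under the integral sign over `[0, 1]`. -/
theorem hasFDerivAt_integral_of_contDiffOn {E : Type} [NormedAddCommGroup E] [NormedSpace ℝ E]
    {Ω : Set (X × ℝ)} (hΩ : IsOpen Ω) {F : X × ℝ → E} (hF : ContDiffOn ℝ ∞ F Ω) {p : X}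
    (hp : ∀ s ∈ Icc (0 : ℝ) 1, (p, s) ∈ Ω) :
    HasFDerivAt (fun q => ∫ s in (0 : ℝ)..1, F (q, s))
      (∫ s in (0 : ℝ)..1, (fderiv ℝ F (p, s)).comp (ContinuousLinearMap.inl ℝ X ℝ)) p := by
  have hcont : ContinuousOn (fun z : X × ℝ => (fderiv ℝ F z).comp (ContinuousLinearMap.inl ℝ X ℝ))
      Ω := ((hF.continuousOn_fderiv_of_isOpen hΩ (by simp)).clm_comp continuousOn_const)
  have hmap : ∀ q : X, ContinuousOn (fun s : ℝ => (q, s)) (Icc 0 1) := fun q => by fun_prop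
  have hcp : ContinuousOn (fun s : ℝ => (fderiv ℝ F (p, s)).comp (ContinuousLinearMap.inl ℝ X ℝ))
      (Icc 0 1) := hcont.comp (hmap p) hp
  obtain ⟨C, hC⟩ := isCompact_Icc.exists_bound_of_continuousOn hcp
  -- Shrinking Ω to where the partial derivative is smaller than C + 1 and applying the tube lemma
  -- gives one neighbourhood of p on which the constant C + 1 dominates for all s.
  obtain ⟨Ω', hΩ', hΩ'e⟩ : ∃ W, IsOpen W ∧ W = Ω ∩
      (fun z => ‖(fderiv ℝ F z).comp (ContinuousLinearMap.inl ℝ X ℝ)‖) ⁻¹' Iio (C + 1) :=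
    ⟨_, hcont.norm.isOpen_inter_preimage hΩ isOpen_Iio, rfl⟩
  have hpΩ' : p ∈ {q : X | ∀ s ∈ Icc (0 : ℝ) 1, (q, s) ∈ Ω'} := fun s hs => by
    rw [hΩ'e]
    exact ⟨hp s hs, (hC s hs).trans_lt (lt_add_one C)⟩
  have hN := (isOpen_setOf_forall_mem_Icc hΩ').mem_nhds hpΩ'
  have hsub : ∀ s : ℝ, s ∈ uIoc (0 : ℝ) 1 → s ∈ Icc (0 : ℝ) 1 := fun s hs => by
    rw [uIoc_of_le zero_le_one] at hs
    exact Ioc_subset_Icc_self hs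
  have hint : ∀ q, (∀ s ∈ Icc (0 : ℝ) 1, (q, s) ∈ Ω) →
      IntervalIntegrable (fun s => F (q, s)) volume 0 1 := fun q hq => by
    refine ContinuousOn.intervalIntegrable ?_
    rw [uIcc_of_le zero_le_one]
    exact hF.continuousOn.comp (hmap q) hq
  refine (intervalIntegral.hasFDerivAt_integral_of_dominated_of_fderiv_le (𝕜 := ℝ) (μ := volume)
    (F := fun q s => F (q, s))
    (F' := fun q s => (fderiv ℝ F (q, s)).comp (ContinuousLinearMap.inl ℝ X ℝ))
    (bound := fun _ => C + 1) hN ?_ (hint p hp) ?_ ?_ intervalIntegrable_const ?_)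
  · filter_upwards [hN] with q hq
    exact (hint q fun s hs => (hΩ'e ▸ hq s hs : (q, s) ∈ Ω ∩ _).1).def'.aestronglyMeasurable
  · have : IntervalIntegrable
        (fun s : ℝ => (fderiv ℝ F (p, s)).comp (ContinuousLinearMap.inl ℝ X ℝ)) volume 0 1 := by
      refine ContinuousOn.intervalIntegrable ?_
      rwa [uIcc_of_le zero_le_one]
    exact this.def'.aestronglyMeasurable
  · refine Eventually.of_forall fun s hs q hq => ?_
    have h := hq s (hsub s hs)
    rw [hΩ'e] at h
    exact (mem_Iio.1 h.2).le
  · refine Eventually.of_forall fun s hs q hq => ?_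
    have hqs : (q, s) ∈ Ω := (hΩ'e ▸ hq s (hsub s hs) : (q, s) ∈ Ω ∩ _).1
    have h1 : HasFDerivAt F (fderiv ℝ F (q, s)) (q, s) :=
      ((hF.contDiffAt (hΩ.mem_nhds hqs)).differentiableAt (by simp)).hasFDerivAt
    exact h1.comp q (hasFDerivAt_prodMk_left q s)

/-- The target space is quantified inside the induction because the derivative of the integral is
again such an integral, with values in a space of linear maps. -/
theorem contDiffOn_integral_nat {Ω : Set (X × ℝ)} (hΩ : IsOpen Ω) (n : ℕ) :
    ∀ {E : Type} [NormedAddCommGroup E] [NormedSpace ℝ E] {F : X × ℝ → E},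
      ContDiffOn ℝ ∞ F Ω → ContDiffOn ℝ n (fun q => ∫ s in (0 : ℝ)..1, F (q, s))
        {p : X | ∀ s ∈ Icc (0 : ℝ) 1, (p, s) ∈ Ω} := by
  induction n with
  | zero =>
    intro E _ _ F hF
    rw [Nat.cast_zero, contDiffOn_zero]
    exact fun p hp => (hasFDerivAt_integral_of_contDiffOn hΩ hF hp).continuousAt.continuousWithinAt
  | succ n ih =>
    intro E _ _ F hF
    have hN := isOpen_setOf_forall_mem_Icc hΩ
    rw [Nat.cast_succ, contDiffOn_succ_iff_fderiv_of_isOpen hN]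
    refine ⟨fun p hp =>
      (hasFDerivAt_integral_of_contDiffOn hΩ hF hp).differentiableAt.differentiableWithinAt,
      fun h => absurd h (by simp), ?_⟩
    have hF' : ContDiffOn ℝ ∞
        (fun z : X × ℝ => (fderiv ℝ F z).comp (ContinuousLinearMap.inl ℝ X ℝ)) Ω :=
      (hF.fderiv_of_isOpen hΩ (by simp)).clm_comp contDiffOn_const
    exact (ih hF').congr fun p hp => (hasFDerivAt_integral_of_contDiffOn hΩ hF hp).fderiv

/-- An integral over `[0, 1]` depends smoothly on parameters. -/
theorem contDiffAt_integral {Ω : Set (X × ℝ)} (hΩ : IsOpen Ω) {E : Type} [NormedAddCommGroup E]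
    [NormedSpace ℝ E] {F : X × ℝ → E} (hF : ContDiffOn ℝ ∞ F Ω) {p : X}
    (hp : ∀ s ∈ Icc (0 : ℝ) 1, (p, s) ∈ Ω) :
    ContDiffAt ℝ ∞ (fun q => ∫ s in (0 : ℝ)..1, F (q, s)) p :=
  (contDiffOn_infty.2 fun n => contDiffOn_integral_nat hΩ n hF).contDiffAt
    ((isOpen_setOf_forall_mem_Icc hΩ).mem_nhds hp)

end ParametricIntegral

section Selection

open Set Filter Topology Manifold

/-- A family of convex sets over an open set which has smooth selections locally has a smooth
selection. -/
theorem exists_contDiffAt_forall_mem_convex {X F : Type} [NormedAddCommGroup X] [NormedSpace ℝ X]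
    [FiniteDimensional ℝ X] [NormedAddCommGroup F] [NormedSpace ℝ F]
    (V : TopologicalSpace.Opens X) (t : X → Set F)
    (ht : ∀ x ∈ V, Convex ℝ (t x))
    (hloc : ∀ x ∈ V, ∃ g : X → F, ∃ N ∈ 𝓝 x, ContDiffOn ℝ ∞ g N ∧ ∀ y ∈ N, g y ∈ t y) :
    ∃ g : X → F, ∀ x ∈ V, ContDiffAt ℝ ∞ g x ∧ g x ∈ t x := by
  have : LocallyCompactSpace V := V.isOpen.locallyCompactSpace
  have : ProperSpace X := FiniteDimensional.proper ℝ X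
  have : SecondCountableTopology X := inferInstance
  have : SecondCountableTopology V := inferInstance
  obtain ⟨g, hg⟩ := exists_contMDiffMap_forall_mem_convex_of_local (n := (⊤ : ℕ∞)) (F := F) (M := V)
    𝓘(ℝ, X) (t := fun x => t x) (fun x => ht x x.2) (fun x => by
      obtain ⟨g, N, hN, hgN, hgt⟩ := hloc x x.2
      obtain ⟨N', hN'N, hN', hxN'⟩ := mem_nhds_iff.1 hN
      refine ⟨Subtype.val ⁻¹' N', (hN'.preimage continuous_subtype_val).mem_nhds hxN',
        fun y => g y, fun y hy => ?_, fun y hy => hgt y (hN'N hy)⟩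
      refine ContMDiffAt.contMDiffWithinAt ?_
      refine contMDiffAt_subtype_iff (f := g).2 ?_
      exact ((hgN.mono hN'N).contDiffAt (hN'.mem_nhds hy)).contMDiffAt)
  refine ⟨Function.extend (Subtype.val : V → X) g 0, fun x hx => ⟨?_, ?_⟩⟩
  · rw [← contMDiffAt_iff_contDiffAt]
    refine (contMDiffAt_subtype_iff (U := V) (x := ⟨x, hx⟩)).1 ?_
    refine (g.contMDiff ⟨x, hx⟩).congr_of_eventuallyEq ?_
    exact Eventually.of_forall fun y => Subtype.val_injective.extend_apply g 0 y
  · rw [show x = ((⟨x, hx⟩ : V) : X) from rfl, Subtype.val_injective.extend_apply]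
    exact hg ⟨x, hx⟩

end Selection

end

/-! ### The equation E h + r h = f along rays. -/

noncomputable section
namespace BookPoisson

open Set Filter Topology MeasureTheory

variable {m : ℕ} {U V : TopologicalSpace.Opens (Space m)}

theorem Smooth.contDiffOn (f : Smooth U) : ContDiffOn ℝ ∞ (ext0 f) U :=
  fun x hx => (f.contDiffAt ⟨x, hx⟩).contDiffWithinAt

theorem Smooth.hasFDerivAt (f : Smooth U) {x : Space m} (hx : x ∈ U) :
    HasFDerivAt (ext0 f) (fderiv ℝ (ext0 f) x) x :=
  (f.differentiableAt ⟨x, hx⟩).hasFDerivAt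

/-- The smooth function on `U` given by a function that is smooth at the points of `U`. -/
def Smooth.restrict (U : TopologicalSpace.Opens (Space m)) (g : Space m → ℝ)
    (hg : ∀ x ∈ U, ContDiffAt ℝ ∞ g x) : Smooth U :=
  Smooth.mk (fun x => g x) fun x =>
    (hg x x.2).congr_of_eventuallyEq (ext0_eventuallyEq _ g (fun _ => rfl) x)

@[simp]
theorem Smooth.restrict_toFun (g : Space m → ℝ) (hg : ∀ x ∈ U, ContDiffAt ℝ ∞ g x) (x : U) :
    (Smooth.restrict U g hg).toFun x = g x := rfl

theorem pderiv_restrict_toFun (c : Coord m) (g : Space m → ℝ) (hg : ∀ x ∈ U, ContDiffAt ℝ ∞ g x)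
    (x : U) : (pderiv U c (Smooth.restrict U g hg)).toFun x = fderiv ℝ g x (coordVec c) :=
  pderiv_eq_of_forall c _ g (fun _ => rfl) x

theorem ext0_toFun_apply (f : Smooth U) {x : Space m} (hx : x ∈ U) :
    ext0 f.toFun x = f.toFun ⟨x, hx⟩ := ext0_apply f.toFun ⟨x, hx⟩

theorem sum_smul_coordVec (u : Fin m → ℝ) :
    ∑ i, u i • (coordVec (some i) : Space m) = (0, u) := by
  ext i
  · simp [coordVec, Prod.fst_sum]
  · simp [coordVec, Prod.snd_sum, Finset.sum_apply, Pi.single_apply]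

theorem eulerOp_toFun (f : Smooth U) (x : U) :
    (eulerOp U f).toFun x = fderiv ℝ (ext0 f) x (0, (x : Space m).2) := by
  rw [← sum_smul_coordVec, map_sum, eulerOp_apply]
  simp [pderiv_toFun]

/-- The rays `s ↦ (t, s u)`, `0 ≤ s ≤ 1`, from the points of `U` to `{u = 0}` stay in `U`. -/
def RayClosed (U : TopologicalSpace.Opens (Space m)) : Prop :=
  ∀ x ∈ U, ∀ s ∈ Icc (0 : ℝ) 1, ((x.1, s • x.2) : Space m) ∈ U

theorem hasDerivAt_ray (f : Smooth U) (x : Space m) (s : ℝ) (hs : ((x.1, s • x.2) : Space m) ∈ U) :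
    HasDerivAt (fun r : ℝ => ext0 f.toFun ((x.1, r • x.2) : Space m))
      (fderiv ℝ (ext0 f) ((x.1, s • x.2) : Space m) (0, x.2)) s := by
  have h1 : HasDerivAt (fun r : ℝ => ((x.1, r • x.2) : Space m)) (0, x.2) s := by
    simpa using (hasDerivAt_const s x.1).prodMk ((hasDerivAt_id s).smul_const x.2)
  exact HasFDerivAt.comp_hasDerivAt s (f.hasFDerivAt hs) h1

theorem continuousOn_ray (f : Smooth U) (x : Space m) :
    ContinuousOn (fun r : ℝ => ext0 f.toFun ((x.1, r • x.2) : Space m))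
      {r | ((x.1, r • x.2) : Space m) ∈ U} :=
  fun r hr => (hasDerivAt_ray f x r hr).continuousAt.continuousWithinAt

theorem isOpen_ray (U : TopologicalSpace.Opens (Space m)) (x : Space m) :
    IsOpen {r : ℝ | ((x.1, r • x.2) : Space m) ∈ U} :=
  U.isOpen.preimage (by fun_prop)

/-- A solution of `E f + d f = 0` with `d ≥ 0` is determined by its values on `{u = 0}`. -/
theorem eq_of_eulerShift_eq_zero (hU : RayClosed U) (d : ℕ) {f : Smooth U}
    (hf : eulerShift U d f = 0) (x : U) :
    f x = 0 ^ d * ext0 f.toFun (((x : Space m).1, 0) : Space m) := by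
  have hmem : ∀ s ∈ Icc (0 : ℝ) 1, (((x : Space m).1, s • (x : Space m).2) : Space m) ∈ U :=
    hU x x.2
  -- Mean value theorem for s ↦ s^d f(t, su) on [0, 1]: s times its derivative is s^d times (E + d)f
  -- at (t, su), so the derivative vanishes for 0 < s < 1. The value at s = 0 carries the factor
  -- 0^d, which is 1 exactly when d = 0.
  obtain ⟨c, hc, hslope⟩ := exists_hasDerivAt_eq_slope
    (fun s : ℝ => s ^ d * ext0 f.toFun (((x : Space m).1, s • (x : Space m).2) : Space m))
    (fun _ => 0) zero_lt_one
    ((continuousOn_id.pow d).mul ((continuousOn_ray f x).mono hmem)) (fun s hs => by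
      have hs' := hmem s (Ioo_subset_Icc_self hs)
      refine (((hasDerivAt_pow d s).mul (hasDerivAt_ray f x s hs'))).congr_deriv ?_
      have h0 := congrFun (congrArg Smooth.toFun hf) ⟨_, hs'⟩
      simp only [eulerShift_apply, Smooth.toFun_add, Smooth.toFun_smul, Pi.add_apply, Pi.smul_apply,
        eulerOp_toFun, Smooth.toFun_zero, Pi.zero_apply, smul_eq_mul] at h0
      rw [show ((0, s • (x : Space m).2) : Space m) = s • (0, (x : Space m).2) by simp,
        map_smul, smul_eq_mul] at h0
      rw [ext0_toFun_apply f hs']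
      refine (mul_eq_zero.1 (?_ : s * _ = 0)).resolve_left hs.1.ne'
      rcases d with _ | d
      · simpa using h0
      · simp only [Nat.add_sub_cancel]
        linear_combination s ^ (d + 1) * h0)
  have h2 : f x = ext0 f.toFun (((x : Space m).1, (1 : ℝ) • (x : Space m).2) : Space m) := by
    rw [one_smul]
    exact (ext0_apply f.toFun x).symm
  rw [h2]
  simp only [one_pow, one_mul, zero_smul, sub_zero, div_one] at hslope ⊢
  linarith

/-- The equation `E h + (d + 1) h = f` is solvable. -/
theorem exists_eulerShift_eq (hU : RayClosed U) (d : ℕ) (f : Smooth U) :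
    ∃ h : Smooth U, eulerShift U ((d : ℝ) + 1) h = f := by
  -- The solution is h(t, u) = ∫₀¹ s^d f(t, su) ds. Rescaling s gives r^(d+1) h(t, ru) = ∫₀^r s^d
  -- f(t, su) ds, and the derivative at r = 1 is the desired equation.
  have hsm : ∀ x ∈ U, ContDiffAt ℝ ∞ (fun y : Space m => ∫ s in (0 : ℝ)..1,
      s ^ d * ext0 f.toFun ((y.1, s • y.2) : Space m)) x := fun x hx => by
    refine contDiffAt_integral (Ω := {z : Space m × ℝ | ((z.1.1, z.2 • z.1.2) : Space m) ∈ U})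
      (F := fun z : Space m × ℝ => z.2 ^ d * ext0 f.toFun ((z.1.1, z.2 • z.1.2) : Space m))
      (U.isOpen.preimage (by fun_prop)) ?_ (hU x hx)
    have h1 : ContDiff ℝ ∞ fun z : Space m × ℝ => z.2 ^ d := by fun_prop
    have h2 : ContDiff ℝ ∞ fun z : Space m × ℝ => ((z.1.1, z.2 • z.1.2) : Space m) := by fun_prop
    exact h1.contDiffOn.mul (f.contDiffOn.comp h2.contDiffOn fun z hz => hz)
  refine ⟨Smooth.restrict U _ hsm, ?_⟩
  ext x
  set h := Smooth.restrict U _ hsm with hh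
  set φ : ℝ → ℝ := fun r => ext0 f.toFun (((x : Space m).1, r • (x : Space m).2) : Space m) with hφ
  have hx1 : (((x : Space m).1, (1 : ℝ) • (x : Space m).2) : Space m) ∈ U := by
    rw [one_smul]; exact x.2
  have hG : HasDerivAt (fun r : ℝ => ∫ s in (0 : ℝ)..r, s ^ d * φ s) (1 ^ d * φ 1) 1 := by
    have hc : ContinuousOn (fun s => s ^ d * φ s)
        {r | (((x : Space m).1, r • (x : Space m).2) : Space m) ∈ U} :=
      (continuousOn_id.pow d).mul (continuousOn_ray f x)
    refine intervalIntegral.integral_hasDerivAt_right (E := ℝ) (f := fun s => s ^ d * φ s) ?_ ?_ ?_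
    · refine (hc.mono ?_).intervalIntegrable
      rw [uIcc_of_le zero_le_one]
      exact hU x x.2
    · exact hc.stronglyMeasurableAtFilter (isOpen_ray U x) 1 hx1
    · exact hc.continuousAt ((isOpen_ray U x).mem_nhds hx1)
  have hH := (hasDerivAt_pow (d + 1) (1 : ℝ)).mul (hasDerivAt_ray h x 1 hx1)
  have heq : (fun r : ℝ => ∫ s in (0 : ℝ)..r, s ^ d * φ s) =ᶠ[𝓝 1]
      fun r => r ^ (d + 1) * ext0 h.toFun (((x : Space m).1, r • (x : Space m).2) : Space m) := by
    filter_upwards [(isOpen_ray U x).mem_nhds hx1] with r hr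
    rw [ext0_toFun_apply h hr, hh, Smooth.restrict_toFun]
    have := intervalIntegral.mul_integral_comp_mul_right (a := 0) (b := 1)
      (f := fun s => s ^ d * φ s) r
    rw [zero_mul, one_mul] at this
    rw [← this, pow_succ', mul_assoc, ← intervalIntegral.integral_const_mul (r ^ d)]
    refine congrArg (r * ·) (intervalIntegral.integral_congr fun s _ => ?_)
    simp only [hφ, mul_pow, smul_smul]
    ring
  have key := HasDerivAt.unique (hG.congr_of_eventuallyEq heq.symm) hH
  simp only [one_pow, one_mul, mul_one, one_smul, hφ, Nat.cast_add, Nat.cast_one] at key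
  have e1 : ext0 f.toFun (((x : Space m).1, (x : Space m).2) : Space m) = f x := ext0_apply _ x
  have e2 : ext0 h.toFun (((x : Space m).1, (x : Space m).2) : Space m) = h x := ext0_apply _ x
  rw [e1, e2] at key
  rw [eulerShift_apply, Smooth.toFun_add, Smooth.toFun_smul, Pi.add_apply, Pi.smul_apply,
    eulerOp_toFun, smul_eq_mul, key]
  exact add_comm _ _

/-- The operator E + d + 1 commutes with ∂_t and is injective on ray-closed sets, because 0^(d+1) =
0. -/
theorem mem_basic_of_eulerShift_mem (hU : RayClosed U) (d : ℕ) {h : Smooth U}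
    (hh : eulerShift U ((d : ℝ) + 1) h ∈ basic U) : h ∈ basic U := by
  rw [mem_basic, pderiv_none_eulerShift] at hh
  have := eq_of_eulerShift_eq_zero hU (d + 1) (f := pderiv U none h) (by exact_mod_cast hh)
  ext x
  rw [this x]
  simp

end BookPoisson
end

/-! ### Sections of the projection, integration in t, and functions of u alone. -/

noncomputable section
namespace BookPoisson

open Set Filter Topology MeasureTheory

variable {m : ℕ} {U : TopologicalSpace.Opens (Space m)}

/-- The projections of the points of `U` to `ℝ^m`. -/
def base (U : TopologicalSpace.Opens (Space m)) : TopologicalSpace.Opens (Fin m → ℝ) :=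
  ⟨Prod.snd '' (U : Set (Space m)), isOpenMap_snd _ U.isOpen⟩

theorem snd_mem_base {x : Space m} (hx : x ∈ U) : x.2 ∈ base U := ⟨x, hx, rfl⟩

/-- The fibres of `U` over `ℝ^m`, which are subsets of `ℝ`, are connected. -/
def ConnectedFibers (U : TopologicalSpace.Opens (Space m)) : Prop :=
  ∀ u ∈ Prod.snd '' (U : Set (Space m)),
    IsConnected ((U : Set (Space m)) ∩ Prod.snd ⁻¹' {u})

/-- The fibre of `U` over `u` -/
def fiber (U : TopologicalSpace.Opens (Space m)) (u : Fin m → ℝ) : Set ℝ :=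
  {t | ((t, u) : Space m) ∈ U}

theorem isOpen_fiber (u : Fin m → ℝ) : IsOpen (fiber U u) :=
  U.isOpen.preimage (by fun_prop : Continuous fun t : ℝ => ((t, u) : Space m))

theorem ConnectedFibers.isPreconnected_fiber (hU : ConnectedFibers U) {u : Fin m → ℝ}
    (hu : u ∈ base U) : IsPreconnected (fiber U u) := by
  have h := (hU u hu).isPreconnected.image Prod.fst continuous_fst.continuousOn
  convert h using 1
  ext t
  constructor
  · intro ht
    exact ⟨(t, u), ⟨ht, rfl⟩, rfl⟩
  · rintro ⟨⟨t', u'⟩, ⟨h1, h2⟩, rfl⟩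
    obtain rfl : u' = u := h2
    exact h1

theorem ConnectedFibers.convex_fiber (hU : ConnectedFibers U) {u : Fin m → ℝ}
    (hu : u ∈ base U) : Convex ℝ (fiber U u) :=
  (hU.isPreconnected_fiber hu).ordConnected.convex

theorem hasDerivAt_fiber (f : Smooth U) (t : ℝ) (u : Fin m → ℝ) (h : ((t, u) : Space m) ∈ U) :
    HasDerivAt (fun r : ℝ => ext0 f.toFun ((r, u) : Space m))
      ((pderiv U none f).toFun ⟨_, h⟩) t := by
  have h1 : HasDerivAt (fun r : ℝ => ((r, u) : Space m)) (1, 0) t :=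
    (hasDerivAt_id t).prodMk (hasDerivAt_const t u)
  exact HasFDerivAt.comp_hasDerivAt t (f.hasFDerivAt h) h1

/-- A function with vanishing `t`-derivative is constant on the fibres. -/
theorem ConnectedFibers.eq_of_mem_basic (hU : ConnectedFibers U) {f : Smooth U} (hf : f ∈ basic U)
    {t t' : ℝ} {u : Fin m → ℝ} (ht : ((t, u) : Space m) ∈ U) (ht' : ((t', u) : Space m) ∈ U) :
    ext0 f.toFun ((t, u) : Space m) = ext0 f.toFun ((t', u) : Space m) := by
  refine (isOpen_fiber u).is_const_of_deriv_eq_zero (𝕜 := ℝ)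
    (f := fun r : ℝ => ext0 f.toFun ((r, u) : Space m))
    (hU.isPreconnected_fiber (snd_mem_base ht)) (fun r hr => ?_) (fun r hr => ?_) ht ht'
  · exact (hasDerivAt_fiber f r u hr).differentiableAt.differentiableWithinAt
  · rw [(hasDerivAt_fiber f r u hr).deriv, mem_basic.1 hf]
    rfl

/-- `u ↦ (σ u, u)` is a smooth section of the projection of `U` to `ℝ^m`. -/
structure IsSection (U : TopologicalSpace.Opens (Space m)) (σ : (Fin m → ℝ) → ℝ) : Prop where
  contDiffAt : ∀ u ∈ base U, ContDiffAt ℝ ∞ σ u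
  mem : ∀ u ∈ base U, ((σ u, u) : Space m) ∈ U

/-- Locally a constant t works because U is open; the fibres are intervals, hence convex, so the
local choices can be glued. -/
theorem ConnectedFibers.exists_isSection (hU : ConnectedFibers U) : ∃ σ, IsSection U σ := by
  obtain ⟨σ, hσ⟩ := exists_contDiffAt_forall_mem_convex (base U) (fiber U)
    (fun u hu => hU.convex_fiber hu) (by
      rintro _ ⟨⟨t, u⟩, hx, rfl⟩
      refine ⟨fun _ => t, {v | ((t, v) : Space m) ∈ U}, ?_, contDiffOn_const, fun v hv => hv⟩
      exact (U.isOpen.preimage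
        (by fun_prop : Continuous fun v : Fin m → ℝ => ((t, v) : Space m))).mem_nhds hx)
  exact ⟨σ, fun u hu => (hσ u hu).1, fun u hu => (hσ u hu).2⟩

namespace IsSection

variable {σ : (Fin m → ℝ) → ℝ}

theorem contDiffAt_comp (hσ : IsSection U σ) (f : Smooth U) {y : Space m} (hy : y.2 ∈ base U) :
    ContDiffAt ℝ ∞ (fun z : Space m => ext0 f.toFun ((σ z.2, z.2) : Space m)) y := by
  have h1 : ContDiffAt ℝ ∞ (fun z : Space m => ((σ z.2, z.2) : Space m)) y :=
    ContDiffAt.prodMk ((hσ.contDiffAt y.2 hy).comp y contDiffAt_snd) contDiffAt_snd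
  exact ContDiffAt.comp y (f.contDiffAt ⟨_, hσ.mem y.2 hy⟩) h1

/-- The restriction of a function to the image of the section, extended constantly along the
fibres. -/
def sec (hσ : IsSection U σ) : Smooth U →ₗ[ℝ] Smooth U where
  toFun f := Smooth.restrict U _ fun _ hx => hσ.contDiffAt_comp f (snd_mem_base hx)
  map_add' f g := by
    ext x
    simp [ext0_add]
  map_smul' r f := by
    ext x
    simp [ext0_smul]

theorem sec_toFun (hσ : IsSection U σ) (f : Smooth U) (x : U) :
    (hσ.sec f).toFun x = ext0 f.toFun ((σ (x : Space m).2, (x : Space m).2) : Space m) := rfl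

theorem sec_mem_basic (hσ : IsSection U σ) (f : Smooth U) : hσ.sec f ∈ basic U := by
  rw [mem_basic]
  ext x
  have h := hasDerivAt_fiber (hσ.sec f) (x : Space m).1 (x : Space m).2 x.2
  refine h.unique ((hasDerivAt_const (x : Space m).1 (ext0 f.toFun
    ((σ (x : Space m).2, (x : Space m).2) : Space m))).congr_of_eventuallyEq ?_)
  filter_upwards [(isOpen_fiber (x : Space m).2).mem_nhds x.2] with r hr
  exact ext0_toFun_apply (hσ.sec f) hr

theorem sec_eq (hσ : IsSection U σ) (hU : ConnectedFibers U) {f : Smooth U} (hf : f ∈ basic U) :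
    hσ.sec f = f := by
  ext x
  rw [sec_toFun, hU.eq_of_mem_basic hf (hσ.mem _ (snd_mem_base x.2)) x.2]
  exact ext0_apply _ x

theorem sec_coordU_mul (hσ : IsSection U σ) (i : Fin m) (f : Smooth U) :
    hσ.sec (coordU U i * f) = coordU U i * hσ.sec f := by
  ext x
  simp only [sec_toFun, Smooth.toFun_mul, Pi.mul_apply, ext0_mul]
  rw [ext0_toFun_apply _ (hσ.mem _ (snd_mem_base x.2))]
  rfl

/-- Every smooth function has an antiderivative in the direction `t`. -/
theorem exists_pderiv_none_eq (hσ : IsSection U σ) (hU : ConnectedFibers U) (f : Smooth U) :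
    ∃ F : Smooth U, pderiv U none F = f := by
  -- The antiderivative is the integral of f from σ(u) to t, rescaled to [0, 1] so that smooth
  -- dependence on parameters applies. Convexity of the fibre keeps the path of integration in U.
  have hsm : ∀ x ∈ U, ContDiffAt ℝ ∞ (fun y : Space m => (y.1 - σ y.2) * ∫ s in (0 : ℝ)..1,
      ext0 f.toFun ((σ y.2 + (y.1 - σ y.2) * s, y.2) : Space m)) x := fun x hx => by
    have hσ2 : ContDiffOn ℝ ∞ (fun y : Space m => σ y.2) {y | y.2 ∈ base U} := fun y hy =>
      ((hσ.contDiffAt y.2 hy).comp y contDiffAt_snd).contDiffWithinAt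
    have hopen : IsOpen {y : Space m | y.2 ∈ base U} := (base U).isOpen.preimage continuous_snd
    refine ContDiffAt.mul (contDiffAt_fst.sub
      (hσ2.contDiffAt (hopen.mem_nhds (snd_mem_base hx)))) ?_
    have hW : IsOpen {z : Space m × ℝ | z.1.2 ∈ base U} :=
      (base U).isOpen.preimage (by fun_prop)
    have hG : ContDiffOn ℝ ∞
        (fun z : Space m × ℝ => ((σ z.1.2 + (z.1.1 - σ z.1.2) * z.2, z.1.2) : Space m))
        {z : Space m × ℝ | z.1.2 ∈ base U} := by
      have h1 : ContDiffOn ℝ ∞ (fun z : Space m × ℝ => σ z.1.2) {z | z.1.2 ∈ base U} :=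
        hσ2.comp contDiff_fst.contDiffOn fun z hz => hz
      have h2 : ContDiffOn ℝ ∞ (fun z : Space m × ℝ => z.1.1) {z | z.1.2 ∈ base U} := by fun_prop
      have h3 : ContDiffOn ℝ ∞ (fun z : Space m × ℝ => z.1.2) {z | z.1.2 ∈ base U} := by fun_prop
      have h4 : ContDiffOn ℝ ∞ (fun z : Space m × ℝ => z.2) {z | z.1.2 ∈ base U} := by fun_prop
      exact (h1.add ((h2.sub h1).mul h4)).prodMk h3
    refine contDiffAt_integral (hG.continuousOn.isOpen_inter_preimage hW U.isOpen)
      (F := fun z : Space m × ℝ =>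
        ext0 f.toFun ((σ z.1.2 + (z.1.1 - σ z.1.2) * z.2, z.1.2) : Space m))
      (f.contDiffOn.comp (hG.mono inter_subset_left) fun z hz => hz.2) fun s hs => ?_
    refine ⟨snd_mem_base hx, ?_⟩
    have := hU.convex_fiber (snd_mem_base hx) (hσ.mem _ (snd_mem_base hx)) (y := x.1) hx
      (sub_nonneg.2 hs.2) hs.1 (by ring)
    have e : σ x.2 + (x.1 - σ x.2) * s = (1 - s) • σ x.2 + s • x.1 := by
      simp only [smul_eq_mul]; ring
    simp only [mem_preimage, e]
    exact this
  refine ⟨Smooth.restrict U _ hsm, ?_⟩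
  ext x
  obtain ⟨⟨t, u⟩, hx⟩ := x
  have hu := snd_mem_base hx
  refine (hasDerivAt_fiber (Smooth.restrict U _ hsm) t u hx).unique ?_
  have hc : ContinuousOn (fun r : ℝ => ext0 f.toFun ((r, u) : Space m)) (fiber U u) :=
    fun r hr => (hasDerivAt_fiber f r u hr).continuousAt.continuousWithinAt
  have hG : HasDerivAt (fun r : ℝ => ∫ s in (σ u)..r, ext0 f.toFun ((s, u) : Space m))
      (ext0 f.toFun ((t, u) : Space m)) t := by
    refine intervalIntegral.integral_hasDerivAt_right (E := ℝ)
      (f := fun r => ext0 f.toFun ((r, u) : Space m)) ?_ ?_ ?_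
    · exact (hc.mono ((hU.isPreconnected_fiber hu).ordConnected.uIcc_subset
        (hσ.mem u hu) hx)).intervalIntegrable
    · exact hc.stronglyMeasurableAtFilter (isOpen_fiber u) t hx
    · exact hc.continuousAt ((isOpen_fiber u).mem_nhds hx)
  rw [ext0_toFun_apply f hx] at hG
  refine hG.congr_of_eventuallyEq ?_
  filter_upwards [(isOpen_fiber u).mem_nhds hx] with r hr
  rw [ext0_toFun_apply _ hr, Smooth.restrict_toFun]
  have := intervalIntegral.mul_integral_comp_add_mul (a := 0) (b := 1)
    (f := fun s => ext0 f.toFun ((s, u) : Space m)) (r - σ u) (σ u)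
  rw [mul_zero, mul_one, add_zero, add_sub_cancel] at this
  exact this

/-- The product of a line and the image of `U` in `ℝ^m`. -/
def cylinder (U : TopologicalSpace.Opens (Space m)) : TopologicalSpace.Opens (Space m) :=
  ⟨{y | y.2 ∈ base U}, (base U).isOpen.preimage continuous_snd⟩

/-- The restriction of a function to the image of the section, as a function on the cylinder. -/
def pull (hσ : IsSection U σ) (f : Smooth U) : Smooth (cylinder U) :=
  Smooth.restrict (cylinder U) _ fun _ hx => hσ.contDiffAt_comp f hx

theorem pull_toFun (hσ : IsSection U σ) (f : Smooth U) (x : cylinder U) :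
    (hσ.pull f).toFun x = ext0 f.toFun ((σ (x : Space m).2, (x : Space m).2) : Space m) := rfl

theorem pderiv_none_pull (hσ : IsSection U σ) (f : Smooth U) : hσ.pull f ∈ basic (cylinder U) := by
  rw [mem_basic]
  ext x
  have h := hasDerivAt_fiber (hσ.pull f) (x : Space m).1 (x : Space m).2 x.2
  refine h.unique ((hasDerivAt_const (x : Space m).1 (ext0 f.toFun
    ((σ (x : Space m).2, (x : Space m).2) : Space m))).congr_of_eventuallyEq ?_)
  filter_upwards [(isOpen_fiber (U := cylinder U) (x : Space m).2).mem_nhds x.2] with r hr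
  exact ext0_toFun_apply (hσ.pull f) hr

/-- No derivative of σ appears: f is constant on fibres, so on a short segment in direction u_i the
pulled-back function equals f with t frozen at σ(u). -/
theorem pderiv_some_pull (hσ : IsSection U σ) (hU : ConnectedFibers U) {f : Smooth U}
    (hf : f ∈ basic U) (i : Fin m) :
    pderiv (cylinder U) (some i) (hσ.pull f) = hσ.pull (pderiv U (some i) f) := by
  ext ⟨⟨t, u⟩, hx⟩
  have hu : u ∈ base U := hx
  have hmem := hσ.mem u hu
  rw [pull_toFun, ext0_toFun_apply _ hmem]
  have h1 : HasDerivAt (fun r : ℝ => ((t, u + r • Pi.single i 1) : Space m))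
      (coordVec (some i)) 0 := by
    simpa [coordVec] using (hasDerivAt_const (0 : ℝ) t).prodMk
      (((hasDerivAt_id (0 : ℝ)).smul_const (Pi.single i (1 : ℝ) : Fin m → ℝ)).const_add u)
  have h2 : HasDerivAt (fun r : ℝ => ((σ u, u + r • Pi.single i 1) : Space m))
      (coordVec (some i)) 0 := by
    simpa [coordVec] using (hasDerivAt_const (0 : ℝ) (σ u)).prodMk
      (((hasDerivAt_id (0 : ℝ)).smul_const (Pi.single i (1 : ℝ) : Fin m → ℝ)).const_add u)
  have e1 : ((t, u + (0 : ℝ) • Pi.single i 1) : Space m) = (t, u) := by simp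
  have e2 : ((σ u, u + (0 : ℝ) • Pi.single i 1) : Space m) = (σ u, u) := by simp
  have d1 := ((hσ.pull f).hasFDerivAt hx).comp_hasDerivAt_of_eq (0 : ℝ) h1 e1.symm
  have d2 := (f.hasFDerivAt hmem).comp_hasDerivAt_of_eq (0 : ℝ) h2 e2.symm
  refine d1.unique (d2.congr_of_eventuallyEq ?_)
  have hev : ∀ᶠ r : ℝ in 𝓝 0, ((σ u, u + r • Pi.single i 1) : Space m) ∈ U := by
    refine h2.continuousAt.eventually_mem (U.isOpen.mem_nhds ?_)
    rw [e2]; exact hmem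
  filter_upwards [hev] with r hr
  have hr' := snd_mem_base hr
  have hc : ((t, u + r • Pi.single i 1) : Space m) ∈ cylinder U := hr'
  simp only [Function.comp_apply]
  rw [ext0_toFun_apply _ hc, pull_toFun]
  exact hU.eq_of_mem_basic hf (hσ.mem _ hr') hr

theorem eulerOp_pull (hσ : IsSection U σ) (hU : ConnectedFibers U) {f : Smooth U}
    (hf : f ∈ basic U) : eulerOp (cylinder U) (hσ.pull f) = hσ.pull (eulerOp U f) := by
  ext x
  have hmem := hσ.mem _ x.2
  simp only [eulerOp_apply, hσ.pderiv_some_pull hU hf]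
  rw [pull_toFun, ext0_toFun_apply _ hmem]
  simp only [Smooth.toFun_sum, Finset.sum_apply, Smooth.toFun_mul, Pi.mul_apply, pull_toFun,
    coordU_toFun, ext0_toFun_apply _ hmem]

/-- Restriction of functions from the cylinder to `U`. -/
def push (g : Smooth (cylinder U)) : Smooth U :=
  Smooth.restrict U (ext0 g.toFun) fun _ hx => g.contDiffAt ⟨_, snd_mem_base hx⟩

theorem push_toFun (g : Smooth (cylinder U)) (x : U) :
    (push g).toFun x = g.toFun ⟨x, snd_mem_base x.2⟩ :=
  ext0_toFun_apply g _

theorem pderiv_push (c : Coord m) (g : Smooth (cylinder U)) :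
    pderiv U c (push g) = push (pderiv (cylinder U) c g) := by
  ext x
  rw [push_toFun, push, pderiv_restrict_toFun]
  rfl

theorem eulerShift_push (r : ℝ) (g : Smooth (cylinder U)) :
    eulerShift U r (push g) = push (eulerShift (cylinder U) r g) := by
  ext x
  rw [push_toFun]
  simp only [eulerShift_apply, eulerOp_apply, pderiv_push, Smooth.toFun_add, Smooth.toFun_smul,
    Smooth.toFun_sum, Smooth.toFun_mul, Pi.add_apply, Pi.smul_apply, Finset.sum_apply, Pi.mul_apply,
    push_toFun, coordU_toFun]

theorem push_pull (hσ : IsSection U σ) (hU : ConnectedFibers U) {f : Smooth U}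
    (hf : f ∈ basic U) : push (hσ.pull f) = f := by
  refine Eq.trans ?_ (hσ.sec_eq hU hf)
  ext x
  rw [push_toFun]
  rfl

end IsSection

-- The set U itself need not be ray-closed, since only its base is star-shaped. This is why
-- functions of u are moved to the cylinder before integrating along rays.
open IsSection in
theorem rayClosed_cylinder (hstar : StarConvex ℝ 0 (Prod.snd '' (U : Set (Space m)))) :
    RayClosed (cylinder U) := fun _ hx _ hs => hstar.smul_mem hx hs.1 hs.2

theorem exists_eulerShift_one_eq {σ : (Fin m → ℝ) → ℝ} (hσ : IsSection U σ)
    (hU : ConnectedFibers U) (hstar : StarConvex ℝ 0 (Prod.snd '' (U : Set (Space m))))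
    {f : Smooth U} (hf : f ∈ basic U) : ∃ h ∈ basic U, eulerShift U 1 h = f := by
  obtain ⟨h, hh⟩ := exists_eulerShift_eq (rayClosed_cylinder hstar) 0 (hσ.pull f)
  have hb := mem_basic_of_eulerShift_mem (rayClosed_cylinder hstar) 0
    (hh ▸ hσ.pderiv_none_pull f)
  refine ⟨IsSection.push h, ?_, ?_⟩
  · rw [mem_basic, IsSection.pderiv_push, mem_basic.1 hb]
    ext x
    rw [IsSection.push_toFun]
    rfl
  · rw [IsSection.eulerShift_push, show (1 : ℝ) = ((0 : ℕ) : ℝ) + 1 by simp, hh, hσ.push_pull hU hf]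

/-- On the cylinder such a function is constant along the rays of the base, which all end at 0. -/
theorem eq_algebraMap_of_eulerOp_eq_zero {σ : (Fin m → ℝ) → ℝ} (hσ : IsSection U σ)
    (hU : ConnectedFibers U) (hstar : StarConvex ℝ 0 (Prod.snd '' (U : Set (Space m))))
    {f : Smooth U} (hf : f ∈ basic U) (hE : eulerOp U f = 0) :
    ∃ r : ℝ, f = algebraMap ℝ (Smooth U) r := by
  by_cases h0 : (0 : Fin m → ℝ) ∈ base U
  · refine ⟨ext0 f.toFun ((σ 0, 0) : Space m), ?_⟩
    have hz : eulerShift (IsSection.cylinder U) ((0 : ℕ) : ℝ) (hσ.pull f) = 0 := by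
      rw [eulerShift_apply, hσ.eulerOp_pull hU hf, hE]
      ext x
      rw [Nat.cast_zero, zero_smul, add_zero]
      exact ext0_apply _ ⟨_, hσ.mem _ x.2⟩
    rw [← hσ.push_pull hU hf]
    ext x
    rw [IsSection.push_toFun, eq_of_eulerShift_eq_zero (rayClosed_cylinder hstar) 0 hz]
    rw [pow_zero, one_mul, ext0_toFun_apply (x := (((x : Space m).1, 0) : Space m)) _ h0,
      IsSection.pull_toFun, hσ.push_pull hU hf]
    rfl
  -- A star-shaped base without 0 is empty, so U is empty as well.
  · refine ⟨0, ?_⟩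
    ext x
    refine absurd ?_ h0
    have := hstar.smul_mem (snd_mem_base x.2) le_rfl zero_le_one
    rwa [zero_smul] at this

/-- Every function of `u` is the sum of a homogeneous polynomial of degree `k` and of a function in
the image of `E - k`. -/
theorem exists_eulerShift_add_homPoly {σ : (Fin m → ℝ) → ℝ} (hσ : IsSection U σ)
    (hU : ConnectedFibers U) (hstar : StarConvex ℝ 0 (Prod.snd '' (U : Set (Space m)))) (k : ℕ)
    {f : Smooth U} (hf : f ∈ basic U) :
    ∃ h ∈ basic U, ∃ q ∈ homPoly U k, f = eulerShift U (-(k : ℝ)) h + q := by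
  -- Hadamard's lemma. With (E + 1)g_i = ∂_i f one has E(∑ u_i g_i) = ∑ u_i ∂_i f = E f, so the
  -- difference is constant.
  have hadamard : ∀ f ∈ basic U, ∃ r : ℝ, ∃ g : Fin m → Smooth U, (∀ i, g i ∈ basic U) ∧
      f = algebraMap ℝ (Smooth U) r + ∑ i, coordU U i * g i := fun f hf => by
    choose g hg hfg using fun i : Fin m =>
      exists_eulerShift_one_eq hσ hU hstar (pderiv_mem_basic (some i) hf)
    have hsum : ∑ i, coordU U i * g i ∈ basic U :=
      Submodule.sum_mem _ fun i _ => coordU_mul_mem_basic i (hg i)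
    have hz : eulerOp U (f - ∑ i, coordU U i * g i) = 0 := by
      rw [map_sub, map_sum, sub_eq_zero, eulerOp_apply]
      refine Finset.sum_congr rfl fun i _ => ?_
      have := eulerShift_coordU_mul (0 : ℝ) i (g i)
      rw [eulerShift_apply, zero_smul, add_zero, zero_add, hfg] at this
      exact this.symm
    obtain ⟨r, hr⟩ := eq_algebraMap_of_eulerOp_eq_zero hσ hU hstar
      (Submodule.sub_mem _ hf hsum) hz
    exact ⟨r, g, hg, by rw [← hr]; abel⟩
  have hconst : ∀ r : ℝ, algebraMap ℝ (Smooth U) r ∈ basic U := fun r => pderiv_algebraMap none r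
  induction k generalizing f with
  | zero =>
    obtain ⟨r, g, hg, rfl⟩ := hadamard f hf
    choose h hh hgh using fun i : Fin m => exists_eulerShift_one_eq hσ hU hstar (hg i)
    refine ⟨∑ i, coordU U i * h i, Submodule.sum_mem _ fun i _ => coordU_mul_mem_basic i (hh i),
      _, algebraMap_mem_homPoly_zero r, ?_⟩
    rw [add_comm, map_sum]
    congr 1
    refine Finset.sum_congr rfl fun i _ => ?_
    rw [eulerShift_coordU_mul, Nat.cast_zero, neg_zero, zero_add, hgh]
  | succ k ih =>
    obtain ⟨r, g, hg, rfl⟩ := hadamard f hf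
    choose h hh q hq hgh using fun i : Fin m => ih (hg i)
    -- On constants E - (k + 1) is multiplication by -(k + 1), so the constant term r is the image
    -- of -r/(k + 1).
    refine ⟨∑ i, coordU U i * h i - algebraMap ℝ (Smooth U) (r / (k + 1)),
      Submodule.sub_mem _ (Submodule.sum_mem _ fun i _ => coordU_mul_mem_basic i (hh i))
        (hconst _), ∑ i, coordU U i * q i,
      Submodule.sum_mem _ fun i _ => coordU_mul_mem_homPoly i (hq i), ?_⟩
    have h1 : eulerShift U (-((k + 1 : ℕ) : ℝ)) (algebraMap ℝ (Smooth U) (r / (k + 1))) =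
        -algebraMap ℝ (Smooth U) r := by
      rw [eulerShift_apply, eulerOp_apply]
      simp only [pderiv_algebraMap, mul_zero, Finset.sum_const_zero, zero_add]
      rw [Algebra.algebraMap_eq_smul_one, Algebra.algebraMap_eq_smul_one, smul_smul, ← neg_smul]
      congr 1
      push_cast
      field_simp
    have h2 : -((k + 1 : ℕ) : ℝ) + 1 = -(k : ℝ) := by push_cast; ring
    rw [map_sub, h1, map_sum]
    simp only [eulerShift_coordU_mul, h2]
    rw [sub_neg_eq_add, add_right_comm, ← Finset.sum_add_distrib, add_comm]
    congr 1
    refine Finset.sum_congr rfl fun i _ => ?_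
    rw [← mul_add, ← hgh]

/-- A function of `u` with `E f = k f` is a homogeneous polynomial of degree `k`. -/
theorem mem_homPoly_of_eulerShift_eq_zero {σ : (Fin m → ℝ) → ℝ} (hσ : IsSection U σ)
    (hU : ConnectedFibers U) (hstar : StarConvex ℝ 0 (Prod.snd '' (U : Set (Space m)))) (k : ℕ)
    {f : Smooth U} (hf : f ∈ basic U) (hE : eulerShift U (-(k : ℝ)) f = 0) : f ∈ homPoly U k := by
  induction k generalizing f with
  | zero =>
    rw [eulerShift_apply, Nat.cast_zero, neg_zero, zero_smul, add_zero] at hE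
    obtain ⟨r, rfl⟩ := eq_algebraMap_of_eulerOp_eq_zero hσ hU hstar hf hE
    exact algebraMap_mem_homPoly_zero r
  | succ k ih =>
    have h2 : -((k + 1 : ℕ) : ℝ) + 1 = -(k : ℝ) := by push_cast; ring
    have hd : ∀ i, pderiv U (some i) f ∈ homPoly U k := fun i =>
      ih (pderiv_mem_basic _ hf) (by rw [← h2, ← pderiv_some_eulerShift, hE, map_zero])
    -- The hypothesis is Euler's identity, so f is recovered from its derivatives, which are
    -- polynomial by induction.
    have : f = ((k : ℝ) + 1)⁻¹ • ∑ i, coordU U i * pderiv U (some i) f := by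
      rw [eulerShift_apply, neg_smul, ← sub_eq_add_neg, sub_eq_zero] at hE
      rw [← eulerOp_apply, hE, smul_smul]
      push_cast
      rw [inv_mul_cancel₀ (by positivity), one_smul]
    rw [this]
    exact Submodule.smul_mem _ _ (Submodule.sum_mem _ fun i _ => coordU_mul_mem_homPoly i (hd i))

end BookPoisson
end

/-! ### Constant multivectors: contractions and the horizontal exterior algebra. -/

noncomputable section
namespace BookPoisson

variable {m : ℕ}

/-- The constant multivectors. -/
abbrev Ext (m : ℕ) : Type := ExteriorAlgebra ℝ (Space m)

/-- The constant coordinate vectors, in the exterior algebra. -/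
def gen (c : Coord m) : Ext m := ExteriorAlgebra.ι ℝ (coordVec c)

/-- The left contraction with `dt` or `du_i`. -/
def ctr (c : Coord m) : Ext m →ₗ[ℝ] Ext m :=
  CliffordAlgebra.contractLeft (Q := (0 : QuadraticForm ℝ (Space m))) (coordCovec c)

theorem coordCovec_coordVec (c c' : Coord m) :
    coordCovec c (coordVec c' : Space m) = if c = c' then 1 else 0 := by
  rcases c with _ | i <;> rcases c' with _ | j <;> simp [coordCovec, coordVec, Pi.single_apply]

theorem ctr_ι_mul (c : Coord m) (v : Space m) (w : Ext m) :
    ctr c (ExteriorAlgebra.ι ℝ v * w) = coordCovec c v • w - ExteriorAlgebra.ι ℝ v * ctr c w :=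
  CliffordAlgebra.contractLeft_ι_mul _ _ _

theorem ctr_gen_mul (c c' : Coord m) (w : Ext m) :
    ctr c (gen c' * w) = (if c = c' then w else 0) - gen c' * ctr c w := by
  rw [gen, ctr_ι_mul, coordCovec_coordVec]
  split_ifs <;> simp

theorem ctr_algebraMap (c : Coord m) (r : ℝ) : ctr c (algebraMap ℝ (Ext m) r) = 0 :=
  CliffordAlgebra.contractLeft_algebraMap _ _ _

theorem ctr_ctr (c : Coord m) (w : Ext m) : ctr c (ctr c w) = 0 :=
  CliffordAlgebra.contractLeft_contractLeft _ _

theorem gen_mul_gen_self (c : Coord m) : gen c * gen c = 0 :=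
  ExteriorAlgebra.ι_sq_zero _

theorem ι_mul_ι_comm (a b : Space m) :
    ExteriorAlgebra.ι ℝ a * ExteriorAlgebra.ι ℝ b =
      -(ExteriorAlgebra.ι ℝ b * ExteriorAlgebra.ι ℝ a) :=
  eq_neg_of_add_eq_zero_left (ExteriorAlgebra.ι_add_mul_swap a b)

theorem gen_mul_gen_comm (c c' : Coord m) : gen c * gen c' = -(gen c' * gen c) :=
  ι_mul_ι_comm _ _

theorem gen_mul_gen_mul (c c' : Coord m) (w : Ext m) :
    gen c * (gen c' * w) = -(gen c' * (gen c * w)) := by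
  rw [← mul_assoc, gen_mul_gen_comm, neg_mul, mul_assoc]

/-- Products of two vectors are central. -/
theorem commute_ι_mul_ι (a b : Space m) (w : Ext m) :
    w * (ExteriorAlgebra.ι ℝ a * ExteriorAlgebra.ι ℝ b) =
      ExteriorAlgebra.ι ℝ a * ExteriorAlgebra.ι ℝ b * w := by
  induction w using ExteriorAlgebra.induction with
  | algebraMap r => exact Algebra.commutes r _
  | ι v =>
    rw [← mul_assoc, ι_mul_ι_comm v a, neg_mul, mul_assoc, ι_mul_ι_comm v b, mul_neg, neg_neg,
      mul_assoc]
  | mul x y hx hy => rw [mul_assoc, hy, ← mul_assoc, hx, mul_assoc]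
  | add x y hx hy => rw [add_mul, mul_add, hx, hy]

theorem contractLeft_mul_ι (d : Module.Dual ℝ (Space m)) (a : Space m) (k : ℕ) (w : Ext m)
    (hw : w ∈ ⋀[ℝ]^k (Space m)) :
    CliffordAlgebra.contractLeft (Q := (0 : QuadraticForm ℝ (Space m))) d
        (w * ExteriorAlgebra.ι ℝ a) =
      CliffordAlgebra.contractLeft (Q := (0 : QuadraticForm ℝ (Space m))) d w *
        ExteriorAlgebra.ι ℝ a + ((-1 : ℝ) ^ k * d a) • w := by
  induction hw using Submodule.pow_induction_on_left' with
  | algebraMap r =>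
    rw [← Algebra.smul_def, map_smul, CliffordAlgebra.contractLeft_algebraMap]
    rw [zero_mul, zero_add, pow_zero, one_mul]
    erw [CliffordAlgebra.contractLeft_ι]
    rw [Algebra.algebraMap_eq_smul_one, Algebra.algebraMap_eq_smul_one, smul_comm]
  | add x y i hx hy ihx ihy => rw [add_mul, map_add, map_add, ihx, ihy, add_mul, smul_add]; abel
  | mem_mul v hv i x hx ih =>
    obtain ⟨v, rfl⟩ := hv
    rw [mul_assoc]
    erw [CliffordAlgebra.contractLeft_ι_mul, CliffordAlgebra.contractLeft_ι_mul]
    rw [ih, sub_mul, mul_add, smul_mul_assoc, mul_assoc, mul_smul_comm, Nat.succ_eq_add_one,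
      pow_succ, mul_neg_one, neg_mul, neg_smul]
    change _ - (_ + _ • (ExteriorAlgebra.ι ℝ v * x)) = _
    abel

/-- The right contraction of a homogeneous multivector. -/
theorem contractRight_eq_of_mem (d : Module.Dual ℝ (Space m)) (k : ℕ) (w : Ext m)
    (hw : w ∈ ⋀[ℝ]^k (Space m)) :
    CliffordAlgebra.contractRight (Q := (0 : QuadraticForm ℝ (Space m))) w d =
      (-1 : ℝ) ^ (k + 1) •
        CliffordAlgebra.contractLeft (Q := (0 : QuadraticForm ℝ (Space m))) d w := by
  induction hw using Submodule.pow_induction_on_right' with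
  | algebraMap r =>
    rw [CliffordAlgebra.contractLeft_algebraMap, CliffordAlgebra.contractRight_algebraMap,
      smul_zero]
  | add x y i hx hy ihx ihy => rw [map_add, LinearMap.add_apply, map_add, ihx, ihy, smul_add]
  | mul_mem i x hx ih v hv =>
    obtain ⟨v, rfl⟩ := hv
    rw [contractLeft_mul_ι d v i x hx]
    erw [CliffordAlgebra.contractRight_mul_ι]
    rw [ih, smul_mul_assoc, smul_add, smul_smul, ← mul_assoc, Nat.succ_eq_add_one, ← pow_add,
      show i + 1 + 1 + i = 2 * (i + 1) by ring, pow_mul, neg_one_sq, one_pow, one_mul,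
      pow_succ _ (i + 1), mul_neg_one, neg_smul]
    change _ - _ • (_ * ExteriorAlgebra.ι ℝ v) = _
    abel

/-- The span of the vectors `∂_{u_i}`. -/
def horOne (m : ℕ) : Submodule ℝ (Ext m) := Submodule.span ℝ (Set.range fun i => gen (some i))

theorem gen_mem_horOne (i : Fin m) : gen (some i) ∈ horOne m := Submodule.subset_span ⟨i, rfl⟩

theorem horOne_le : horOne m ≤ LinearMap.range (ExteriorAlgebra.ι ℝ : Space m →ₗ[ℝ] Ext m) := by
  rw [horOne, Submodule.span_le]
  rintro _ ⟨i, rfl⟩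
  exact ⟨_, rfl⟩

theorem horOne_pow_le (k : ℕ) : horOne m ^ k ≤ ⋀[ℝ]^k (Space m) := pow_le_pow_left' horOne_le k

/-- The constant horizontal `k`-vectors, `k ∈ ℤ`. -/
def hor (m : ℕ) : ℤ → Submodule ℝ (Ext m)
  | Int.ofNat k => horOne m ^ k
  | Int.negSucc _ => ⊥

theorem hor_natCast (k : ℕ) : hor m (k : ℤ) = horOne m ^ k := rfl

theorem mem_hor {k : ℤ} {w : Ext m} :
    w ∈ hor m k ↔ w = 0 ∨ ∃ j : ℕ, k = j ∧ w ∈ horOne m ^ j := by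
  rcases k with k | k
  · constructor
    · exact fun h => Or.inr ⟨k, rfl, h⟩
    · rintro (rfl | ⟨j, hj, h⟩)
      · exact Submodule.zero_mem _
      · obtain rfl : k = j := Int.ofNat.inj hj
        exact h
  · constructor
    · exact fun h => Or.inl h
    · rintro (rfl | ⟨j, hj, h⟩)
      · exact Submodule.zero_mem _
      · exact absurd hj (by omega)

theorem gen_mul_mem_hor (i : Fin m) {k : ℤ} {w : Ext m} (hw : w ∈ hor m k) :
    gen (some i) * w ∈ hor m (k + 1) := by
  rw [mem_hor] at hw ⊢
  obtain rfl | ⟨j, rfl, hw⟩ := hw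
  · simp
  · refine Or.inr ⟨j + 1, by push_cast; rfl, ?_⟩
    rw [pow_succ']
    exact Submodule.mul_mem_mul (gen_mem_horOne i) hw

theorem ctr_none_of_mem_pow {k : ℕ} {w : Ext m} (hw : w ∈ horOne m ^ k) : ctr none w = 0 := by
  induction hw using Submodule.pow_induction_on_left' with
  | algebraMap r => exact ctr_algebraMap _ _
  | add x y i hx hy ihx ihy => rw [map_add, ihx, ihy, add_zero]
  | mem_mul v hv i x hx ih =>
    clear hx
    induction hv using Submodule.span_induction with
    | mem v hv =>
      obtain ⟨i, rfl⟩ := hv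
      simp [ctr_gen_mul, ih]
    | zero => simp
    | add a b _ _ ha hb => rw [add_mul, map_add, ha, hb, add_zero]
    | smul r a _ ha => rw [smul_mul_assoc, map_smul, ha, smul_zero]

theorem ctr_none_of_mem_hor {k : ℤ} {w : Ext m} (hw : w ∈ hor m k) : ctr none w = 0 := by
  rw [mem_hor] at hw
  obtain rfl | ⟨j, rfl, hw⟩ := hw
  · simp
  · exact ctr_none_of_mem_pow hw

theorem ctr_some_mem_pow (j : Fin m) {k : ℕ} {w : Ext m} (hw : w ∈ horOne m ^ k) :
    ctr (some j) w ∈ hor m (k - 1) := by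
  induction hw using Submodule.pow_induction_on_left' with
  | algebraMap r => rw [ctr_algebraMap]; exact Submodule.zero_mem _
  | add x y i hx hy ihx ihy => rw [map_add]; exact Submodule.add_mem _ ihx ihy
  | mem_mul v hv i x hx ih =>
    have e : ((i.succ : ℕ) : ℤ) - 1 = i := by push_cast; ring
    rw [e]
    induction hv using Submodule.span_induction with
    | mem v hv =>
      obtain ⟨l, rfl⟩ := hv
      rw [ctr_gen_mul]
      refine Submodule.sub_mem _ ?_ ?_
      · split_ifs
        · exact hx
        · exact Submodule.zero_mem _
      · simpa using gen_mul_mem_hor l ih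
    | zero => simp
    | add a b _ _ ha hb => rw [add_mul, map_add]; exact Submodule.add_mem _ ha hb
    | smul r a _ ha => rw [smul_mul_assoc, map_smul]; exact Submodule.smul_mem _ _ ha

theorem ctr_some_mem_hor (i : Fin m) {k : ℤ} {w : Ext m} (hw : w ∈ hor m k) :
    ctr (some i) w ∈ hor m (k - 1) := by
  rw [mem_hor] at hw
  obtain rfl | ⟨j, rfl, hw⟩ := hw
  · simp
  · exact ctr_some_mem_pow i hw

/-- The operator ∑ ∂_i∧ι_{du_i} is a derivation that fixes every ∂_j, so it counts the degree. It
supplies the -k in the differential and the shift in the Koszul homotopy. -/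
theorem sum_gen_mul_ctr_pow {k : ℕ} {w : Ext m} (hw : w ∈ horOne m ^ k) :
    ∑ i, gen (some i) * ctr (some i) w = (k : ℝ) • w := by
  induction hw using Submodule.pow_induction_on_left' with
  | algebraMap r => simp [ctr_algebraMap]
  | add x y i hx hy ihx ihy => simp only [map_add, mul_add, Finset.sum_add_distrib, ihx, ihy, smul_add]
  | mem_mul v hv i x hx ih =>
    clear hx
    induction hv using Submodule.span_induction with
    | mem v hv =>
      obtain ⟨l, rfl⟩ := hv
      simp only [ctr_gen_mul, mul_sub, Finset.sum_sub_distrib, gen_mul_gen_mul _ (some l)]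
      rw [Finset.sum_neg_distrib, ← Finset.mul_sum, ih, Finset.sum_eq_single l]
      · simp [add_smul, add_comm]
      · intro b _ hb
        simp [hb]
      · simp
    | zero => simp
    | add a b _ _ ha hb =>
      simp only [add_mul, map_add, mul_add, Finset.sum_add_distrib, ha, hb, smul_add]
    | smul r a _ ha =>
      simp only [smul_mul_assoc, map_smul, mul_smul_comm, ← Finset.smul_sum, ha]
      rw [smul_comm]

theorem sum_gen_mul_ctr {k : ℤ} {w : Ext m} (hw : w ∈ hor m k) :
    ∑ i, gen (some i) * ctr (some i) w = (k : ℝ) • w := by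
  rw [mem_hor] at hw
  obtain rfl | ⟨j, rfl, hw⟩ := hw
  · simp
  · simpa using sum_gen_mul_ctr_pow hw

theorem sum_ctr_gen_mul {k : ℤ} {w : Ext m} (hw : w ∈ hor m k) :
    ∑ i, ctr (some i) (gen (some i) * w) = ((m : ℝ) - k) • w := by
  simp [ctr_gen_mul, Finset.sum_sub_distrib, sum_gen_mul_ctr hw, sub_smul, Nat.cast_smul_eq_nsmul]

/-- The projection of `ℝ × ℝ^m` to the horizontal vectors. -/
def horProj (m : ℕ) : Space m →ₗ[ℝ] Space m :=
  (LinearMap.inr ℝ ℝ (Fin m → ℝ)).comp (LinearMap.snd ℝ ℝ (Fin m → ℝ))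

theorem horProj_apply (v : Space m) : horProj m v = v - coordCovec none v • coordVec none := by
  ext <;> simp [horProj, coordCovec, coordVec]

theorem ι_horProj_mem (v : Space m) : ExteriorAlgebra.ι ℝ (horProj m v) ∈ horOne m := by
  have : horProj m v = ∑ i, v.2 i • coordVec (some i) := by
    rw [sum_smul_coordVec]; rfl
  rw [this, map_sum]
  refine Submodule.sum_mem _ fun i _ => ?_
  rw [map_smul]
  exact Submodule.smul_mem _ _ (gen_mem_horOne i)

/-- Identifying 1 - ∂_t∧ι_{dt} with an algebra map that kills ∂_t shows that its values are
horizontal, which gives the splitting ∂_t∧a + b. -/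
theorem sub_gen_mul_ctr (w : Ext m) :
    w - gen none * ctr none w = ExteriorAlgebra.map (horProj m) w := by
  induction w using CliffordAlgebra.left_induction with
  | algebraMap r =>
    erw [ctr_algebraMap]
    rw [mul_zero, sub_zero]
    exact ((ExteriorAlgebra.map (horProj m)).commutes r).symm
  | add x y hx hy =>
    rw [map_add, map_add, ← hx, ← hy, mul_add]
    exact add_sub_add_comm _ _ _ _
  | ι_mul w v hw =>
    rw [map_mul (ExteriorAlgebra.map (horProj m)) (CliffordAlgebra.ι 0 v) w, ← hw]
    change ExteriorAlgebra.ι ℝ v * w - gen none * ctr none (ExteriorAlgebra.ι ℝ v * w) =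
      ExteriorAlgebra.map (horProj m) (ExteriorAlgebra.ι ℝ v) * (w - gen none * ctr none w)
    rw [ExteriorAlgebra.map_apply_ι, horProj_apply, map_sub, map_smul, ctr_ι_mul]
    change _ = (_ - _ • gen none) * _
    rw [sub_mul, mul_sub, mul_sub, mul_smul_comm, smul_mul_assoc, mul_sub, ← mul_assoc (gen none)
      (gen none), gen_mul_gen_self, zero_mul, sub_zero, ← mul_assoc, gen, ι_mul_ι_comm _ v, neg_mul,
      mul_assoc]
    abel

theorem map_horProj_mem {k : ℕ} {w : Ext m} (hw : w ∈ ⋀[ℝ]^k (Space m)) :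
    ExteriorAlgebra.map (horProj m) w ∈ horOne m ^ k := by
  have h : (LinearMap.range (ExteriorAlgebra.ι ℝ : Space m →ₗ[ℝ] Ext m)).map
      (ExteriorAlgebra.map (horProj m)).toLinearMap ≤ horOne m := by
    rintro _ ⟨_, ⟨v, rfl⟩, rfl⟩
    rw [AlgHom.toLinearMap_apply, ExteriorAlgebra.map_apply_ι]
    exact ι_horProj_mem v
  refine pow_le_pow_left' h k ?_
  rw [← Submodule.map_pow]
  exact ⟨w, hw, rfl⟩

theorem ctr_mem_exteriorPower (c : Coord m) {k : ℕ} {w : Ext m} (hw : w ∈ ⋀[ℝ]^k (Space m)) :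
    ctr c w ∈ ⋀[ℝ]^(k - 1) (Space m) := by
  induction hw using Submodule.pow_induction_on_left' with
  | algebraMap r => rw [ctr_algebraMap]; exact Submodule.zero_mem _
  | add x y i hx hy ihx ihy => rw [map_add]; exact Submodule.add_mem _ ihx ihy
  | mem_mul v hv i x hx ih =>
    obtain ⟨v, rfl⟩ := hv
    rw [ctr_ι_mul]
    refine Submodule.sub_mem _ (Submodule.smul_mem _ _ hx) ?_
    rcases i with _ | i
    · obtain ⟨r, rfl⟩ := Submodule.mem_one.1 (by simpa using hx)
      rw [ctr_algebraMap, mul_zero]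
      exact Submodule.zero_mem _
    · have := Submodule.mul_mem_mul (LinearMap.mem_range_self (ExteriorAlgebra.ι ℝ) v) ih
      rwa [← pow_succ'] at this

theorem mem_pow_of_ctr_none {k : ℕ} {w : Ext m} (hw : w ∈ ⋀[ℝ]^k (Space m))
    (h : ctr none w = 0) : w ∈ horOne m ^ k := by
  have := sub_gen_mul_ctr w
  rw [h, mul_zero, sub_zero] at this
  rw [this]
  exact map_horProj_mem hw

theorem ctr_none_mem_hor {k : ℕ} {w : Ext m} (hw : w ∈ ⋀[ℝ]^k (Space m)) :
    ctr none w ∈ hor m (k - 1) := by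
  rcases k with _ | k
  · obtain ⟨r, rfl⟩ := Submodule.mem_one.1 (by simpa using hw)
    rw [ctr_algebraMap]
    exact Submodule.zero_mem _
  · rw [show ((k + 1 : ℕ) : ℤ) - 1 = (k : ℤ) by push_cast; ring]
    exact mem_pow_of_ctr_none (ctr_mem_exteriorPower _ hw) (ctr_ctr _ _)

theorem horOne_pow_eq_span (k : ℕ) :
    horOne m ^ k = Submodule.span ℝ (Set.range fun J : Fin k → Fin m =>
      ExteriorAlgebra.ιMulti ℝ k (fun s => coordVec (some (J s)) : Fin k → Space m)) := by
  rw [horOne, Submodule.span_pow]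
  congr 1
  ext w
  rw [Set.mem_pow]
  constructor
  · rintro ⟨f, rfl⟩
    choose J hJ using fun s => (f s).2
    refine ⟨J, ?_⟩
    simp only [ExteriorAlgebra.ιMulti_apply]
    congr 2
    exact funext fun s => hJ s
  · rintro ⟨J, rfl⟩
    exact ⟨fun s => ⟨gen (some (J s)), Set.mem_range_self _⟩,
      (ExteriorAlgebra.ιMulti_apply _).symm⟩

theorem hor_eq_bot {k : ℤ} (hk : (m : ℤ) < k) : hor m k = ⊥ := by
  rcases k with k | k
  · have hk' : m < k := by simpa using hk
    rw [Int.ofNat_eq_natCast, hor_natCast, horOne_pow_eq_span, Submodule.span_eq_bot]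
    rintro _ ⟨J, rfl⟩
    -- Pigeonhole: more than m indices from m values must repeat.
    obtain ⟨a, b, hab, h⟩ : ∃ a b, a ≠ b ∧ J a = J b := by
      by_contra! h
      have := Fintype.card_le_of_injective J fun a b e => by_contra fun hab => h a b hab e
      simp at this
      omega
    exact AlternatingMap.map_eq_zero_of_eq _ _ (by simp [h]) hab
  · rfl

instance finite_hor (k : ℤ) : Module.Finite ℝ (hor m k) := by
  rw [Module.Finite.iff_fg]
  rcases k with k | k
  · exact Submodule.FG.pow (Submodule.fg_span (Set.finite_range _)) k
  · exact Submodule.fg_bot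

end BookPoisson
end

/-! ### Horizontal multivector fields and their coefficients. -/

noncomputable section
namespace BookPoisson

variable {m : ℕ} {U : TopologicalSpace.Opens (Space m)}

/-- The sums of products of a function in `K` and a constant horizontal `k`-vector. -/
def tens (K : Submodule ℝ (Smooth U)) (k : ℤ) : Submodule ℝ (MultiVF U) :=
  Submodule.map₂ (TensorProduct.mk ℝ (Smooth U) (Ext m)) K (hor m k)

theorem tmul_mem_tens {K : Submodule ℝ (Smooth U)} {k : ℤ} {f : Smooth U} (hf : f ∈ K) {w : Ext m}
    (hw : w ∈ hor m k) : (f ⊗ₜ[ℝ] w : MultiVF U) ∈ tens K k :=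
  Submodule.apply_mem_map₂ _ hf hw

-- Scalars are absorbed into the function factor, so no scalar case is needed; for this the
-- induction runs over all multiples `r • x`.
@[elab_as_elim]
theorem tens_induction {K : Submodule ℝ (Smooth U)} {k : ℤ} {p : ∀ x : MultiVF U, x ∈ tens K k → Prop}
    (tmul : ∀ f, ∀ hf : f ∈ K, ∀ w, ∀ hw : w ∈ hor m k, p (f ⊗ₜ[ℝ] w) (tmul_mem_tens hf hw))
    (zero : p 0 (Submodule.zero_mem _))
    (add : ∀ x y hx hy, p x hx → p y hy → p (x + y) (Submodule.add_mem _ hx hy)) {x : MultiVF U}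
    (hx : x ∈ tens K k) : p x hx := by
  suffices ∀ r : ℝ, ∃ h : r • x ∈ tens K k, p (r • x) h by simpa [hx] using this 1
  rw [tens, Submodule.map₂_eq_span_image2] at hx
  induction hx using Submodule.span_induction with
  | mem x hx =>
    obtain ⟨f, hf, w, hw, rfl⟩ := hx
    exact fun r => ⟨_, tmul (r • f) (K.smul_mem r hf) w hw⟩
  | zero => exact fun r => by simpa using zero
  | add x y _ _ hx hy =>
    intro r
    obtain ⟨h1, h2⟩ := hx r
    obtain ⟨h3, h4⟩ := hy r
    rw [smul_add]
    exact ⟨_, add _ _ _ _ h2 h4⟩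
  | smul a x _ hx =>
    intro r
    rw [smul_smul]
    exact hx _

theorem tens_mono {K L : Submodule ℝ (Smooth U)} (h : K ≤ L) (k : ℤ) : tens K k ≤ tens L k :=
  Submodule.map₂_le_map₂_left h

/-- The linear functional `φ` on constant multivectors applied to a multivector field. -/
def coef (U : TopologicalSpace.Opens (Space m)) (φ : Module.Dual ℝ (Ext m)) :
    MultiVF U →ₗ[ℝ] Smooth U :=
  (TensorProduct.rid ℝ (Smooth U)).toLinearMap.comp (φ.lTensor (Smooth U))

@[simp]
theorem coef_tmul (φ : Module.Dual ℝ (Ext m)) (f : Smooth U) (w : Ext m) :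
    coef U φ (f ⊗ₜ[ℝ] w) = φ w • f := by
  simp [coef]

theorem coef_rTensor (φ : Module.Dual ℝ (Ext m)) (D : Smooth U →ₗ[ℝ] Smooth U) (x : MultiVF U) :
    coef U φ (D.rTensor (Ext m) x) = D (coef U φ x) := by
  induction x using TensorProduct.induction_on with
  | zero => simp
  | tmul f w => simp
  | add x y hx hy => simp [hx, hy]

/-- Coordinate functionals of a basis of the horizontal k-vectors, extended to all multivectors.
They reduce statements about fields to statements about coefficient functions. -/
theorem exists_dual_basis (k : ℤ) : ∃ (N : ℕ) (e : Fin N → Ext m) (φ : Fin N → Module.Dual ℝ (Ext m)),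
    (∀ i, e i ∈ hor m k) ∧ ∀ w ∈ hor m k, ∑ i, φ i w • e i = w := by
  let b := Module.finBasis ℝ (hor m k)
  choose φ hφ using fun i => LinearMap.exists_extend (b.coord i)
  refine ⟨_, fun i => b i, φ, fun i => (b i).2, fun w hw => ?_⟩
  have h := congrArg (Subtype.val) (b.sum_repr ⟨w, hw⟩)
  simp only [Submodule.coe_sum, Submodule.coe_smul] at h
  rw [← h]
  refine Finset.sum_congr rfl fun i _ => ?_
  rw [h]
  congr 1
  exact LinearMap.congr_fun (hφ i) ⟨w, hw⟩

theorem eq_sum_coef_tmul {k : ℤ} {N : ℕ} {e : Fin N → Ext m} {φ : Fin N → Module.Dual ℝ (Ext m)}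
    (h : ∀ w ∈ hor m k, ∑ i, φ i w • e i = w) {x : MultiVF U} (hx : x ∈ tens ⊤ k) :
    ∑ i, coef U (φ i) x ⊗ₜ[ℝ] e i = x := by
  induction hx using tens_induction with
  | tmul f _ w hw =>
    simp only [coef_tmul, TensorProduct.smul_tmul]
    rw [← TensorProduct.tmul_sum, h w hw]
  | zero => simp
  | add x y _ _ hx hy => simp only [map_add, TensorProduct.add_tmul, Finset.sum_add_distrib, hx, hy]

theorem mem_tens_of_coef {K : Submodule ℝ (Smooth U)} {k : ℤ} {x : MultiVF U} (hx : x ∈ tens ⊤ k)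
    (h : ∀ φ, coef U φ x ∈ K) : x ∈ tens K k := by
  obtain ⟨N, e, φ, he, hφ⟩ := exists_dual_basis (m := m) k
  rw [← eq_sum_coef_tmul hφ hx]
  exact Submodule.sum_mem _ fun i _ => tmul_mem_tens (h _) (he i)

theorem coef_mem_of_mem_tens {K : Submodule ℝ (Smooth U)} {k : ℤ} {x : MultiVF U}
    (hx : x ∈ tens K k) (φ : Module.Dual ℝ (Ext m)) : coef U φ x ∈ K := by
  induction hx using tens_induction with
  | tmul f hf w _ => rw [coef_tmul]; exact K.smul_mem _ hf
  | zero => simp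
  | add x y _ _ hx hy => rw [map_add]; exact K.add_mem hx hy

theorem eq_zero_of_coef {k : ℤ} {x : MultiVF U} (hx : x ∈ tens ⊤ k) (h : ∀ φ, coef U φ x = 0) :
    x = 0 := by
  obtain ⟨N, e, φ, he, hφ⟩ := exists_dual_basis (m := m) k
  rw [← eq_sum_coef_tmul hφ hx]
  simp [h]

theorem rTensor_mem_tens {K L : Submodule ℝ (Smooth U)} {D : Smooth U →ₗ[ℝ] Smooth U}
    (hD : ∀ f ∈ K, D f ∈ L) {k : ℤ} {x : MultiVF U} (hx : x ∈ tens K k) :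
    D.rTensor (Ext m) x ∈ tens L k := by
  induction hx using tens_induction with
  | tmul f hf w hw => rw [LinearMap.rTensor_tmul]; exact tmul_mem_tens (hD f hf) hw
  | zero => simp
  | add x y _ _ hx hy => rw [map_add]; exact Submodule.add_mem _ hx hy

theorem rTensor_eq_zero {K : Submodule ℝ (Smooth U)} {D : Smooth U →ₗ[ℝ] Smooth U}
    (hD : ∀ f ∈ K, D f = 0) {k : ℤ} {x : MultiVF U} (hx : x ∈ tens K k) :
    D.rTensor (Ext m) x = 0 := by
  induction hx using tens_induction with
  | tmul f hf w hw => rw [LinearMap.rTensor_tmul, hD f hf, TensorProduct.zero_tmul]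
  | zero => simp
  | add x y _ _ hx hy => rw [map_add, hx, hy, add_zero]

theorem rTensor_eq_self {K : Submodule ℝ (Smooth U)} {D : Smooth U →ₗ[ℝ] Smooth U}
    (hD : ∀ f ∈ K, D f = f) {k : ℤ} {x : MultiVF U} (hx : x ∈ tens K k) :
    D.rTensor (Ext m) x = x := by
  induction hx using tens_induction with
  | tmul f hf w hw => rw [LinearMap.rTensor_tmul, hD f hf]
  | zero => simp
  | add x y _ _ hx hy => rw [map_add, hx, hy]

theorem mem_tens_basic {k : ℤ} {x : MultiVF U} (hx : x ∈ tens ⊤ k) (h : pderivM U none x = 0) :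
    x ∈ tens (basic U) k :=
  mem_tens_of_coef hx fun φ => by rw [mem_basic, ← coef_rTensor, ← pderivM, h, map_zero]

theorem pderivM_of_mem_tens_basic {k : ℤ} {x : MultiVF U} (hx : x ∈ tens (basic U) k) :
    pderivM U none x = 0 := rTensor_eq_zero (fun _ hf => hf) hx

/-- The operator `μ ↦ E μ + r μ` on multivector fields, applied to the coefficient functions. -/
def eulerM (U : TopologicalSpace.Opens (Space m)) (r : ℝ) : MultiVF U →ₗ[ℝ] MultiVF U :=
  (eulerShift U r).rTensor (Ext m)

@[simp]
theorem eulerM_tmul (r : ℝ) (f : Smooth U) (w : Ext m) :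
    eulerM U r (f ⊗ₜ[ℝ] w) = eulerShift U r f ⊗ₜ[ℝ] w := rfl

@[simp]
theorem pderivM_tmul (c : Coord m) (f : Smooth U) (w : Ext m) :
    pderivM U c (f ⊗ₜ[ℝ] w) = pderiv U c f ⊗ₜ[ℝ] w := rfl

@[simp]
theorem contractL_tmul (c : Coord m) (f : Smooth U) (w : Ext m) :
    contractL U c (f ⊗ₜ[ℝ] w) = f ⊗ₜ[ℝ] ctr c w := rfl

@[simp]
theorem vf_mul_tmul (c : Coord m) (f : Smooth U) (w : Ext m) :
    vf U c * (f ⊗ₜ[ℝ] w) = f ⊗ₜ[ℝ] (gen c * w) := by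
  rw [vf, Algebra.TensorProduct.tmul_mul_tmul, one_mul]
  rfl

theorem euler_eq : euler U = ∑ i, coordU U i ⊗ₜ[ℝ] gen (some i) := by
  refine Finset.sum_congr rfl fun i _ => ?_
  rw [vf, TensorProduct.smul_tmul', smul_eq_mul, mul_one]
  rfl

@[simp]
theorem euler_mul_tmul (f : Smooth U) (w : Ext m) :
    euler U * (f ⊗ₜ[ℝ] w) = ∑ i, (coordU U i * f) ⊗ₜ[ℝ] (gen (some i) * w) := by
  simp [euler_eq, Finset.sum_mul]

theorem pderivM_vf_mul (c c' : Coord m) (x : MultiVF U) :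
    pderivM U c (vf U c' * x) = vf U c' * pderivM U c x := by
  induction x using TensorProduct.induction_on with
  | zero => simp
  | tmul f w => simp
  | add x y hx hy => simp [hx, hy, mul_add]

theorem pderivM_euler_mul (x : MultiVF U) :
    pderivM U none (euler U * x) = euler U * pderivM U none x := by
  induction x using TensorProduct.induction_on with
  | zero => simp
  | tmul f w => simp [pderiv_mul]
  | add x y hx hy => simp [hx, hy, mul_add]

theorem eulerM_euler_mul (r : ℝ) (x : MultiVF U) :
    eulerM U r (euler U * x) = euler U * eulerM U (r + 1) x := by
  induction x using TensorProduct.induction_on with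
  | zero => simp
  | tmul f w => simp [eulerShift_coordU_mul]
  | add x y hx hy => simp [hx, hy, mul_add]

theorem pderivM_eulerM (r : ℝ) (x : MultiVF U) :
    pderivM U none (eulerM U r x) = eulerM U r (pderivM U none x) := by
  induction x using TensorProduct.induction_on with
  | zero => simp
  | tmul f w => simp [pderiv_none_eulerShift]
  | add x y hx hy => simp [hx, hy]

theorem contractL_vf_mul (c : Coord m) (x : MultiVF U) :
    contractL U c (vf U c * x) = x - vf U c * contractL U c x := by
  induction x using TensorProduct.induction_on with
  | zero => simp
  | tmul f w => simp [ctr_gen_mul, TensorProduct.tmul_sub]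
  | add x y hx hy => simp only [hx, hy, mul_add, map_add]; abel

theorem vf_mul_vf_mul (c : Coord m) (x : MultiVF U) : vf U c * (vf U c * x) = 0 := by
  rw [← mul_assoc, vf, Algebra.TensorProduct.tmul_mul_tmul]
  change ((1 * 1 : Smooth U) ⊗ₜ[ℝ] (gen c * gen c)) * x = 0
  rw [gen_mul_gen_self, TensorProduct.tmul_zero, zero_mul]

theorem euler_mul_vf_mul (x : MultiVF U) :
    euler U * (vf U none * x) = -(vf U none * (euler U * x)) := by
  induction x using TensorProduct.induction_on with
  | zero => simp
  | tmul f w =>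
    simp only [vf_mul_tmul, euler_mul_tmul, Finset.mul_sum, ← Finset.sum_neg_distrib,
      gen_mul_gen_mul _ none, TensorProduct.tmul_neg]
  | add x y hx hy => simp only [hx, hy, mul_add, neg_add]

theorem euler_mul_mem_tens {k : ℤ} {x : MultiVF U} {K L : Submodule ℝ (Smooth U)}
    (hKL : ∀ i, ∀ f ∈ K, coordU U i * f ∈ L) (hx : x ∈ tens K k) :
    euler U * x ∈ tens L (k + 1) := by
  induction hx using tens_induction with
  | tmul f hf w hw =>
    rw [euler_mul_tmul]
    exact Submodule.sum_mem _ fun i _ => tmul_mem_tens (hKL i f hf) (gen_mul_mem_hor i hw)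
  | zero => simp
  | add x y _ _ hx hy => rw [mul_add]; exact Submodule.add_mem _ hx hy

theorem euler_mul_mem_tens_top {k : ℤ} {x : MultiVF U} (hx : x ∈ tens ⊤ k) :
    euler U * x ∈ tens ⊤ (k + 1) :=
  euler_mul_mem_tens (fun _ _ _ => Submodule.mem_top) hx

theorem euler_mul_mem_tens_top_of_sub {k : ℤ} {x : MultiVF U} (hx : x ∈ tens ⊤ (k - 1)) :
    euler U * x ∈ tens ⊤ k := by
  simpa using euler_mul_mem_tens_top hx

theorem pderivM_mem_tens_top (c : Coord m) {k : ℤ} {x : MultiVF U} (hx : x ∈ tens ⊤ k) :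
    pderivM U c x ∈ tens ⊤ k :=
  rTensor_mem_tens (fun _ _ => Submodule.mem_top) hx

theorem eulerM_mem_tens_top (r : ℝ) {k : ℤ} {x : MultiVF U} (hx : x ∈ tens ⊤ k) :
    eulerM U r x ∈ tens ⊤ k :=
  rTensor_mem_tens (fun _ _ => Submodule.mem_top) hx

theorem contractL_of_mem_tens {K : Submodule ℝ (Smooth U)} {k : ℤ} {x : MultiVF U}
    (hx : x ∈ tens K k) : contractL U none x = 0 := by
  induction hx using tens_induction with
  | tmul f hf w hw => rw [contractL_tmul, ctr_none_of_mem_hor hw, TensorProduct.tmul_zero]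
  | zero => simp
  | add x y _ _ hx hy => rw [map_add, hx, hy, add_zero]

theorem tens_le_kVF (k : ℤ) : tens ⊤ k ≤ kVF U k := by
  intro x hx
  induction hx using tens_induction with
  | tmul f _ w hw =>
    obtain rfl | ⟨j, rfl, hw⟩ := mem_hor.1 hw
    · simp
    · exact Submodule.subset_span ⟨j, f, w, horOne_pow_le j hw, rfl, rfl⟩
  | zero => simp
  | add x y _ _ hx hy => exact Submodule.add_mem _ hx hy

theorem vf_mul_mem_kVF {k : ℤ} {x : MultiVF U} (hx : x ∈ tens ⊤ (k - 1)) :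
    vf U none * x ∈ kVF U k := by
  induction hx using tens_induction with
  | tmul f _ w hw =>
    obtain rfl | ⟨j, hj, hw⟩ := mem_hor.1 hw
    · simp
    · rw [vf_mul_tmul]
      refine Submodule.subset_span ⟨j + 1, f, _, ?_, by push_cast; omega, rfl⟩
      rw [ExteriorAlgebra.exteriorPower, pow_succ']
      exact Submodule.mul_mem_mul ⟨_, rfl⟩ (horOne_pow_le j hw)
  | zero => simp
  | add x y _ _ hx hy => rw [mul_add]; exact Submodule.add_mem _ hx hy

/-- Every `k`-vector field is of the form `∂_t ∧ a + b` with horizontal `a` and `b`. -/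
theorem exists_eq_vf_mul_add {k : ℤ} {x : MultiVF U} (hx : x ∈ kVF U k) :
    ∃ a ∈ tens (U := U) ⊤ (k - 1), ∃ b ∈ tens (U := U) ⊤ k, x = vf U none * a + b := by
  rw [kVF] at hx
  induction hx using Submodule.span_induction with
  | mem x hx =>
    obtain ⟨j, f, w, hw, rfl, rfl⟩ := hx
    refine ⟨f ⊗ₜ ctr none w, tmul_mem_tens Submodule.mem_top (ctr_none_mem_hor hw),
      f ⊗ₜ ExteriorAlgebra.map (horProj m) w,
      tmul_mem_tens Submodule.mem_top (map_horProj_mem hw), ?_⟩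
    rw [vf_mul_tmul, ← TensorProduct.tmul_add, ← sub_gen_mul_ctr, add_sub_cancel]
  | zero => exact ⟨0, Submodule.zero_mem _, 0, Submodule.zero_mem _, by simp⟩
  | add x y _ _ hx hy =>
    obtain ⟨a, ha, b, hb, rfl⟩ := hx
    obtain ⟨a', ha', b', hb', rfl⟩ := hy
    exact ⟨a + a', Submodule.add_mem _ ha ha', b + b', Submodule.add_mem _ hb hb', by
      rw [mul_add]; abel⟩
  | smul r x _ hx =>
    obtain ⟨a, ha, b, hb, rfl⟩ := hx
    exact ⟨r • a, Submodule.smul_mem _ _ ha, r • b, Submodule.smul_mem _ _ hb, by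
      rw [mul_smul_comm, smul_add]⟩

theorem vf_mul_add_inj {k l : ℤ} {a a' b b' : MultiVF U} (ha : a ∈ tens ⊤ l) (ha' : a' ∈ tens ⊤ l)
    (hb : b ∈ tens ⊤ k) (hb' : b' ∈ tens ⊤ k) (h : vf U none * a + b = vf U none * a' + b') :
    a = a' ∧ b = b' := by
  have h' := congrArg (contractL U none) h
  simp only [map_add, contractL_vf_mul, contractL_of_mem_tens ha, contractL_of_mem_tens ha',
    contractL_of_mem_tens hb, contractL_of_mem_tens hb', mul_zero, sub_zero, add_zero] at h'
  subst h'
  exact ⟨rfl, add_left_cancel h⟩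

theorem horizontal_eq (k : ℤ) : horizontal U k = tens ⊤ k := by
  refine le_antisymm ?_ fun x hx => ⟨tens_le_kVF k hx, contractL_of_mem_tens hx⟩
  rintro x ⟨hx, hx0⟩
  obtain ⟨a, ha, b, hb, rfl⟩ := exists_eq_vf_mul_add hx
  have h : contractL U none (vf U none * a + b) = 0 := hx0
  rw [map_add, contractL_vf_mul, contractL_of_mem_tens ha, contractL_of_mem_tens hb, mul_zero,
    sub_zero, add_zero] at h
  rw [h, mul_zero, zero_add]
  exact hb

/-- The homogeneous polynomials of degree `k` in the `u_i`, `k ∈ ℤ`. -/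
def homPolyInt (U : TopologicalSpace.Opens (Space m)) : ℤ → Submodule ℝ (Smooth U)
  | Int.ofNat k => homPoly U k
  | Int.negSucc _ => ⊥

theorem polyW_eq (k : ℤ) : polyW U k = tens (homPolyInt U k) k := by
  rcases k with k | k
  · rw [tens]
    simp only [homPolyInt, homPoly, hor, horOne_pow_eq_span]
    rw [Submodule.map₂_span_span, polyW]
    congr 1
    ext x
    constructor
    · rintro ⟨j, I, J, hj, rfl⟩
      obtain rfl : j = k := by simpa using hj
      exact ⟨_, ⟨I, rfl⟩, _, ⟨J, rfl⟩, rfl⟩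
    · rintro ⟨_, ⟨I, rfl⟩, _, ⟨J, rfl⟩, rfl⟩
      exact ⟨k, I, J, rfl, rfl⟩
  · rw [tens, homPolyInt, Submodule.map₂_bot_left, polyW, Submodule.span_eq_bot]
    rintro x ⟨j, _, _, hj, _⟩
    omega

end BookPoisson
end

/-! ### The Poisson differential in components, and Taylor operators on multivector fields. -/

noncomputable section
namespace BookPoisson

variable {m : ℕ} {U : TopologicalSpace.Opens (Space m)}

/-- The right contraction with `dt` or `du_i`. -/
def ctrR (c : Coord m) (w : Ext m) : Ext m :=
  CliffordAlgebra.contractRight (Q := (0 : QuadraticForm ℝ (Space m))) w (coordCovec c)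

theorem contractR_tmul (c : Coord m) (f : Smooth U) (w : Ext m) :
    contractR U c (f ⊗ₜ[ℝ] w) = f ⊗ₜ[ℝ] ctrR c w := rfl

theorem ctrR_eq (c : Coord m) {k : ℕ} {w : Ext m} (hw : w ∈ ⋀[ℝ]^k (Space m)) :
    ctrR c w = (-1 : ℝ) ^ (k + 1) • ctr c w :=
  contractRight_eq_of_mem _ k w hw

theorem ctrR_gen_mul_gen (c c₁ c₂ : Coord m) :
    ctrR c (gen c₁ * gen c₂) = (if c = c₂ then gen c₁ else 0) - if c = c₁ then gen c₂ else 0 := by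
  have h1 : ctrR c (gen c₁) = if c = c₁ then 1 else 0 := by
    refine (CliffordAlgebra.contractRight_ι _ _ _).trans ?_
    rw [coordCovec_coordVec]
    split_ifs
    · exact map_one _
    · exact map_zero _
  refine (CliffordAlgebra.contractRight_mul_ι (coordCovec c) (coordVec c₂) (gen c₁)).trans ?_
  rw [coordCovec_coordVec]
  change _ - ctrR c (gen c₁) * gen c₂ = _
  rw [h1]
  congr 1
  · split_ifs
    · exact one_smul _ _
    · exact zero_smul _ _
  · split_ifs
    · exact one_mul _
    · exact zero_mul _

theorem halfSchouten_apply (x y : MultiVF U) :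
    halfSchouten U x y = ∑ c, contractR U c x * pderivM U c y := by
  simp [halfSchouten, LinearMap.sum_apply]

theorem bookBivector_eq :
    bookBivector U = ∑ i, coordU U i ⊗ₜ[ℝ] (gen none * gen (some i)) := by
  simp [bookBivector, euler_eq, Finset.mul_sum]

/-- The odd derivatives of ∂_t∧E are -E in the direction of ∂_t and u_j ∂_t in the direction of
∂_{u_j}. -/
theorem halfSchouten_bookBivector (x : MultiVF U) :
    halfSchouten U (bookBivector U) x =
      vf U none * eulerM U 0 x - euler U * pderivM U none x := by
  have h0 : contractR U none (bookBivector U) = -euler U := by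
    simp [bookBivector_eq, contractR_tmul, ctrR_gen_mul_gen, euler_eq, TensorProduct.tmul_neg]
  have hs (j : Fin m) : contractR U (some j) (bookBivector U) = coordU U j ⊗ₜ[ℝ] gen none := by
    rw [bookBivector_eq, map_sum, Finset.sum_eq_single j]
    · simp [contractR_tmul, ctrR_gen_mul_gen]
    · intro i _ hi
      simp [contractR_tmul, ctrR_gen_mul_gen, Ne.symm hi]
    · simp
  rw [halfSchouten_apply, Fintype.sum_option, h0]
  simp only [hs]
  rw [neg_mul, neg_add_eq_sub]
  congr 1
  induction x using TensorProduct.induction_on with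
  | zero => simp
  | tmul f w =>
    simp [eulerShift_apply, eulerOp_apply, TensorProduct.sum_tmul, Finset.mul_sum]
  | add x y hx hy => simp only [map_add, mul_add, Finset.sum_add_distrib, hx, hy]

theorem halfSchouten_bookBivector_right (f : Smooth U) (w : Ext m) :
    halfSchouten U (f ⊗ₜ w) (bookBivector U) =
      ∑ j, f ⊗ₜ[ℝ] (ctrR (some j) w * (gen none * gen (some j))) := by
  have h0 : pderivM U none (bookBivector U) = 0 := by simp [bookBivector_eq]
  have hs (j : Fin m) : pderivM U (some j) (bookBivector U) =
      1 ⊗ₜ[ℝ] (gen none * gen (some j)) := by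
    rw [bookBivector_eq, map_sum, Finset.sum_eq_single j]
    · simp [pderiv_coordU]
    · intro i _ hi
      simp [pderiv_coordU, Ne.symm hi]
    · simp
  rw [halfSchouten_apply, Fintype.sum_option, h0]
  simp only [hs, contractR_tmul]
  simp

/-- Only the derivatives ∂_t∧∂_j of the bivector survive. Bivectors are central, so the
degree-counting operator appears, and the sign of the right contraction cancels the sign of the
bracket. -/
theorem halfSchouten_horizontal {k : ℤ} {x : MultiVF U} (hx : x ∈ tens ⊤ k) :
    (-1 : ℝ) ^ ((2 - 1) * (k - 1)) • halfSchouten U x (bookBivector U) =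
      (k : ℝ) • (vf U none * x) := by
  induction hx using tens_induction with
  | tmul f _ w hw =>
    obtain rfl | ⟨j, rfl, hw'⟩ := mem_hor.1 hw
    · simp
    · have hj := horOne_pow_le j hw'
      have h1 : ∀ i : Fin m, ctrR (some i) w * (gen none * gen (some i)) =
          (-1 : ℝ) ^ (j + 1) • (gen none * (gen (some i) * ctr (some i) w)) := fun i => by
        rw [ctrR_eq _ hj, gen, gen, commute_ι_mul_ι, mul_smul_comm, mul_assoc]
      have h2 : (-1 : ℝ) ^ (((2 : ℤ) - 1) * ((j : ℤ) - 1)) * (-1) ^ (j + 1) = 1 := by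
        rw [show ((2 : ℤ) - 1) * ((j : ℤ) - 1) = (j : ℤ) - 1 by ring, ← zpow_natCast,
          ← zpow_add₀ (by norm_num), show (j : ℤ) - 1 + ((j + 1 : ℕ) : ℤ) = 2 * (j : ℤ) by
            push_cast; ring, zpow_mul]
        norm_num
      rw [halfSchouten_bookBivector_right]
      simp only [h1]
      rw [← TensorProduct.tmul_sum, ← Finset.smul_sum, ← Finset.mul_sum, sum_gen_mul_ctr hw,
        TensorProduct.tmul_smul, smul_smul, h2, one_smul, mul_smul_comm, TensorProduct.tmul_smul,
        vf_mul_tmul]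
  | zero => simp
  | add x y _ _ hx hy =>
    rw [map_add, LinearMap.add_apply, smul_add, hx, hy, mul_add, smul_add]

/-- Contracting with du_j leaves the factor ∂_t in place, and the derivative of the bivector brings
a second one. -/
theorem halfSchouten_vf_mul {k : ℤ} {x : MultiVF U} (hx : x ∈ tens ⊤ k) :
    halfSchouten U (vf U none * x) (bookBivector U) = 0 := by
  induction hx using tens_induction with
  | tmul f _ w hw =>
    obtain rfl | ⟨j, rfl, hw'⟩ := mem_hor.1 hw
    · simp
    · have hj : gen none * w ∈ ⋀[ℝ]^(j + 1) (Space m) := by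
        rw [ExteriorAlgebra.exteriorPower, pow_succ']
        exact Submodule.mul_mem_mul ⟨_, rfl⟩ (horOne_pow_le j hw')
      rw [vf_mul_tmul, halfSchouten_bookBivector_right]
      refine Finset.sum_eq_zero fun i _ => ?_
      rw [ctrR_eq _ hj, gen, gen, smul_mul_assoc, commute_ι_mul_ι]
      change f ⊗ₜ[ℝ] (_ • (gen none * gen (some i) * ctr (some i) (gen none * w))) = 0
      rw [ctr_gen_mul, if_neg (by simp), zero_sub, mul_neg, mul_assoc,
        gen_mul_gen_mul (some i) none, mul_neg, ← mul_assoc (gen none) (gen none),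
        gen_mul_gen_self]
      simp
  | zero => simp
  | add x y _ _ hx hy => rw [mul_add, map_add, LinearMap.add_apply, hx, hy, add_zero]

theorem eulerM_eq (r : ℝ) (x : MultiVF U) : eulerM U r x = eulerM U 0 x + r • x := by
  induction x using TensorProduct.induction_on with
  | zero => simp
  | tmul f w => simp [eulerShift_apply, TensorProduct.add_tmul, TensorProduct.smul_tmul']
  | add x y hx hy => rw [map_add, map_add, hx, hy, smul_add]; abel

theorem eulerM_vf_mul (r : ℝ) (x : MultiVF U) :
    eulerM U r (vf U none * x) = vf U none * eulerM U r x := by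
  induction x using TensorProduct.induction_on with
  | zero => simp
  | tmul f w => simp
  | add x y hx hy => rw [mul_add, map_add, map_add, hx, hy, mul_add]

/-- The Poisson differential of `∂_t ∧ a + b`. -/
theorem dBook_vf_mul_add {k : ℤ} {a b : MultiVF U} (ha : a ∈ tens ⊤ (k - 1)) (hb : b ∈ tens ⊤ k) :
    dBook U k (vf U none * a + b) =
      vf U none * (eulerM U (-k) b + euler U * pderivM U none a) +
        -(euler U * pderivM U none b) := by
  have hd (x : MultiVF U) : dBook U k x = halfSchouten U (bookBivector U) x -
      (-1 : ℝ) ^ ((2 - 1) * (k - 1)) • halfSchouten U x (bookBivector U) := rfl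
  rw [map_add, hd, hd, halfSchouten_vf_mul ha, halfSchouten_horizontal hb,
    halfSchouten_bookBivector, halfSchouten_bookBivector, eulerM_vf_mul, vf_mul_vf_mul,
    pderivM_vf_mul, euler_mul_vf_mul, eulerM_eq (-k), smul_zero, mul_add, mul_add, mul_smul_comm,
    neg_smul]
  abel

theorem mem_cocycles_iff {k : ℤ} {a b : MultiVF U} (ha : a ∈ tens ⊤ (k - 1)) (hb : b ∈ tens ⊤ k) :
    vf U none * a + b ∈ cocycles U k ↔
      eulerM U (-k) b + euler U * pderivM U none a = 0 ∧ euler U * pderivM U none b = 0 := by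
  have h1 : vf U none * a + b ∈ kVF U k :=
    Submodule.add_mem _ (vf_mul_mem_kVF ha) (tens_le_kVF _ hb)
  have h2 : eulerM U (-k) b + euler U * pderivM U none a ∈ tens ⊤ k :=
    Submodule.add_mem _ (eulerM_mem_tens_top _ hb)
      (euler_mul_mem_tens_top_of_sub (pderivM_mem_tens_top _ ha))
  have h3 : -(euler U * pderivM U none b) ∈ tens ⊤ (k + 1) :=
    Submodule.neg_mem _ (euler_mul_mem_tens_top (pderivM_mem_tens_top _ hb))
  constructor
  · rintro ⟨-, h⟩
    have h' : dBook U k (vf U none * a + b) = 0 := h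
    rw [dBook_vf_mul_add ha hb] at h'
    obtain ⟨e1, e2⟩ := vf_mul_add_inj h2 (Submodule.zero_mem _) h3 (Submodule.zero_mem _)
      (h'.trans (by simp : (0 : MultiVF U) = vf U none * 0 + 0))
    exact ⟨e1, neg_eq_zero.1 e2⟩
  · rintro ⟨e1, e2⟩
    refine ⟨h1, ?_⟩
    change dBook U k (vf U none * a + b) = 0
    rw [dBook_vf_mul_add ha hb, e1, e2]
    simp

theorem mem_coboundaries {k : ℤ} {a b : MultiVF U} (ha : a ∈ tens ⊤ (k - 1 - 1))
    (hb : b ∈ tens ⊤ (k - 1)) :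
    vf U none * (eulerM U (-(k - 1)) b + euler U * pderivM U none a) +
      -(euler U * pderivM U none b) ∈ coboundaries U k := by
  refine ⟨vf U none * a + b,
    Submodule.add_mem _ (vf_mul_mem_kVF ha) (tens_le_kVF _ hb), ?_⟩
  rw [dBook_vf_mul_add ha hb]
  push_cast
  rfl

theorem exists_of_mem_coboundaries {k : ℤ} {x : MultiVF U} (hx : x ∈ coboundaries U k) :
    ∃ a ∈ tens (U := U) ⊤ (k - 1 - 1), ∃ b ∈ tens (U := U) ⊤ (k - 1),
      x = vf U none * (eulerM U (-(k - 1)) b + euler U * pderivM U none a) +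
        -(euler U * pderivM U none b) := by
  obtain ⟨y, hy, rfl⟩ := hx
  obtain ⟨a, ha, b, hb, rfl⟩ := exists_eq_vf_mul_add hy
  refine ⟨a, ha, b, hb, ?_⟩
  rw [dBook_vf_mul_add ha hb]
  push_cast
  rfl

/-- The Taylor operators on functions, in all degrees `k ∈ ℤ`. -/
def taylorInt (x₀ : U) : ℤ → (Smooth U →ₗ[ℝ] Smooth U)
  | Int.ofNat k => taylorFun x₀ k
  | Int.negSucc _ => 0

theorem taylorAt_eq (x₀ : U) (k : ℤ) : taylorAt x₀ k = (taylorInt x₀ k).rTensor (Ext m) := by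
  rcases k with k | k
  · rfl
  · exact (LinearMap.rTensor_zero _).symm

theorem taylorInt_mem (x₀ : U) (k : ℤ) (f : Smooth U) : taylorInt x₀ k f ∈ homPolyInt U k := by
  rcases k with k | k
  · exact taylorFun_mem_homPoly x₀ k f
  · exact Submodule.zero_mem _

theorem taylorInt_homPoly (x₀ : U) (k : ℤ) {f : Smooth U} (hf : f ∈ homPolyInt U k) :
    taylorInt x₀ k f = f := by
  rcases k with k | k
  · exact taylorFun_homPoly x₀ hf
  · exact ((Submodule.mem_bot ℝ).1 hf).symm

theorem taylorInt_eulerShift (x₀ : U) (hx₀ : (x₀ : Space m).2 = 0) (k : ℤ) (f : Smooth U) :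
    taylorInt x₀ k (eulerShift U (-k) f) = 0 := by
  rcases k with k | k
  · rw [Int.ofNat_eq_natCast, Int.cast_natCast]
    exact taylorFun_eulerShift x₀ hx₀ k f
  · rfl

theorem taylorInt_coordU_mul (x₀ : U) (hx₀ : (x₀ : Space m).2 = 0) (k : ℤ) (i : Fin m)
    (f : Smooth U) : taylorInt x₀ k (coordU U i * f) = coordU U i * taylorInt x₀ (k - 1) f := by
  rcases k with (_ | k) | k
  -- In degree 0 the operator on the right has degree -1 and is zero by convention, in agreement
  -- with u_i f vanishing at u = 0.
  · exact (taylorFun_zero_coordU_mul x₀ hx₀ i f).trans (mul_zero _).symm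
  · have : (Int.ofNat (k + 1)) - 1 = Int.ofNat k := by simp
    rw [this]
    exact taylorFun_succ_coordU_mul x₀ hx₀ k i f
  · have : Int.negSucc k - 1 = Int.negSucc (k + 1) := rfl
    rw [this]
    exact (mul_zero _).symm

theorem taylorAt_mem (x₀ : U) {k : ℤ} {x : MultiVF U} (hx : x ∈ tens ⊤ k) :
    taylorAt x₀ k x ∈ polyW U k := by
  rw [taylorAt_eq, polyW_eq]
  exact rTensor_mem_tens (fun f _ => taylorInt_mem x₀ k f) hx

theorem taylorAt_polyW (x₀ : U) {k : ℤ} {x : MultiVF U} (hx : x ∈ polyW U k) :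
    taylorAt x₀ k x = x := by
  rw [polyW_eq] at hx
  rw [taylorAt_eq]
  exact rTensor_eq_self (fun f hf => taylorInt_homPoly x₀ k hf) hx

theorem taylorAt_eulerM (x₀ : U) (hx₀ : (x₀ : Space m).2 = 0) (k : ℤ) (x : MultiVF U) :
    taylorAt x₀ k (eulerM U (-k) x) = 0 := by
  rw [taylorAt_eq]
  induction x using TensorProduct.induction_on with
  | zero => simp
  | tmul f w => rw [eulerM_tmul, LinearMap.rTensor_tmul, taylorInt_eulerShift x₀ hx₀,
      TensorProduct.zero_tmul]
  | add x y hx hy => rw [map_add, map_add, hx, hy, add_zero]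

theorem taylorAt_euler_mul (x₀ : U) (hx₀ : (x₀ : Space m).2 = 0) (k : ℤ) (x : MultiVF U) :
    taylorAt x₀ k (euler U * x) = euler U * taylorAt x₀ (k - 1) x := by
  rw [taylorAt_eq, taylorAt_eq]
  induction x using TensorProduct.induction_on with
  | zero => simp
  | tmul f w => simp [taylorInt_coordU_mul x₀ hx₀]
  | add x y hx hy => rw [mul_add, map_add, map_add, hx, hy, mul_add]

theorem homPolyInt_le_basic (k : ℤ) : homPolyInt U k ≤ basic U := by
  rcases k with k | k
  · exact fun q hq => pderiv_none_homPoly hq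
  · exact bot_le

theorem eulerShift_homPolyInt {k : ℤ} {q : Smooth U} (hq : q ∈ homPolyInt U k) :
    eulerShift U (-k) q = 0 := by
  rcases k with k | k
  · have := eulerOp_homPoly (k := k) hq
    rw [eulerShift_apply, this, Int.ofNat_eq_natCast, Int.cast_natCast, neg_smul, add_neg_cancel]
  · rw [(Submodule.mem_bot ℝ).1 hq, map_zero]

theorem polyW_le (k : ℤ) : polyW U k ≤ tens (basic U) k :=
  polyW_eq (U := U) k ▸ tens_mono (homPolyInt_le_basic k) k

theorem polyW_le_top (k : ℤ) : polyW U k ≤ tens ⊤ k := polyW_eq (U := U) k ▸ tens_mono le_top k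

theorem pderivM_polyW {k : ℤ} {x : MultiVF U} (hx : x ∈ polyW U k) : pderivM U none x = 0 :=
  pderivM_of_mem_tens_basic (polyW_le k hx)

theorem eulerM_polyW {k : ℤ} {x : MultiVF U} (hx : x ∈ polyW U k) : eulerM U (-k) x = 0 := by
  rw [polyW_eq] at hx
  exact rTensor_eq_zero (fun _ hf => eulerShift_homPolyInt hf) hx

theorem euler_mul_polyW {k : ℤ} {x : MultiVF U} (hx : x ∈ polyW U (k - 1)) :
    euler U * x ∈ polyW U k := by
  rw [polyW_eq] at hx ⊢
  have h : ∀ i, ∀ f ∈ homPolyInt U (k - 1), coordU U i * f ∈ homPolyInt U k := by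
    rcases k with (_ | k) | k
    · intro i f hf
      rw [(Submodule.mem_bot ℝ).1 hf, mul_zero]
      exact Submodule.zero_mem _
    · intro i f hf
      have : (Int.ofNat (k + 1)) - 1 = Int.ofNat k := by simp
      rw [this] at hf
      exact coordU_mul_mem_homPoly i hf
    · intro i f hf
      rw [(Submodule.mem_bot ℝ).1 hf, mul_zero]
      exact Submodule.zero_mem _
  simpa using euler_mul_mem_tens h hx

end BookPoisson
end

/-! ### Exactness of the Koszul complex of E∧. -/

noncomputable section
namespace BookPoisson

open Set Filter Topology

variable {m : ℕ} {U V : TopologicalSpace.Opens (Space m)}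

/-- The divergence operator `∑ ι_{du_i} ∂/∂u_i`. -/
def divM (U : TopologicalSpace.Opens (Space m)) : MultiVF U →ₗ[ℝ] MultiVF U :=
  ∑ i : Fin m, (contractL U (some i)).comp (pderivM U (some i))

theorem divM_tmul (f : Smooth U) (w : Ext m) :
    divM U (f ⊗ₜ[ℝ] w) = ∑ i, pderiv U (some i) f ⊗ₜ[ℝ] ctr (some i) w := by
  simp [divM, LinearMap.sum_apply]

theorem divM_mem_tens {k : ℤ} {x : MultiVF U} (hx : x ∈ tens ⊤ k) : divM U x ∈ tens ⊤ (k - 1) := by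
  induction hx using tens_induction with
  | tmul f _ w hw =>
    rw [divM_tmul]
    exact Submodule.sum_mem _ fun i _ => tmul_mem_tens Submodule.mem_top (ctr_some_mem_hor i hw)
  | zero => simp
  | add x y _ _ hx hy => rw [map_add]; exact Submodule.add_mem _ hx hy

/-- The homotopy formula for the Koszul complex. -/
theorem euler_mul_divM_add {k : ℤ} {x : MultiVF U} (hx : x ∈ tens ⊤ k) :
    euler U * divM U x + divM U (euler U * x) = eulerM U ((m : ℝ) - k) x := by
  induction hx using tens_induction with
  | tmul f _ w hw =>
    have h1 (i : Fin m) : divM U ((coordU U i * f) ⊗ₜ[ℝ] (gen (some i) * w)) =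
        f ⊗ₜ[ℝ] ctr (some i) (gen (some i) * w) + (coordU U i * pderiv U (some i) f) ⊗ₜ[ℝ] w -
          ∑ j, (coordU U i * pderiv U (some j) f) ⊗ₜ[ℝ] (gen (some i) * ctr (some j) w) := by
      have h2 (j : Fin m) :
          pderiv U (some j) (coordU U i * f) ⊗ₜ[ℝ] ctr (some j) (gen (some i) * w) =
            (if j = i then f ⊗ₜ[ℝ] ctr (some i) (gen (some i) * w) +
              (coordU U i * pderiv U (some i) f) ⊗ₜ[ℝ] w else 0) -
            (coordU U i * pderiv U (some j) f) ⊗ₜ[ℝ] (gen (some i) * ctr (some j) w) := by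
        by_cases h : j = i
        · subst h
          simp only [pderiv_mul, pderiv_coordU, ctr_gen_mul, if_true, TensorProduct.add_tmul,
            TensorProduct.tmul_sub, mul_one]
          abel
        · simp [pderiv_mul, pderiv_coordU, ctr_gen_mul, h, TensorProduct.tmul_neg]
      rw [divM_tmul]
      simp only [h2, Finset.sum_sub_distrib, Finset.sum_ite_eq', Finset.mem_univ, if_true]
    rw [euler_mul_tmul, map_sum]
    simp only [h1]
    rw [Finset.sum_sub_distrib, Finset.sum_add_distrib, ← TensorProduct.tmul_sum,
      sum_ctr_gen_mul hw, divM_tmul, Finset.mul_sum]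
    simp only [euler_mul_tmul]
    -- After exchanging the indices, the double sum from E∧div cancels the mixed terms of div(E∧x).
    -- What remains is E plus the count m - k.
    rw [Finset.sum_comm, eulerM_tmul, eulerShift_apply, eulerOp_apply, TensorProduct.add_tmul,
      TensorProduct.sum_tmul, TensorProduct.tmul_smul, TensorProduct.smul_tmul']
    abel
  | zero => simp
  | add x y _ _ hx hy => rw [map_add, map_add, ← hx, ← hy, mul_add, mul_add, map_add]; abel

theorem coef_euler_mul (φ : Module.Dual ℝ (Ext m)) (x : MultiVF U) (p : U)
    (hp : (p : Space m).2 = 0) : coef U φ (euler U * x) p = 0 := by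
  induction x using TensorProduct.induction_on with
  | zero => simp
  | tmul f w => simp [hp]
  | add x y hx hy => simp [mul_add, hx, hy]

/-- The coefficients of a multivector field vanish on `{u = 0}`. -/
def VanishesOnAxis (x : MultiVF U) : Prop :=
  ∀ φ, ∀ p : U, (p : Space m).2 = 0 → coef U φ x p = 0

/-- Exactness of the Koszul complex, on open sets that are star-shaped in the direction of `u`. -/
theorem RayClosed.exists_euler_mul_eq (hU : RayClosed U) {k : ℤ} (hk : k ≤ m) {x : MultiVF U}
    (hx : x ∈ tens ⊤ k) (hE : euler U * x = 0) (h0 : k < m ∨ VanishesOnAxis x) :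
    ∃ z ∈ tens (U := U) ⊤ (k - 1), euler U * z = x := by
  obtain ⟨c, hc⟩ : ∃ c : ℕ, (m : ℤ) - k = c := ⟨_, (Int.toNat_of_nonneg (by omega)).symm⟩
  have hcR : (m : ℝ) - k = c := by exact_mod_cast hc
  have hsurj : ∀ y ∈ tens (U := U) ⊤ (k - 1), ∃ z ∈ tens (U := U) ⊤ (k - 1),
      eulerM U ((c : ℝ) + 1) z = y := fun y hy => by
    induction hy using tens_induction with
    | tmul f _ w hw =>
      obtain ⟨h, hh⟩ := exists_eulerShift_eq hU c f
      exact ⟨h ⊗ₜ w, tmul_mem_tens Submodule.mem_top hw, by rw [eulerM_tmul, hh]⟩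
    | zero => exact ⟨0, Submodule.zero_mem _, map_zero _⟩
    | add y y' _ _ hy hy' =>
      obtain ⟨z, hz, rfl⟩ := hy
      obtain ⟨z', hz', rfl⟩ := hy'
      exact ⟨z + z', Submodule.add_mem _ hz hz', map_add _ _ _⟩
  -- With c = m - k and (E + c + 1)z = div x, the homotopy formula gives (E + c)(E∧z) = E∧div x = (E
  -- + c)x. The error x - E∧z is therefore killed by E + c, and it is zero if c > 0 or if x vanishes
  -- on the axis.
  obtain ⟨z, hz, hzx⟩ := hsurj _ (divM_mem_tens hx)
  refine ⟨z, hz, (sub_eq_zero.1 ?_).symm⟩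
  have h1 : eulerM U c (x - euler U * z) = 0 := by
    rw [map_sub, eulerM_euler_mul, hzx, ← hcR, ← euler_mul_divM_add hx, hE, map_zero, add_zero,
      sub_self]
  refine eq_zero_of_coef (Submodule.sub_mem _ hx (euler_mul_mem_tens_top_of_sub hz)) fun φ => ?_
  have h2 : eulerShift U c (coef U φ (x - euler U * z)) = 0 := by
    rw [← coef_rTensor, ← eulerM, h1, map_zero]
  ext p
  rw [eq_of_eulerShift_eq_zero hU c h2 p]
  rcases h0 with h0 | h0
  · rw [zero_pow (by omega), zero_mul]
    rfl
  · have hp : (((p : Space m).1, 0) : Space m) ∈ U := by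
      simpa using hU p p.2 0 ⟨le_rfl, zero_le_one⟩
    rw [ext0_toFun_apply _ hp, map_sub, Smooth.toFun_sub, Pi.sub_apply, h0 φ ⟨_, hp⟩ rfl,
      coef_euler_mul φ z ⟨_, hp⟩ rfl, sub_self, mul_zero]
    rfl

/-- Restriction of functions to a smaller open set. -/
def resFun (h : V ≤ U) : Smooth U →ₗ[ℝ] Smooth V where
  toFun f := Smooth.restrict V (ext0 f.toFun) fun _ hx => f.contDiffAt ⟨_, h hx⟩
  map_add' f g := by
    ext x
    simp [ext0_add]
  map_smul' r f := by
    ext x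
    simp [ext0_smul]

theorem resFun_toFun (h : V ≤ U) (f : Smooth U) (x : V) :
    (resFun h f).toFun x = f.toFun ⟨x, h x.2⟩ :=
  ext0_toFun_apply f _

/-- Restriction of multivector fields to a smaller open set. -/
def resM (h : V ≤ U) : MultiVF U →ₗ[ℝ] MultiVF V :=
  TensorProduct.map (resFun h) LinearMap.id

@[simp]
theorem resM_tmul (h : V ≤ U) (f : Smooth U) (w : Ext m) :
    resM h (f ⊗ₜ[ℝ] w) = resFun h f ⊗ₜ[ℝ] w := rfl

theorem resM_mem_tens (h : V ≤ U) {k : ℤ} {x : MultiVF U} (hx : x ∈ tens ⊤ k) :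
    resM h x ∈ tens ⊤ k := by
  induction hx using tens_induction with
  | tmul f _ w hw => exact tmul_mem_tens Submodule.mem_top hw
  | zero => simp
  | add x y _ _ hx hy => rw [map_add]; exact Submodule.add_mem _ hx hy

theorem coef_resM (h : V ≤ U) (φ : Module.Dual ℝ (Ext m)) (x : MultiVF U) :
    coef V φ (resM h x) = resFun h (coef U φ x) := by
  induction x using TensorProduct.induction_on with
  | zero => simp
  | tmul f w => simp
  | add x y hx hy => simp [hx, hy]

theorem resFun_coordU_mul (h : V ≤ U) (i : Fin m) (f : Smooth U) :
    resFun h (coordU U i * f) = coordU V i * resFun h f := by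
  ext x
  simp [resFun_toFun]

theorem resM_euler_mul (h : V ≤ U) (x : MultiVF U) :
    resM h (euler U * x) = euler V * resM h x := by
  induction x using TensorProduct.induction_on with
  | zero => simp
  | tmul f w => simp [resFun_coordU_mul]
  | add x y hx hy => rw [mul_add, map_add, map_add, hx, hy, mul_add]

/-- Multiplication of a multivector field by a function. -/
def mulM (f : Smooth U) : MultiVF U →ₗ[ℝ] MultiVF U := (LinearMap.mulLeft ℝ f).rTensor (Ext m)

@[simp]
theorem mulM_tmul (f g : Smooth U) (w : Ext m) : mulM f (g ⊗ₜ[ℝ] w) = (f * g) ⊗ₜ[ℝ] w := rfl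

theorem mulM_mem_tens (f : Smooth U) {k : ℤ} {x : MultiVF U} (hx : x ∈ tens ⊤ k) :
    mulM f x ∈ tens ⊤ k :=
  rTensor_mem_tens (fun _ _ => Submodule.mem_top) hx

theorem euler_mul_mulM (f : Smooth U) (x : MultiVF U) :
    euler U * mulM f x = mulM f (euler U * x) := by
  induction x using TensorProduct.induction_on with
  | zero => simp
  | tmul g w => simp [mul_left_comm]
  | add x y hx hy => rw [map_add, mul_add, mul_add, map_add, hx, hy]

theorem mulM_mulM (f g : Smooth U) (x : MultiVF U) : mulM f (mulM g x) = mulM (f * g) x := by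
  induction x using TensorProduct.induction_on with
  | zero => simp
  | tmul h w => simp [mul_assoc]
  | add x y hx hy => simp only [map_add, hx, hy]

theorem mulM_one (x : MultiVF U) : mulM 1 x = x := by
  induction x using TensorProduct.induction_on with
  | zero => simp
  | tmul h w => simp
  | add x y hx hy => simp only [map_add, hx, hy]

theorem contractL_euler_mul (i : Fin m) (x : MultiVF U) :
    contractL U (some i) (euler U * x) =
      mulM (coordU U i) x - euler U * contractL U (some i) x := by
  induction x using TensorProduct.induction_on with
  | zero => simp
  | tmul f w =>
    rw [euler_mul_tmul, map_sum, contractL_tmul, euler_mul_tmul, mulM_tmul]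
    simp only [contractL_tmul, ctr_gen_mul, TensorProduct.tmul_sub, Finset.sum_sub_distrib]
    congr 1
    rw [Finset.sum_eq_single i]
    · simp
    · intro j _ hj
      simp [Ne.symm hj]
    · simp
  | add x y hx hy => simp only [map_add, mul_add, hx, hy]; abel

theorem contractL_some_mem_tens (i : Fin m) {k : ℤ} {x : MultiVF U} (hx : x ∈ tens ⊤ k) :
    contractL U (some i) x ∈ tens ⊤ (k - 1) := by
  induction hx using tens_induction with
  | tmul f _ w hw => exact tmul_mem_tens Submodule.mem_top (ctr_some_mem_hor i hw)
  | zero => simp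
  | add x y _ _ hx hy => rw [map_add]; exact Submodule.add_mem _ hx hy

/-- Exactness of the Koszul complex where `u_i` has an inverse. -/
theorem exists_euler_mul_eq_of_mul_eq_one {i : Fin m} {v : Smooth U} (hv : v * coordU U i = 1)
    {k : ℤ} {x : MultiVF U} (hx : x ∈ tens ⊤ k) (hE : euler U * x = 0) :
    ∃ z ∈ tens (U := U) ⊤ (k - 1), euler U * z = x := by
  -- Contracting E∧x = 0 with du_i gives u_i x = E∧ι_{du_i}x; it remains to divide by u_i.
  refine ⟨mulM v (contractL U (some i) x), mulM_mem_tens v (contractL_some_mem_tens i hx), ?_⟩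
  have h := contractL_euler_mul i x
  rw [hE, map_zero, eq_comm, sub_eq_zero] at h
  rw [euler_mul_mulM, ← h, mulM_mulM, hv, mulM_one]

/-- Local exactness of the Koszul complex. -/
theorem exists_nhds_euler_mul_eq {k : ℤ} (hk : k ≤ m) {x : MultiVF U} (hx : x ∈ tens ⊤ k)
    (hE : euler U * x = 0) (h0 : k < m ∨ VanishesOnAxis x) {p : Space m} (hp : p ∈ U) :
    ∃ V : TopologicalSpace.Opens (Space m), ∃ h : V ≤ U, p ∈ V ∧
      ∃ z ∈ tens (U := V) ⊤ (k - 1), euler V * z = resM h x := by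
  have hE' {V : TopologicalSpace.Opens (Space m)} (h : V ≤ U) : euler V * resM h x = 0 := by
    rw [← resM_euler_mul, hE, map_zero]
  by_cases hp0 : p.2 = 0
  -- A ball of the product metric centred on the axis is ray-closed. Away from the axis some u_i is
  -- invertible.
  · obtain ⟨r, hr, hrU⟩ := Metric.isOpen_iff.1 U.isOpen p hp
    let V : TopologicalSpace.Opens (Space m) := ⟨Metric.ball p r, Metric.isOpen_ball⟩
    have hV : V ≤ U := hrU
    have hray : RayClosed V := fun y hy s hs => by
      have hy' : dist y p < r := hy
      change dist _ p < r
      rw [Prod.dist_eq, max_lt_iff, hp0, dist_zero_right] at hy' ⊢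
      refine ⟨hy'.1, lt_of_le_of_lt ?_ hy'.2⟩
      rw [norm_smul, Real.norm_of_nonneg hs.1]
      exact mul_le_of_le_one_left (norm_nonneg _) hs.2
    refine ⟨V, hV, Metric.mem_ball_self hr, hray.exists_euler_mul_eq hk (resM_mem_tens hV hx)
      (hE' hV) (h0.imp_right fun h0 φ q hq => ?_)⟩
    rw [coef_resM, resFun_toFun]
    exact h0 φ ⟨q, hV q.2⟩ hq
  · obtain ⟨i, hi⟩ := Function.ne_iff.1 hp0
    let V : TopologicalSpace.Opens (Space m) :=
      U ⊓ ⟨{y | y.2 i ≠ 0}, isOpen_ne_fun (by fun_prop) continuous_const⟩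
    have hV : V ≤ U := inf_le_left
    let v : Smooth V := Smooth.restrict V (fun y => (y.2 i)⁻¹) fun y hy => by
      have h1 : ContDiff ℝ ∞ fun y : Space m => y.2 i := by fun_prop
      exact h1.contDiffAt.inv hy.2
    have hv : v * coordU V i = 1 := by
      ext y
      exact inv_mul_cancel₀ y.2.2
    exact ⟨V, hV, ⟨hp, hi⟩, exists_euler_mul_eq_of_mul_eq_one hv (resM_mem_tens hV hx) (hE' hV)⟩

/-- Exactness of the Koszul complex of smooth functions. -/
theorem exists_euler_mul_eq {k : ℤ} {x : MultiVF U} (hx : x ∈ tens ⊤ k)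
    (hE : euler U * x = 0) (h0 : k < m ∨ VanishesOnAxis x) :
    ∃ z ∈ tens (U := U) ⊤ (k - 1), euler U * z = x := by
  rcases lt_or_ge (m : ℤ) k with hk | hk
  · refine ⟨0, Submodule.zero_mem _, ?_⟩
    rw [tens, hor_eq_bot hk, Submodule.map₂_bot_right, Submodule.mem_bot] at hx
    rw [hx, mul_zero]
  obtain ⟨N, e, φ, he, hφ⟩ := exists_dual_basis (m := m) (k - 1)
  have hval {V : TopologicalSpace.Opens (Space m)} (g : Fin N → Smooth V)
      (ψ : Module.Dual ℝ (Ext m)) (p : V) :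
      coef V ψ (euler V * ∑ a, g a ⊗ₜ[ℝ] e a) p =
        ∑ a, g a p * ∑ i, (p : Space m).2 i * ψ (gen (some i) * e a) := by
    simp only [Finset.mul_sum, euler_mul_tmul, map_sum, coef_tmul, Smooth.toFun_sum,
      Finset.sum_apply, Smooth.toFun_smul, Pi.smul_apply, Smooth.toFun_mul, Pi.mul_apply,
      coordU_toFun, smul_eq_mul]
    exact Finset.sum_congr rfl fun a _ => Finset.sum_congr rfl fun i _ => by ring
  -- At each point E∧z = x is a linear system, with no derivatives, for the coefficients of z. Its
  -- solution set is affine, hence convex, so local solutions glue.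
  obtain ⟨g, hg⟩ := exists_contDiffAt_forall_mem_convex (F := Fin N → ℝ) U
    (fun p => {v | ∀ ψ, ∑ a, v a * ∑ i, p.2 i * ψ (gen (some i) * e a) =
      ext0 (coef U ψ x).toFun p}) (fun p _ v hv v' hv' r s _ _ hrs ψ => by
        simp only [Pi.add_apply, Pi.smul_apply, smul_eq_mul, add_mul, mul_assoc,
          Finset.sum_add_distrib]
        rw [← Finset.mul_sum, ← Finset.mul_sum, hv ψ, hv' ψ, ← add_mul, hrs, one_mul])
    (fun p hp => by
      obtain ⟨V, hV, hpV, z, hz, hzx⟩ := exists_nhds_euler_mul_eq hk hx hE h0 hp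
      refine ⟨fun q a => ext0 (coef V (φ a) z).toFun q, V, V.isOpen.mem_nhds hpV,
        contDiffOn_pi.2 fun a => (coef V (φ a) z).contDiffOn, fun q hq ψ => ?_⟩
      have h1 := hval (fun a => coef V (φ a) z) ψ ⟨q, hq⟩
      rw [eq_sum_coef_tmul hφ hz, hzx, coef_resM, resFun_toFun,
        ← ext0_toFun_apply _ (hV hq)] at h1
      simp only [ext0_toFun_apply _ hq]
      exact h1.symm)
  have hz : ∑ a, Smooth.restrict U (fun p => g p a)
      (fun p hp => contDiffAt_pi.1 (hg p hp).1 a) ⊗ₜ[ℝ] e a ∈ tens (U := U) ⊤ (k - 1) :=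
    Submodule.sum_mem _ fun a _ => tmul_mem_tens Submodule.mem_top (he a)
  refine ⟨_, hz, sub_eq_zero.1 (eq_zero_of_coef
    (Submodule.sub_mem _ (euler_mul_mem_tens_top_of_sub hz) hx) fun ψ => ?_)⟩
  ext p
  rw [map_sub, Smooth.toFun_sub, Pi.sub_apply, hval]
  have := (hg p p.2).2 ψ
  rw [ext0_toFun_apply _ p.2] at this
  exact sub_eq_zero.2 this

end BookPoisson
end

/-! ### Normal form of cocycles and the isomorphism. -/

noncomputable section
namespace BookPoisson

open Set Filter Topology

variable {m : ℕ} {U : TopologicalSpace.Opens (Space m)} {σ : (Fin m → ℝ) → ℝ}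

theorem IsSection.exists_pderivM_eq (hσ : IsSection U σ) (hU : ConnectedFibers U) {k : ℤ}
    {x : MultiVF U} (hx : x ∈ tens ⊤ k) : ∃ y ∈ tens (U := U) ⊤ k, pderivM U none y = x := by
  induction hx using tens_induction with
  | tmul f _ w hw =>
    obtain ⟨F, hF⟩ := hσ.exists_pderiv_none_eq hU f
    exact ⟨F ⊗ₜ w, tmul_mem_tens Submodule.mem_top hw, by rw [pderivM_tmul, hF]⟩
  | zero => exact ⟨0, Submodule.zero_mem _, map_zero _⟩
  | add y y' _ _ hy hy' =>
    obtain ⟨z, hz, rfl⟩ := hy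
    obtain ⟨z', hz', rfl⟩ := hy'
    exact ⟨z + z', Submodule.add_mem _ hz hz', map_add _ _ _⟩

theorem exists_eulerM_add_polyW (hσ : IsSection U σ) (hU : ConnectedFibers U)
    (hstar : StarConvex ℝ 0 (Prod.snd '' (U : Set (Space m)))) {k : ℤ} {x : MultiVF U}
    (hx : x ∈ tens (basic U) k) :
    ∃ h ∈ tens (basic U) k, ∃ q ∈ polyW U k, x = eulerM U (-k) h + q := by
  induction hx using tens_induction with
  | tmul f hf w hw =>
    obtain rfl | ⟨j, rfl, -⟩ := mem_hor.1 hw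
    · exact ⟨0, Submodule.zero_mem _, 0, Submodule.zero_mem _, by simp⟩
    · obtain ⟨h, hh, q, hq, rfl⟩ := exists_eulerShift_add_homPoly hσ hU hstar j hf
      refine ⟨h ⊗ₜ w, tmul_mem_tens hh hw, q ⊗ₜ w, ?_, ?_⟩
      · rw [polyW_eq]
        exact tmul_mem_tens hq hw
      · rw [eulerM_tmul, Int.cast_natCast, TensorProduct.add_tmul]
  | zero => exact ⟨0, Submodule.zero_mem _, 0, Submodule.zero_mem _, by simp⟩
  | add y y' _ _ hy hy' =>
    obtain ⟨h, hh, q, hq, rfl⟩ := hy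
    obtain ⟨h', hh', q', hq', rfl⟩ := hy'
    exact ⟨h + h', Submodule.add_mem _ hh hh', q + q', Submodule.add_mem _ hq hq', by
      rw [map_add]; abel⟩

theorem mem_polyW_of_eulerM_eq_zero (hσ : IsSection U σ) (hU : ConnectedFibers U)
    (hstar : StarConvex ℝ 0 (Prod.snd '' (U : Set (Space m)))) {k : ℤ} {x : MultiVF U}
    (hx : x ∈ tens (basic U) k) (hE : eulerM U (-k) x = 0) : x ∈ polyW U k := by
  rw [polyW_eq]
  rcases k with k | k
  · refine mem_tens_of_coef (tens_mono le_top _ hx) fun φ => ?_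
    refine mem_homPoly_of_eulerShift_eq_zero hσ hU hstar k (coef_mem_of_mem_tens hx φ) ?_
    rw [Int.ofNat_eq_natCast, Int.cast_natCast] at hE
    rw [← coef_rTensor, ← eulerM, hE, map_zero]
  · rw [tens, hor, Submodule.map₂_bot_right, Submodule.mem_bot] at hx
    rw [hx]
    exact Submodule.zero_mem _

theorem coef_eulerM_of_axis (φ : Module.Dual ℝ (Ext m)) (r : ℝ) (x : MultiVF U) (p : U)
    (hp : (p : Space m).2 = 0) : coef U φ (eulerM U r x) p = r * coef U φ x p := by
  rw [eulerM, coef_rTensor, eulerShift_apply, eulerOp_apply]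
  simp [hp]

/-- The direction ∂_t is tangent to the axis. -/
theorem VanishesOnAxis.pderivM {x : MultiVF U} (hx : VanishesOnAxis x) :
    VanishesOnAxis (pderivM U none x) := by
  rintro φ ⟨⟨t, u⟩, hp⟩ rfl
  rw [BookPoisson.pderivM, coef_rTensor]
  refine (hasDerivAt_fiber (coef U φ x) t 0 hp).unique
    ((hasDerivAt_const t (0 : ℝ)).congr_of_eventuallyEq ?_)
  filter_upwards [(isOpen_fiber (U := U) 0).mem_nhds hp] with s hs
  rw [ext0_toFun_apply _ hs]
  exact hx φ ⟨_, hs⟩ rfl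

/-- The part `∂_t ∧ a` of a cocycle. -/
theorem exists_polyW_add (hσ : IsSection U σ) (hU : ConnectedFibers U)
    (hstar : StarConvex ℝ 0 (Prod.snd '' (U : Set (Space m)))) (hm : 1 ≤ m) {k : ℤ} {a : MultiVF U}
    (ha : a ∈ tens ⊤ k) (hE : euler U * pderivM U none a = 0) :
    ∃ w ∈ polyW U k, ∃ b ∈ tens (U := U) ⊤ k, ∃ a' ∈ tens (U := U) ⊤ (k - 1),
      euler U * pderivM U none b = 0 ∧
        a = w + (eulerM U (-k) b + euler U * pderivM U none a') := by
  have key : ∀ a ∈ tens (U := U) ⊤ k, euler U * pderivM U none a = 0 →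
      (k < m ∨ VanishesOnAxis (pderivM U none a)) →
      ∃ w ∈ polyW U k, ∃ b ∈ tens (U := U) ⊤ k, ∃ a' ∈ tens (U := U) ⊤ (k - 1),
        euler U * pderivM U none b = 0 ∧
          a = w + (eulerM U (-k) b + euler U * pderivM U none a') := fun a ha hE h0 => by
    obtain ⟨c, hc, hca⟩ := exists_euler_mul_eq (pderivM_mem_tens_top none ha) hE h0
    obtain ⟨γ, hγ, rfl⟩ := hσ.exists_pderivM_eq hU hc
    obtain ⟨a', ha', rfl⟩ := hσ.exists_pderivM_eq hU hγ
    have hb : a - euler U * pderivM U none a' ∈ tens (basic U) k := by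
      refine mem_tens_basic (Submodule.sub_mem _ ha (euler_mul_mem_tens_top_of_sub hγ)) ?_
      rw [map_sub, pderivM_euler_mul, hca, sub_self]
    obtain ⟨h, hh, q, hq, e⟩ := exists_eulerM_add_polyW hσ hU hstar hb
    refine ⟨q, hq, h, tens_mono le_top _ hh, a', ha', ?_, ?_⟩
    · rw [pderivM_of_mem_tens_basic hh, mul_zero]
    · rw [← add_assoc, add_comm q, ← e, sub_add_cancel]
  rcases lt_or_ge k m with hk | hk
  · exact key a ha hE (Or.inl hk)
  · have hk0 : (k : ℝ) ≠ 0 := by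
      have : k ≠ 0 := by omega
      exact_mod_cast this
    -- In top degree exactness needs vanishing on the axis. Since a = k⁻¹E a - (E - k)(k⁻¹a), one
    -- may pass to k⁻¹E a, which vanishes there because E does; k ≠ 0 since k ≥ m ≥ 1.
    obtain ⟨w, hw, b, hb, a', ha', h1, h2⟩ := key ((k : ℝ)⁻¹ • eulerM U 0 a)
      (Submodule.smul_mem _ _ (eulerM_mem_tens_top _ ha))
      (by
        have := eulerM_euler_mul (-1) (pderivM U none a)
        rw [hE, map_zero, neg_add_cancel] at this
        rw [map_smul, pderivM_eulerM, mul_smul_comm, ← this, smul_zero])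
      (Or.inr fun φ p hp => by
        rw [map_smul, pderivM_eulerM, map_smul, Smooth.toFun_smul, Pi.smul_apply,
          coef_eulerM_of_axis φ 0 _ p hp, zero_mul, smul_zero])
    refine ⟨w, hw, b - (k : ℝ)⁻¹ • a, Submodule.sub_mem _ hb (Submodule.smul_mem _ _ ha), a', ha',
      ?_, ?_⟩
    · rw [map_sub, map_smul, mul_sub, mul_smul_comm, h1, hE, smul_zero, sub_zero]
    · have h3 : eulerM U (-k) ((k : ℝ)⁻¹ • a) = (k : ℝ)⁻¹ • eulerM U 0 a - a := by
        rw [map_smul, eulerM_eq, smul_add, smul_smul, mul_neg, inv_mul_cancel₀ hk0, neg_one_smul,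
          sub_eq_add_neg]
      rw [map_sub, h3, h2]
      abel

theorem IsSection.sec_euler_mul (hσ : IsSection U σ) (x : MultiVF U) :
    hσ.sec.rTensor (Ext m) (euler U * x) = euler U * hσ.sec.rTensor (Ext m) x := by
  induction x using TensorProduct.induction_on with
  | zero => simp
  | tmul f w => simp [hσ.sec_coordU_mul]
  | add x y hx hy => rw [mul_add, map_add, map_add, hx, hy, mul_add]

/-- Every cocycle is cohomologous to an element of `∂_t ∧ 𝕎^(k-1) + 𝕎^k`. -/
theorem exists_sub_mem_coboundaries (hU : ConnectedFibers U)
    (hstar : StarConvex ℝ 0 (Prod.snd '' (U : Set (Space m)))) (hm : 1 ≤ m) (x₀ : U)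
    (hx₀ : (x₀ : Space m).2 = 0) {k : ℤ} {a b : MultiVF U} (ha : a ∈ tens ⊤ (k - 1))
    (hb : b ∈ tens ⊤ k) (hμ : vf U none * a + b ∈ cocycles U k) :
    ∃ w₁ ∈ polyW U (k - 1), ∃ w₂ ∈ polyW U k,
      vf U none * a + b - (vf U none * w₁ + w₂) ∈ coboundaries U k := by
  obtain ⟨σ, hσ⟩ := hU.exists_isSection
  obtain ⟨h1, h2⟩ := (mem_cocycles_iff ha hb).1 hμ
  have hcast : (((k - 1 : ℤ)) : ℝ) = (k : ℝ) - 1 := by push_cast; rfl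
  have hr : -(k : ℝ) + 1 = -((k : ℝ) - 1) := by ring
  -- On the axis the cocycle equation reads -k b = 0, so in top degree b, and with it ḃ, vanishes
  -- there.
  have h0 : k < m ∨ VanishesOnAxis (pderivM U none b) := by
    rcases lt_or_ge k m with hk | hk
    · exact Or.inl hk
    · refine Or.inr (VanishesOnAxis.pderivM fun φ p hp => ?_)
      have hk0 : (k : ℝ) ≠ 0 := by
        have : k ≠ 0 := by omega
        exact_mod_cast this
      have h := congrFun (congrArg (fun x => (coef U φ x).toFun) h1) p
      simp only [map_add, Smooth.toFun_add, Pi.add_apply, coef_eulerM_of_axis φ _ b p hp,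
        coef_euler_mul φ _ p hp, add_zero, map_zero, Smooth.toFun_zero, Pi.zero_apply] at h
      exact (mul_eq_zero.1 h).resolve_left (neg_ne_zero.2 hk0)
  obtain ⟨c, hc, hcb⟩ := exists_euler_mul_eq (pderivM_mem_tens_top none hb) h2 h0
  obtain ⟨γ, hγ, rfl⟩ := hσ.exists_pderivM_eq hU hc
  obtain ⟨β, hβ, rfl⟩ := hσ.exists_pderivM_eq hU hγ
  -- Adding d β, where the second t-derivative of β is c, replaces (a, b) by (a₀, b₀) and makes b₀
  -- independent of t.
  set b₀ := b - euler U * pderivM U none β with hb₀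
  set a₀ := a + eulerM U (-((k : ℝ) - 1)) β with ha₀
  have hb₀' : b₀ ∈ tens (basic U) k := by
    refine mem_tens_basic (Submodule.sub_mem _ hb (euler_mul_mem_tens_top_of_sub hγ)) ?_
    rw [hb₀, map_sub, pderivM_euler_mul, hcb, sub_self]
  have ha₀' : a₀ ∈ tens ⊤ (k - 1) := Submodule.add_mem _ ha (eulerM_mem_tens_top _ hβ)
  have h3 : eulerM U (-k) b₀ + euler U * pderivM U none a₀ = 0 := by
    rw [← h1, hb₀, ha₀, map_sub, map_add, mul_add, eulerM_euler_mul, pderivM_eulerM, hr]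
    abel
  have hEb₀ : eulerM U (-k) b₀ ∈ tens (basic U) k :=
    rTensor_mem_tens (fun f hf => by
      rw [mem_basic, pderiv_none_eulerShift, mem_basic.1 hf, map_zero]) hb₀'
  -- The derivative of a₀ may depend on t, but its product with E does not. Restriction to the
  -- section commutes with E∧, so g has the same product.
  set g := hσ.sec.rTensor (Ext m) (pderivM U none a₀) with hg
  have hg' : g ∈ tens (basic U) (k - 1) :=
    rTensor_mem_tens (fun f _ => hσ.sec_mem_basic f) (pderivM_mem_tens_top none ha₀')
  have h4 : euler U * g = euler U * pderivM U none a₀ := by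
    rw [hg, ← hσ.sec_euler_mul, ← neg_eq_of_add_eq_zero_right h3]
    exact rTensor_eq_self (fun f hf => hσ.sec_eq hU hf) (Submodule.neg_mem _ hEb₀)
  obtain ⟨h, hh, q, hq, hgq⟩ := exists_eulerM_add_polyW hσ hU hstar hg'
  rw [hcast] at hgq
  have hw : b₀ + euler U * h ∈ tens (basic U) k := by
    refine Submodule.add_mem _ hb₀' ?_
    simpa using euler_mul_mem_tens (fun i f hf => coordU_mul_mem_basic i hf) hh
  have h5 : eulerM U (-k) (b₀ + euler U * h) = -(euler U * q) := by
    rw [map_add, eulerM_euler_mul, hr, eq_neg_of_add_eq_zero_left h3, ← h4, hgq, mul_add]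
    abel
  -- T^k kills the image of E - k but fixes the polynomial field E∧q.
  have h6 : euler U * q = 0 := by
    have := taylorAt_eulerM x₀ hx₀ k (b₀ + euler U * h)
    rwa [h5, map_neg, taylorAt_polyW x₀ (euler_mul_polyW hq), neg_eq_zero] at this
  have hw₂ : b₀ + euler U * h ∈ polyW U k :=
    mem_polyW_of_eulerM_eq_zero hσ hU hstar hw (by rw [h5, h6, neg_zero])
  -- Subtracting d η turns b₀ into the polynomial b₀ + E∧h and leaves a first component whose
  -- t-derivative is annihilated by E∧.
  obtain ⟨η, hη, hηh⟩ := hσ.exists_pderivM_eq hU (tens_mono le_top _ hh)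
  obtain ⟨w₁, hw₁, b', hb', a', ha', h7, h8⟩ := exists_polyW_add hσ hU hstar hm
    (a := a₀ - eulerM U (-((k : ℝ) - 1)) η)
    (Submodule.sub_mem _ ha₀' (eulerM_mem_tens_top _ hη)) (by
      rw [map_sub, pderivM_eulerM, mul_sub, ← h4, hηh, hgq, mul_add, h6]
      abel)
  rw [hcast] at h8
  refine ⟨w₁, hw₁, _, hw₂, ?_⟩
  convert mem_coboundaries (k := k) ha' (Submodule.add_mem _ (Submodule.sub_mem _ hη hβ) hb') using 1
  have ha_eq : a = w₁ + (eulerM U (-((k : ℝ) - 1)) b' + euler U * pderivM U none a') +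
      eulerM U (-((k : ℝ) - 1)) η - eulerM U (-((k : ℝ) - 1)) β := by
    rw [← h8, ha₀]
    abel
  have hb_eq : b = b₀ + euler U * pderivM U none β := by rw [hb₀, sub_add_cancel]
  rw [ha_eq, hb_eq]
  simp only [map_add, map_sub, mul_add, mul_sub, h7, hηh]
  abel

/-- The coordinate function `t`. -/
def coordT (U : TopologicalSpace.Opens (Space m)) : Smooth U :=
  Smooth.restrict U Prod.fst fun _ _ => contDiffAt_fst

theorem pderiv_coordT (c : Coord m) :
    pderiv U c (coordT U) = if c = none then 1 else 0 := by
  ext x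
  rw [coordT, pderiv_restrict_toFun, fderiv_fst]
  rcases c with _ | i <;> simp [coordVec]

theorem pderivM_mulM_coordT {k : ℤ} {x : MultiVF U} (hx : x ∈ tens (basic U) k) :
    pderivM U none (mulM (coordT U) x) = x := by
  induction hx using tens_induction with
  | tmul f hf w _ => simp [pderiv_mul, pderiv_coordT, mem_basic.1 hf]
  | zero => simp
  | add x y _ _ hx hy => rw [map_add, map_add, hx, hy]

theorem eulerM_mulM_coordT (r : ℝ) (x : MultiVF U) :
    eulerM U r (mulM (coordT U) x) = mulM (coordT U) (eulerM U r x) := by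
  induction x using TensorProduct.induction_on with
  | zero => simp
  | tmul f w =>
    have : eulerOp U (coordT U) = 0 := by simp [eulerOp_apply, pderiv_coordT]
    simp [eulerShift_apply, eulerOp_mul, this, mul_add]
  | add x y hx hy => simp only [map_add, hx, hy]

theorem vf_mul_add_mem_cocycles {k : ℤ} {a b : MultiVF U} (ha : a ∈ polyW U (k - 1))
    (hb : b ∈ polyW U k) : vf U none * a + b ∈ cocycles U k := by
  refine (mem_cocycles_iff (polyW_le_top _ ha) (polyW_le_top _ hb)).2 ?_
  rw [pderivM_polyW ha, pderivM_polyW hb, eulerM_polyW hb]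
  simp

/-- For w ∈ 𝕎^(k-2), the field ∂_t∧E∧w is d(∂_t∧a') for any horizontal a' with t-derivative w. For w
∈ 𝕎^(k-1), the field E∧w is d(-t w), because E - (k - 1) kills t w. -/
theorem vf_mul_add_mem_coboundaries (hσ : IsSection U σ) (hU : ConnectedFibers U) {k : ℤ}
    {a b : MultiVF U} (ha : a ∈ eulerW U (k - 1 - 1)) (hb : b ∈ eulerW U (k - 1)) :
    vf U none * a + b ∈ coboundaries U k := by
  obtain ⟨a, ha, rfl⟩ := ha
  obtain ⟨b, hb, rfl⟩ := hb
  obtain ⟨a', ha', rfl⟩ := hσ.exists_pderivM_eq hU (polyW_le_top _ ha)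
  convert mem_coboundaries (k := k) ha'
    (Submodule.neg_mem _ (mulM_mem_tens (coordT U) (polyW_le_top _ hb))) using 1
  have h := eulerM_polyW hb
  push_cast at h
  rw [map_neg, map_neg, eulerM_mulM_coordT, h, pderivM_mulM_coordT (polyW_le _ hb)]
  simp

/-- The coefficient `a` of `∂_t ∧ a + b`. -/
def partA (U : TopologicalSpace.Opens (Space m)) : MultiVF U →ₗ[ℝ] MultiVF U := contractL U none

/-- The part `b` of `∂_t ∧ a + b`. -/
def partB (U : TopologicalSpace.Opens (Space m)) : MultiVF U →ₗ[ℝ] MultiVF U :=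
  LinearMap.id - (LinearMap.mulLeft ℝ (vf U none)).comp (contractL U none)

theorem partA_apply {k l : ℤ} {a b : MultiVF U} (ha : a ∈ tens ⊤ l) (hb : b ∈ tens ⊤ k) :
    partA U (vf U none * a + b) = a := by
  rw [partA, map_add, contractL_vf_mul, contractL_of_mem_tens ha, contractL_of_mem_tens hb]
  simp

theorem partB_apply {k l : ℤ} {a b : MultiVF U} (ha : a ∈ tens ⊤ l) (hb : b ∈ tens ⊤ k) :
    partB U (vf U none * a + b) = b := by
  have h := partA_apply ha hb
  rw [partA] at h
  simp [partB, -map_add, h]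

theorem taylorAt_partA_mem (x₀ : U) {k : ℤ} {μ : MultiVF U} (hμ : μ ∈ kVF U k) :
    taylorAt x₀ (k - 1) (partA U μ) ∈ polyW U (k - 1) := by
  obtain ⟨a, ha, b, hb, rfl⟩ := exists_eq_vf_mul_add hμ
  rw [partA_apply ha hb]
  exact taylorAt_mem x₀ ha

theorem taylorAt_partB_mem (x₀ : U) {k : ℤ} {μ : MultiVF U} (hμ : μ ∈ kVF U k) :
    taylorAt x₀ k (partB U μ) ∈ polyW U k := by
  obtain ⟨a, ha, b, hb, rfl⟩ := exists_eq_vf_mul_add hμ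
  rw [partB_apply ha hb]
  exact taylorAt_mem x₀ hb

/-- The map `∂_t ∧ a + b ↦ [T a] ⊕ [T b]` on cocycles. -/
def taylorMap (x₀ : U) (k : ℤ) : cocycles U k →ₗ[ℝ] QuotW U (k - 1) × QuotW U k :=
  ((Submodule.mkQ _).comp (LinearMap.codRestrict (polyW U (k - 1))
    (((taylorAt x₀ (k - 1)).comp (partA U)).domRestrict (cocycles U k))
    fun μ => taylorAt_partA_mem x₀ μ.2.1)).prod
  ((Submodule.mkQ _).comp (LinearMap.codRestrict (polyW U k)
    (((taylorAt x₀ k).comp (partB U)).domRestrict (cocycles U k))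
    fun μ => taylorAt_partB_mem x₀ μ.2.1))

theorem taylorMap_apply (x₀ : U) {k : ℤ} {a b : MultiVF U} (ha : a ∈ tens ⊤ (k - 1))
    (hb : b ∈ tens ⊤ k) (hμ : vf U none * a + b ∈ cocycles U k) :
    taylorMap x₀ k ⟨_, hμ⟩ =
      (QuotW.mk _ (taylorAt_mem x₀ ha), QuotW.mk _ (taylorAt_mem x₀ hb)) := by
  refine Prod.ext ?_ ?_
  · refine congrArg Submodule.Quotient.mk (Subtype.ext ?_)
    exact congrArg (taylorAt x₀ (k - 1)) (partA_apply ha hb)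
  · refine congrArg Submodule.Quotient.mk (Subtype.ext ?_)
    exact congrArg (taylorAt x₀ k) (partB_apply ha hb)

theorem QuotW.mk_eq_zero_iff {k : ℤ} {a : MultiVF U} (ha : a ∈ polyW U k) :
    QuotW.mk a ha = 0 ↔ a ∈ eulerW U (k - 1) :=
  Submodule.Quotient.mk_eq_zero _

theorem QuotW.mk_congr {k : ℤ} {a a' : MultiVF U} (h : a = a') (ha : a ∈ polyW U k)
    (ha' : a' ∈ polyW U k) : QuotW.mk a ha = QuotW.mk a' ha' := by
  subst h
  rfl

theorem taylorMap_polyW (x₀ : U) {k : ℤ} {a b : MultiVF U} (ha : a ∈ polyW U (k - 1))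
    (hb : b ∈ polyW U k) :
    taylorMap x₀ k ⟨_, vf_mul_add_mem_cocycles ha hb⟩ = (QuotW.mk a ha, QuotW.mk b hb) := by
  rw [taylorMap_apply x₀ (polyW_le_top _ ha) (polyW_le_top _ hb)]
  exact Prod.ext (QuotW.mk_congr (taylorAt_polyW x₀ ha) _ _)
    (QuotW.mk_congr (taylorAt_polyW x₀ hb) _ _)

theorem taylorMap_coboundaries (x₀ : U) (hx₀ : (x₀ : Space m).2 = 0) {k : ℤ} :
    (coboundaries U k).submoduleOf (cocycles U k) ≤ LinearMap.ker (taylorMap x₀ k) := by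
  rintro ⟨μ, hμ⟩ h
  obtain ⟨a, ha, b, hb, rfl⟩ := exists_of_mem_coboundaries (x := μ) h
  have hA : eulerM U (-(k - 1)) b + euler U * pderivM U none a ∈ tens ⊤ (k - 1) :=
    Submodule.add_mem _ (eulerM_mem_tens_top _ hb)
      (euler_mul_mem_tens_top_of_sub (pderivM_mem_tens_top none ha))
  have hB : -(euler U * pderivM U none b) ∈ tens ⊤ k :=
    Submodule.neg_mem _ (euler_mul_mem_tens_top_of_sub (pderivM_mem_tens_top none hb))
  rw [LinearMap.mem_ker, taylorMap_apply x₀ hA hB, Prod.mk_eq_zero, QuotW.mk_eq_zero_iff,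
    QuotW.mk_eq_zero_iff]
  constructor
  · have h0 := taylorAt_eulerM x₀ hx₀ (k - 1) b
    push_cast at h0
    rw [map_add, h0, zero_add, taylorAt_euler_mul x₀ hx₀]
    exact ⟨_, taylorAt_mem x₀ (pderivM_mem_tens_top none ha), rfl⟩
  · rw [map_neg, taylorAt_euler_mul x₀ hx₀]
    exact Submodule.neg_mem _ ⟨_, taylorAt_mem x₀ (pderivM_mem_tens_top none hb), rfl⟩

/-- The map `[∂_t ∧ a + b] ↦ [T a] ⊕ [T b]` on the Poisson cohomology. -/
def taylorCohomology (x₀ : U) (hx₀ : (x₀ : Space m).2 = 0) (k : ℤ) :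
    Cohomology U k →ₗ[ℝ] QuotW U (k - 1) × QuotW U k :=
  Submodule.liftQ _ (taylorMap x₀ k) (taylorMap_coboundaries x₀ hx₀)

theorem taylorCohomology_mk (x₀ : U) (hx₀ : (x₀ : Space m).2 = 0) {k : ℤ} (μ : MultiVF U)
    (hμ : μ ∈ cocycles U k) :
    taylorCohomology x₀ hx₀ k (Cohomology.mk μ hμ) = taylorMap x₀ k ⟨μ, hμ⟩ :=
  Submodule.liftQ_apply _ _ _

theorem taylorCohomology_bijective (hU : ConnectedFibers U)
    (hstar : StarConvex ℝ 0 (Prod.snd '' (U : Set (Space m)))) (hm : 1 ≤ m) (x₀ : U)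
    (hx₀ : (x₀ : Space m).2 = 0) (k : ℤ) : Function.Bijective (taylorCohomology x₀ hx₀ k) := by
  constructor
  · rw [← LinearMap.ker_eq_bot, LinearMap.ker_eq_bot']
    intro c hc
    obtain ⟨⟨μ, hμ⟩, rfl⟩ := Submodule.Quotient.mk_surjective _ c
    obtain ⟨a, ha, b, hb, rfl⟩ := exists_eq_vf_mul_add hμ.1
    -- On a polynomial representative the map only takes classes, so a zero image puts w₁ and w₂
    -- into E∧𝕎, where they give a coboundary.
    obtain ⟨w₁, hw₁, w₂, hw₂, h⟩ := exists_sub_mem_coboundaries hU hstar hm x₀ hx₀ ha hb hμ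
    have heq : (Submodule.Quotient.mk ⟨_, hμ⟩ : Cohomology U k) =
        Cohomology.mk _ (vf_mul_add_mem_cocycles hw₁ hw₂) :=
      (Submodule.Quotient.eq _).2 h
    rw [heq, taylorCohomology_mk, taylorMap_polyW x₀ hw₁ hw₂, Prod.mk_eq_zero,
      QuotW.mk_eq_zero_iff, QuotW.mk_eq_zero_iff] at hc
    obtain ⟨σ, hσ⟩ := hU.exists_isSection
    rw [heq]
    exact (Submodule.Quotient.mk_eq_zero _).2 (vf_mul_add_mem_coboundaries hσ hU hc.1 hc.2)
  · rintro ⟨c₁, c₂⟩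
    obtain ⟨⟨w₁, hw₁⟩, rfl⟩ := Submodule.Quotient.mk_surjective _ c₁
    obtain ⟨⟨w₂, hw₂⟩, rfl⟩ := Submodule.Quotient.mk_surjective _ c₂
    exact ⟨Cohomology.mk _ (vf_mul_add_mem_cocycles hw₁ hw₂), by
      rw [taylorCohomology_mk, taylorMap_polyW]; rfl⟩

end BookPoisson
end

theorem theorem3p6 (n : ℕ) (hn : 2 ≤ n)
    (U : TopologicalSpace.Opens (BookPoisson.Space (n - 1)))
    (hfib : ∀ u ∈ Prod.snd '' (U : Set (BookPoisson.Space (n - 1))),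
      IsConnected ((U : Set (BookPoisson.Space (n - 1))) ∩ Prod.snd ⁻¹' {u}))
    (hstar : StarConvex ℝ 0 (Prod.snd '' (U : Set (BookPoisson.Space (n - 1)))))
    (t₀ : ℝ) (ht₀ : ((t₀, 0) : BookPoisson.Space (n - 1)) ∈ U) (k : ℕ) :
    ∃ Φ : BookPoisson.Cohomology U (k : ℤ) ≃ₗ[ℝ]
        BookPoisson.QuotW U ((k : ℤ) - 1) × BookPoisson.QuotW U (k : ℤ),
      -- the map is given on the class of `∂_t ∧ a + b` by the Taylor operators at `t = t₀`
      (∀ a ∈ BookPoisson.horizontal U ((k : ℤ) - 1), ∀ b ∈ BookPoisson.horizontal U (k : ℤ),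
        ∀ hμ : BookPoisson.vf U none * a + b ∈ BookPoisson.cocycles U (k : ℤ),
        ∃ (ha : BookPoisson.taylorAt ⟨(t₀, 0), ht₀⟩ ((k : ℤ) - 1) a
              ∈ BookPoisson.polyW U ((k : ℤ) - 1))
          (hb : BookPoisson.taylorAt ⟨(t₀, 0), ht₀⟩ (k : ℤ) b ∈ BookPoisson.polyW U (k : ℤ)),
          Φ (BookPoisson.Cohomology.mk _ hμ) =
            (BookPoisson.QuotW.mk _ ha, BookPoisson.QuotW.mk _ hb)) ∧
      -- the inverse map
      (∀ (a : BookPoisson.MultiVF U) (ha : a ∈ BookPoisson.polyW U ((k : ℤ) - 1))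
        (b : BookPoisson.MultiVF U) (hb : b ∈ BookPoisson.polyW U (k : ℤ)),
        ∃ hμ : BookPoisson.vf U none * a + b ∈ BookPoisson.cocycles U (k : ℤ),
          Φ.symm (BookPoisson.QuotW.mk a ha, BookPoisson.QuotW.mk b hb) =
            BookPoisson.Cohomology.mk _ hμ) := by
  refine ⟨LinearEquiv.ofBijective (BookPoisson.taylorCohomology ⟨(t₀, 0), ht₀⟩ rfl k)
    (BookPoisson.taylorCohomology_bijective hfib hstar (by omega) _ rfl k), ?_, ?_⟩
  · intro a ha b hb hμ
    rw [BookPoisson.horizontal_eq] at ha hb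
    refine ⟨BookPoisson.taylorAt_mem _ ha, BookPoisson.taylorAt_mem _ hb, ?_⟩
    rw [LinearEquiv.ofBijective_apply, BookPoisson.taylorCohomology_mk]
    exact BookPoisson.taylorMap_apply _ ha hb hμ
  · intro a ha b hb
    refine ⟨BookPoisson.vf_mul_add_mem_cocycles ha hb, ?_⟩
    rw [LinearEquiv.symm_apply_eq, LinearEquiv.ofBijective_apply, BookPoisson.taylorCohomology_mk,
      BookPoisson.taylorMap_polyW]
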